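/- Let $n\ge 2$ and let $M$ be a smooth $n$-dimensional manifold without boundary. Let $\alpha(x,y)=\sqrt{a_{ij}(x)y^iy^j}$ be a smooth Riemannian metric and $\beta=b_i(x)y^i$ a smooth nowhere vanishing 1-form on $M$, and let $F=\alpha^2/\beta$ be the corresponding Kropina metric, considered on the domain $\{\beta(y)>0\}\subset TM$ (since $n\ge2$, $F$ is never Riemannian). For a (conic) Finsler metric $F$ put, in local coordinates $(x^i,y^i)$, $g_{ij}=\tfrac12[F^2]_{y^iy^j}$, $(g^{ij})=(g_{ij})^{-1}$, $$G^i=\tfrac14 g^{il}\{[F^2]_{x^ky^l}y^k-[F^2]_{x^l}\},\qquad R^i{}_k=2\frac{\partial G^i}{\partial x^k}-\frac{\partial^2G^i}{\partial x^m\partial y^k}y^m+2G^m\frac{\partial^2G^i}{\partial y^m\partial y^k}-\frac{\partial G^i}{\partial y^m}\frac{\partial G^m}{\partial y^k},\qquad \mathrm{Ric}=R^m{}_m .$$ $F$ is Einstein with Einstein scalar $\sigma$ if $\mathrm{Ric}=\sigma F^2$ on the domain of $F$ for a function $\sigma=\sigma(x)$ on $M$, and Ricci constant if this holds with $\sigma$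 constant; a Riemannian metric $h$ is Einstein with Einstein scalar $\delta$ if this holds for $F=\sqrt{h_{ij}y^iy^j}$, on the nonzero tangent vectors, with the function $\delta$ on $M$. Let $(h,W)$ be the navigation data of $F$: $h$ is a smooth Riemannian metric and $W$ a smooth vector field on $M$ such that $\|W\|_h=1$ and $\left\|\frac{y}{F(x,y)}-W_x\right\|_h=1$ for all $x\in M$ and $y\in T_xM$ with $\beta(y)>0$. Then: 1. $F$ is Einstein if and only if $h$ is Einstein and $W$ is a unit Killing vector field of $h$, that is, $\|W\|_h=1$ and $W_{i;j}+W_{j;i}=0$, where $W_i=h_{ij}W^j$ and the semicolon denotes the Levi-Civita covariant derivative of $h$. 2. In this case, if $\sigma$ and $\delta$ are the Einstein scalars of $F$ and of $h$, then $\sigma=\delta\ge0$ on $M$. 3. If $n\ge3$, $M$ is connected and $F$ is Einstein, then $F$ is Ricci constant. -/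

import Mathlib

open scoped Manifold ContDiff Bundle

noncomputable section

namespace Kropina

/-! ### Finsler geometry in local coordinates

A function of a point `p` and a tangent vector `v` in a coordinate domain is a curried function
`E n → E n → ℝ`. -/

/-- The coordinate space `ℝⁿ`. -/
abbrev E (n : ℕ) : Type := EuclideanSpace ℝ (Fin n)

section Coordinates

variable {n : ℕ}

/-- The partial derivative `∂f/∂xⁱ` in the position variable. -/
def dX (i : Fin n) (f : E n → E n → ℝ) : E n → E n → ℝ :=
  fun p v => fderiv ℝ (fun q => f q v) p (EuclideanSpace.single i 1)

/-- The partial derivative `∂f/∂yⁱ` in the velocity variable. -/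
def dY (i : Fin n) (f : E n → E n → ℝ) : E n → E n → ℝ :=
  fun p v => fderiv ℝ (fun w => f p w) v (EuclideanSpace.single i 1)

/-- The square `F²`. -/
def sqF (F : E n → E n → ℝ) : E n → E n → ℝ := fun p v => F p v ^ 2

/-- The fundamental tensor `g_{ij} = ½ [F²]_{yⁱ yʲ}`. -/
def fundamentalTensor (F : E n → E n → ℝ) (p v : E n) : Matrix (Fin n) (Fin n) ℝ :=
  Matrix.of fun i j => (1 / 2 : ℝ) * dY i (dY j (sqF F)) p v

/-- The geodesic coefficients `Gⁱ = ¼ g^{il} ([F²]_{x^k y^l} y^k - [F²]_{x^l})`. -/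
def geodesicCoeff (F : E n → E n → ℝ) (i : Fin n) : E n → E n → ℝ :=
  fun p v => (1 / 4 : ℝ) * ∑ l, (fundamentalTensor F p v)⁻¹ i l *
    ((∑ k, dX k (dY l (sqF F)) p v * v k) - dX l (sqF F) p v)

/-- The Riemann curvature
`Rⁱ_k = 2 ∂Gⁱ/∂x^k - y^m ∂²Gⁱ/∂x^m∂y^k + 2 G^m ∂²Gⁱ/∂y^m∂y^k - ∂Gⁱ/∂y^m ∂G^m/∂y^k`. -/
def riemannCurvature (F : E n → E n → ℝ) (i k : Fin n) : E n → E n → ℝ :=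
  fun p v =>
    2 * dX k (geodesicCoeff F i) p v
      - (∑ m, dX m (dY k (geodesicCoeff F i)) p v * v m)
      + 2 * (∑ m, geodesicCoeff F m p v * dY m (dY k (geodesicCoeff F i)) p v)
      - ∑ m, dY m (geodesicCoeff F i) p v * dY k (geodesicCoeff F m) p v

/-- The Ricci curvature `Ric = R^m_m`. -/
def ricciCurvature (F : E n → E n → ℝ) (p v : E n) : ℝ :=
  ∑ m, riemannCurvature F m m p v

/-- The partial derivative `∂f/∂xⁱ` of a function of the position only. -/
def dPos (i : Fin n) (f : E n → ℝ) (p : E n) : ℝ :=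
  fderiv ℝ f p (EuclideanSpace.single i 1)

/-- The Christoffel symbols
`Γ^k_{ij} = ½ g^{kl} (∂_i g_{jl} + ∂_j g_{il} - ∂_l g_{ij})` of a matrix of functions `g`. -/
def christoffel (g : E n → Matrix (Fin n) (Fin n) ℝ) (k i j : Fin n) (p : E n) : ℝ :=
  (1 / 2 : ℝ) * ∑ l, (g p)⁻¹ k l *
    (dPos i (fun q => g q j l) p + dPos j (fun q => g q i l) p - dPos l (fun q => g q i j) p)

/-- The covariant derivative `w_{i;j} = ∂_j w_i - Γ^k_{ij} w_k` of a covector field `w`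
with respect to the Levi-Civita connection of `g`. -/
def covDeriv (g : E n → Matrix (Fin n) (Fin n) ℝ) (w : Fin n → E n → ℝ) (i j : Fin n)
    (p : E n) : ℝ :=
  dPos j (w i) p - ∑ k, christoffel g k i j p * w k p

end Coordinates

/-! ### Objects on a smooth `n`-manifold -/

section Manifold

variable {n : ℕ} (M : Type*) [TopologicalSpace M] [ChartedSpace (E n) M] [IsManifold (𝓡 n) ∞ M]

/-- Smooth Riemannian metrics on `M`. -/
abbrev Metric : Type _ :=
  Bundle.ContMDiffRiemannianMetric (𝓡 n) ∞ (E n) (fun x : M => TangentSpace (𝓡 n) x)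

/-- Smooth vector fields on `M`. -/
abbrev VField : Type _ :=
  ContMDiffSection (𝓡 n) (E n) ∞ (fun x : M => TangentSpace (𝓡 n) x)

/-- Smooth `1`-forms on `M`. -/
abbrev OneForm : Type _ :=
  ContMDiffSection (𝓡 n) (E n →L[ℝ] ℝ) ∞
    (fun x : M => TangentSpace (𝓡 n) x →L[ℝ] Bundle.Trivial M ℝ x)

variable {M}

/-- The norm `√(h_x(y, y))` of a tangent vector. -/
def Metric.norm (h : Metric (n := n) M) (x : M) (y : TangentSpace (𝓡 n) x) : ℝ :=
  √(h.inner x y y)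

/-- The Kropina function `F = α² / β`, where `α = √(a_{ij} yⁱ yʲ)`. It is only considered on the
domain `β > 0`. -/
def kropina (a : Metric (n := n) M) (β : OneForm (n := n) M) (x : M)
    (y : TangentSpace (𝓡 n) x) : ℝ :=
  a.norm x y ^ 2 / β x y

/-- The domain `β > 0` of a Kropina metric. -/
def kropinaDomain (β : OneForm (n := n) M) (x : M) : Set (TangentSpace (𝓡 n) x) :=
  {y | 0 < β x y}

variable (M) in
/-- The nonzero tangent vectors, the domain of a Riemannian metric. -/
def slitDomain (x : M) : Set (TangentSpace (𝓡 n) x) := {y | y ≠ 0}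

/-- The tangent vector of `M` at `e⁻¹(p)` with coordinates `v` in the chart `e`. -/
def ofCoord (e : OpenPartialHomeomorph M (E n)) (p v : E n) :
    TangentSpace (𝓡 n) (e.symm p) :=
  mfderiv (𝓡 n) (𝓡 n) e.symm p v

/-- The expression of a function on `TM` in the chart `e`. -/
def inChart (e : OpenPartialHomeomorph M (E n)) (F : ∀ x : M, TangentSpace (𝓡 n) x → ℝ) :
    E n → E n → ℝ :=
  fun p v => F (e.symm p) (ofCoord e p v)

/-- The components `h_{ij}` of a metric in the chart `e`. -/
def metricCoord (h : Metric (n := n) M) (e : OpenPartialHomeomorph M (E n)) (p : E n) :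
    Matrix (Fin n) (Fin n) ℝ :=
  Matrix.of fun i j => h.inner (e.symm p) (ofCoord e p (EuclideanSpace.single i 1))
    (ofCoord e p (EuclideanSpace.single j 1))

/-- The components `W_i = h_{ij} Wʲ` of a vector field in the chart `e`, with index lowered. -/
def lowerCoord (h : Metric (n := n) M) (W : VField (n := n) M)
    (e : OpenPartialHomeomorph M (E n)) (i : Fin n) (p : E n) : ℝ :=
  h.inner (e.symm p) (W (e.symm p)) (ofCoord e p (EuclideanSpace.single i 1))

/-- `F`, considered on the domain `D` in `TM`, satisfies `Ric = σ F²` for the function `σ` on `M`: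
this holds for the Ricci curvature computed in every smooth chart of `M`. -/
def IsEinsteinWith (D : ∀ x : M, Set (TangentSpace (𝓡 n) x))
    (F : ∀ x : M, TangentSpace (𝓡 n) x → ℝ) (σ : M → ℝ) : Prop :=
  ∀ e ∈ IsManifold.maximalAtlas (𝓡 n) ∞ M, ∀ p ∈ e.target, ∀ v : E n,
    ofCoord e p v ∈ D (e.symm p) →
      ricciCurvature (inChart e F) p v = σ (e.symm p) * inChart e F p v ^ 2

/-- `F` is Einstein on the domain `D`. -/
def IsEinstein (D : ∀ x : M, Set (TangentSpace (𝓡 n) x))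
    (F : ∀ x : M, TangentSpace (𝓡 n) x → ℝ) : Prop :=
  ∃ σ : M → ℝ, IsEinsteinWith D F σ

/-- `F` is Ricci constant on the domain `D`: `Ric = c F²` with a constant `c`. -/
def IsRicciConstant (D : ∀ x : M, Set (TangentSpace (𝓡 n) x))
    (F : ∀ x : M, TangentSpace (𝓡 n) x → ℝ) : Prop :=
  ∃ c : ℝ, IsEinsteinWith D F (fun _ => c)

/-- `W` has unit length with respect to `h`. -/
def IsUnitField (h : Metric (n := n) M) (W : VField (n := n) M) : Prop :=
  ∀ x, h.norm x (W x) = 1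

/-- `W` is a Killing vector field of `h`: `W_{i;j} + W_{j;i} = 0` in every smooth chart. -/
def IsKilling (h : Metric (n := n) M) (W : VField (n := n) M) : Prop :=
  ∀ e ∈ IsManifold.maximalAtlas (𝓡 n) ∞ M, ∀ p ∈ e.target, ∀ i j : Fin n,
    covDeriv (metricCoord h e) (lowerCoord h W e) i j p
      + covDeriv (metricCoord h e) (lowerCoord h W e) j i p = 0

/-- `(h, W)` is the navigation data of `F = α²/β`: `W` has `h`-length one, and `F` solves the
navigation problem `‖y / F(x, y) - W_x‖_h = 1` for all `y` with `β(y) > 0`. -/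
def IsNavigationData (a : Metric (n := n) M) (β : OneForm (n := n) M)
    (h : Metric (n := n) M) (W : VField (n := n) M) : Prop :=
  IsUnitField h W ∧
    ∀ x, ∀ y ∈ kropinaDomain β x, h.norm x ((kropina a β x y)⁻¹ • y - W x) = 1

end Manifold

end Kropina

end

/-! ### Sprays and their Ricci curvature over an algebra with position and velocity derivations -/

noncomputable section

/-! Write w = h(W, ·). Squaring the navigation equation gives h(y,y) = 2F w(y), so F = h(y,y) /
(2w(y)), and the half space β > 0 is w > 0. Everything follows from this formula.

Put r = h(∇_y W, y). The spray coefficients of F are those of h plus a field V plus a multiple p y,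
where p = ρ - 2 r w(y) / h(y,y). The factor p is the only place where h(y,y) is a denominator. The
formula for projective changes of Ricci curvature then gives h(y,y)² · 4 Ric = 12(n-1)(r w(y))² +
h(y,y) a with a polynomial in y and 1/w(y) (`exists_h2_sq_mul_ric4`). Suppose Ric = σF², and
restrict to a line W + t x with x a unit vector orthogonal to W. There w(y) = 1, h(y,y) = 1 + t² and
r = bt + ct², without constant term because W has constant length. So 1 + t² divides (bt + ct²)²,
and t = i gives b = c = 0. Since x is arbitrary, r = 0, that is, W is Killing
(`killing_of_einstein`).

If W is Killing, then r = ρ = 0, no projective term is needed, and V = -2F ∇_y W. With div ∇W =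
Ric(W) and Ric(W,W) = -tr (∇W)² the curvature collapses to Ric_F(y) = Ric_h(y - FW, y - FW)
(`ric4_of_killing`). The vectors y - FW with F(y) = 1 are the h-unit vectors other than -W, so F and
h are Einstein together and with the same scalar. That scalar is Ric(W,W) = -tr (∇W)², which is
nonnegative since ∇W is skew, and Schur's lemma for h makes it locally constant when n ≥ 3.

The computations take place in an abstract algebra with commuting derivations, where they are ring
identities. Smooth functions on an open set of positions and velocities form such an algebra. A
candidate spray is recognised as the true one by its Euler-Lagrange equation and the nondegeneracy
of the fundamental tensor (`rep_geodesicCoeff`, `isUnit_det_kropina`). -/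

/-- A commutative algebra with the formal properties of the algebra of smooth functions of a
position and a velocity in `ℝⁿ`: it has commuting partial derivatives in both variables, and the
velocity coordinates. -/
structure VelocityAlgebra (n : ℕ) (A : Type*) [CommRing A] [Algebra ℝ A] where
  X : Fin n → Derivation ℝ A A
  Y : Fin n → Derivation ℝ A A
  y : Fin n → A
  XX : ∀ i j a, X i (X j a) = X j (X i a)
  XY : ∀ i j a, X i (Y j a) = Y j (X i a)
  YY : ∀ i j a, Y i (Y j a) = Y j (Y i a)
  Xy : ∀ i j, X i (y j) = 0
  Yy : ∀ i j, Y i (y j) = if i = j then 1 else 0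

namespace VelocityAlgebra

variable {n : ℕ} {A : Type*} [CommRing A] [Algebra ℝ A]

variable (A) in
/-- The element `1/2`. -/
def half : A := algebraMap ℝ A 2⁻¹

variable (A) in
lemma two_mul_half : (2 : A) * half A = 1 := by
  have h : ((2 : ℝ) * 2⁻¹) = 1 := by norm_num
  have := congrArg (algebraMap ℝ A) h
  rwa [map_mul, map_ofNat, map_one] at this

lemma two_mul_cancel {a b : A} (h : 2 * a = 2 * b) : a = b := by
  linear_combination half A * h - (a - b) * two_mul_half A

@[simp] lemma derivation_half (D : Derivation ℝ A A) : D (half A) = 0 := D.map_algebraMap _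

variable (T : VelocityAlgebra n A)

/-- The second order vector field `yᵏ ∂/∂xᵏ - Kᵏ ∂/∂yᵏ`. -/
def spray (K : Fin n → A) : Derivation ℝ A A := ∑ k, (T.y k • T.X k - K k • T.Y k)

lemma spray_apply (K : Fin n → A) (a : A) :
    T.spray K a = ∑ k, (T.y k * T.X k a - K k * T.Y k a) := by
  have : T.spray K a = ∑ k, (T.y k • T.X k - K k • T.Y k) a := by
    simp only [spray]
    induction (Finset.univ : Finset (Fin n)) using Finset.induction_on with
    | empty => simp
    | insert i s hi ih => rw [Finset.sum_insert hi, Finset.sum_insert hi, Derivation.add_apply, ih]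
  rw [this]; rfl

/-- The Euler operator `yᵏ ∂/∂yᵏ`. -/
def euler : Derivation ℝ A A := ∑ k, T.y k • T.Y k

lemma euler_apply (a : A) : T.euler a = ∑ k, T.y k * T.Y k a := by
  have : T.euler a = ∑ k, (T.y k • T.Y k) a := by
    simp only [euler]
    induction (Finset.univ : Finset (Fin n)) using Finset.induction_on with
    | empty => simp
    | insert i s hi ih => rw [Finset.sum_insert hi, Finset.sum_insert hi, Derivation.add_apply, ih]
  rw [this]; rfl

@[simp] lemma spray_y (K : Fin n → A) (m : Fin n) : T.spray K (T.y m) = -K m := by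
  simp [spray_apply, T.Xy, T.Yy]

lemma spray_add (K Q : Fin n → A) (a : A) :
    T.spray (K + Q) a = T.spray K a - ∑ k, Q k * T.Y k a := by
  simp only [spray_apply, ← Finset.sum_sub_distrib, Pi.add_apply]
  exact Finset.sum_congr rfl fun _ _ => by ring

@[simp] lemma euler_y (m : Fin n) : T.euler (T.y m) = T.y m := by
  simp [euler_apply, T.Yy]

/-- The elements which depend on the position only. -/
def basic : Subalgebra ℝ A where
  carrier := {a | ∀ k, T.Y k a = 0}
  mul_mem' ha hb k := by simp [ha k, hb k]
  add_mem' ha hb k := by simp [ha k, hb k]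
  algebraMap_mem' r k := by simp

variable {T}

lemma basic.Y {a : A} (ha : a ∈ T.basic) (k : Fin n) : T.Y k a = 0 := ha k

lemma basic.X {a : A} (ha : a ∈ T.basic) (k : Fin n) : T.X k a ∈ T.basic := fun j => by
  rw [← T.XY, ha j, map_zero]

lemma basic.euler {a : A} (ha : a ∈ T.basic) : T.euler a = 0 := by
  simp [euler_apply, basic.Y ha]

lemma basic.spray {a : A} (ha : a ∈ T.basic) (K : Fin n → A) :
    T.spray K a = ∑ k, T.y k * T.X k a := by
  simp [spray_apply, basic.Y ha]

lemma half_mem_basic : half A ∈ T.basic := T.basic.algebraMap_mem _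

variable (T)

/-- Four times the Ricci curvature of the spray with coefficients `K = 2G`. -/
def ric4 (K : Fin n → A) : A :=
  4 * ∑ m, T.X m (K m) - 2 * T.spray K (∑ m, T.Y m (K m)) - ∑ m, ∑ k, T.Y k (K m) * T.Y m (K k)

/-- The change of the Ricci curvature when a vector field is added to a spray. -/
lemma ric4_add (K Q : Fin n → A) :
    T.ric4 (K + Q) = T.ric4 K + 4 * ∑ m, T.X m (Q m) - 2 * T.spray K (∑ m, T.Y m (Q m))
      + 2 * ∑ k, Q k * T.Y k (∑ m, T.Y m (K m)) + 2 * ∑ k, Q k * T.Y k (∑ m, T.Y m (Q m))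
      - 2 * (∑ m, ∑ k, T.Y k (K m) * T.Y m (Q k)) - ∑ m, ∑ k, T.Y k (Q m) * T.Y m (Q k) := by
  have h1 : ∑ m, ∑ k, T.Y k (K m + Q m) * T.Y m (K k + Q k) =
      ∑ m, ∑ k, T.Y k (K m) * T.Y m (K k) + 2 * (∑ m, ∑ k, T.Y k (K m) * T.Y m (Q k))
      + ∑ m, ∑ k, T.Y k (Q m) * T.Y m (Q k) := by
    have h2 : ∑ m, ∑ k, T.Y k (K m) * T.Y m (Q k) = ∑ m, ∑ k, T.Y k (Q m) * T.Y m (K k) := by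
      rw [Finset.sum_comm]
      exact Finset.sum_congr rfl fun _ _ => Finset.sum_congr rfl fun _ _ => mul_comm _ _
    rw [two_mul]
    nth_rewrite 2 [h2]
    simp only [← Finset.sum_add_distrib]
    exact Finset.sum_congr rfl fun _ _ => Finset.sum_congr rfl fun _ _ => by
      simp only [map_add]; ring
  simp only [map_add] at h1
  simp only [ric4, spray_add, Pi.add_apply, map_add, h1]
  simp only [Finset.sum_add_distrib, map_add, mul_add]
  ring

/-- The projective change of the Ricci curvature. -/
lemma ric4_add_smul_y (K : Fin n → A) (p : A) (hK : ∀ m, T.euler (K m) = 2 * K m)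
    (hp : T.euler p = p) :
    T.ric4 (K + fun m => p * T.y m) = T.ric4 K + ((n : A) - 1) * (p ^ 2 - 2 * T.spray K p) := by
  have hdiv : ∑ m, T.Y m (p * T.y m) = (n + 1 : A) * p := by
    simp only [Derivation.leibniz, T.Yy, smul_eq_mul, Finset.sum_add_distrib, ← T.euler_apply, hp]
    simp; ring
  -- The divergence of a 2-homogeneous field is 1-homogeneous: differentiate Euler's identity for
  -- K^m in y^m.
  have hdK : T.euler (∑ m, T.Y m (K m)) = ∑ m, T.Y m (K m) := by
    have : ∀ m, T.euler (T.Y m (K m)) = T.Y m (K m) := fun m => by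
      have h1 := congrArg (T.Y m) (hK m)
      rw [euler_apply, map_sum, two_mul, map_add] at h1
      simp only [Derivation.leibniz, T.Yy, smul_eq_mul, Finset.sum_add_distrib] at h1
      simp at h1
      rw [euler_apply]
      simp only [T.YY _ m]
      linear_combination h1
    rw [map_sum]; exact Finset.sum_congr rfl fun m _ => this m
  have hX : ∑ m, T.X m (p * T.y m) = ∑ m, T.y m * T.X m p := by simp [T.Xy]
  have h1 : ∑ k, p * T.y k * T.Y k (∑ m, T.Y m (K m)) = p * ∑ m, T.Y m (K m) := by
    simp only [mul_assoc, ← Finset.mul_sum, ← T.euler_apply, hdK]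
  have h2 : ∑ k, p * T.y k * T.Y k ((n + 1 : A) * p) = (n + 1) * p ^ 2 := by
    simp only [mul_assoc, ← Finset.mul_sum, ← T.euler_apply]
    simp [hp]; ring
  have h3 : ∑ m, ∑ k, T.Y k (K m) * T.Y m (p * T.y k) =
      2 * ∑ m, K m * T.Y m p + p * ∑ m, T.Y m (K m) := by
    simp only [Derivation.leibniz, T.Yy, smul_eq_mul, mul_add, Finset.sum_add_distrib]
    rw [add_comm, Finset.mul_sum, Finset.mul_sum]
    congr 1
    · refine Finset.sum_congr rfl fun m _ => ?_
      have := hK m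
      rw [euler_apply] at this
      rw [← mul_assoc, ← this, Finset.sum_mul]
      exact Finset.sum_congr rfl fun k _ => by ring
    · refine Finset.sum_congr rfl fun m _ => ?_
      simp; ring
  -- This is the trace of the square of p·1 + y ⊗ dp: n p² from the identity, 2p² from the cross
  -- terms, p² from the rank-one part.
  have h4 : ∑ m, ∑ k, T.Y k (p * T.y m) * T.Y m (p * T.y k) = (n + 3) * p ^ 2 := by
    have e : ∀ m k, T.Y k (p * T.y m) * T.Y m (p * T.y k) =
        (T.y m * T.Y m p) * (T.y k * T.Y k p) + (if k = m then 2 * p * (T.y k * T.Y k p) + p ^ 2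
          else 0) := fun m k => by
      simp only [Derivation.leibniz, T.Yy, smul_eq_mul]
      rcases eq_or_ne k m with rfl | hkm
      · simp; ring
      · simp [hkm, hkm.symm]; ring
    simp only [e, Finset.sum_add_distrib, ← Finset.mul_sum, ← Finset.sum_mul, ← T.euler_apply, hp,
      Finset.sum_ite_eq', Finset.mem_univ, if_true]
    simp; ring
  have h5 : T.spray K p = ∑ m, T.y m * T.X m p - ∑ m, K m * T.Y m p := by
    rw [spray_apply, Finset.sum_sub_distrib]
  have h6 : T.spray K ((n + 1 : A) * p) = (n + 1) * T.spray K p := by simp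
  rw [ric4_add, hdiv, hX, h1, h2, h3, h4, h6, h5]
  ring

end VelocityAlgebra

end

/-! ### Levi-Civita connections: Bianchi identities, Schur's lemma, divergence of ∇W -/

noncomputable section

open Matrix

section DerivationMatrix

variable {A ι : Type*} [CommRing A] [Algebra ℝ A]

lemma Derivation.map_matrix_add (D : Derivation ℝ A A) (M N : Matrix ι ι A) :
    (M + N).map D = M.map D + N.map D := by
  ext i j; simp

lemma Derivation.map_matrix_sub (D : Derivation ℝ A A) (M N : Matrix ι ι A) :
    (M - N).map D = M.map D - N.map D := by
  ext i j; simp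

variable [Fintype ι]

lemma Derivation.map_dotProduct (D : Derivation ℝ A A) (u v : ι → A) :
    D (u ⬝ᵥ v) = (fun i => D (u i)) ⬝ᵥ v + u ⬝ᵥ fun i => D (v i) := by
  simp only [dotProduct, map_sum, Derivation.leibniz, smul_eq_mul, ← Finset.sum_add_distrib]
  exact Finset.sum_congr rfl fun _ _ => by ring

lemma Derivation.map_mulVec (D : Derivation ℝ A A) (M : Matrix ι ι A) (v : ι → A) (i : ι) :
    D ((M *ᵥ v) i) = (M.map D *ᵥ v) i + (M *ᵥ fun j => D (v j)) i :=
  D.map_dotProduct _ _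

lemma Derivation.map_matrix_mul (D : Derivation ℝ A A) (M N : Matrix ι ι A) :
    (M * N).map D = M.map D * N + M * N.map D := by
  ext i j
  simpa [Matrix.mul_apply, dotProduct] using D.map_dotProduct (M i) (fun k => N k j)

end DerivationMatrix

/-- A metric `h` with inverse `hi` and Levi-Civita connection `Γ`, where `Γ i k j` is the
Christoffel symbol `Γᵏᵢⱼ`. -/
structure MetricData {n : ℕ} {A : Type*} [CommRing A] [Algebra ℝ A]
    (X : Fin n → Derivation ℝ A A) where
  comm : ∀ i j a, X i (X j a) = X j (X i a)
  h : Matrix (Fin n) (Fin n) A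
  hi : Matrix (Fin n) (Fin n) A
  Γ : Fin n → Matrix (Fin n) (Fin n) A
  symm : hᵀ = h
  mul_hi : h * hi = 1
  torsion : ∀ i j k, Γ i k j = Γ j k i
  compat : ∀ k, h.map (X k) = h * Γ k + (Γ k)ᵀ * h

namespace MetricData

variable {n : ℕ} {A : Type*} [CommRing A] [Algebra ℝ A] {X : Fin n → Derivation ℝ A A}
  (g : MetricData X)

/-- The curvature endomorphisms `R(∂ᵢ, ∂ⱼ)`. -/
def R (i j : Fin n) : Matrix (Fin n) (Fin n) A :=
  (g.Γ j).map (X i) - (g.Γ i).map (X j) + g.Γ i * g.Γ j - g.Γ j * g.Γ i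

/-- The trace of Z ↦ R(Z, ∂ⱼ)∂_b, the sign for which round spheres are positive. -/
def Ric (j b : Fin n) : A := ∑ i, g.R i j i b

lemma hi_mul : g.hi * g.h = 1 := mul_eq_one_comm.mp g.mul_hi

lemma hi_symm : g.hiᵀ = g.hi := by
  have h1 : g.hiᵀ * g.h = 1 := by
    have := congrArg transpose g.mul_hi
    rwa [transpose_mul, g.symm, transpose_one] at this
  calc g.hiᵀ = g.hiᵀ * (g.h * g.hi) := by rw [g.mul_hi, mul_one]
    _ = g.hi := by rw [← mul_assoc, h1, one_mul]

lemma map_hi (k : Fin n) : g.hi.map (X k) = -(g.Γ k * g.hi) - g.hi * (g.Γ k)ᵀ := by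
  have h1 := (X k).map_matrix_mul g.hi g.h
  have h0 : (1 : Matrix (Fin n) (Fin n) A).map (X k) = 0 := by
    ext i j
    by_cases hij : i = j <;> simp [hij]
  rw [g.hi_mul, h0, g.compat, mul_add, ← mul_assoc, g.hi_mul, one_mul] at h1
  have h2 := congrArg (· * g.hi) h1
  simp only [add_mul, zero_mul, mul_assoc, g.mul_hi, mul_one] at h2
  rw [← sub_eq_zero, h2]; abel

lemma R_swap (i j : Fin n) : g.R j i = -g.R i j := by simp only [R]; abel

/-- Second derivatives of h commute; expanding both orders by metric compatibility leaves exactly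
the skewness of the curvature. -/
lemma h_mul_R (i j : Fin n) : g.h * g.R i j + (g.R i j)ᵀ * g.h = 0 := by
  have key : ∀ i j, (g.h.map (X j)).map (X i) = (g.h * g.Γ i + (g.Γ i)ᵀ * g.h) * g.Γ j
      + g.h * (g.Γ j).map (X i) + ((g.Γ j).map (X i))ᵀ * g.h
      + (g.Γ j)ᵀ * (g.h * g.Γ i + (g.Γ i)ᵀ * g.h) := fun i j => by
    rw [g.compat, Derivation.map_matrix_add, Derivation.map_matrix_mul, Derivation.map_matrix_mul,
      g.compat, transpose_map]
    abel
  have hc : (g.h.map (X j)).map (X i) = (g.h.map (X i)).map (X j) := by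
    ext a b; simp [g.comm i j]
  rw [key, key, ← sub_eq_zero] at hc
  rw [← hc]
  simp only [R, transpose_add, transpose_sub, transpose_mul]
  noncomm_ring

lemma trace_R (i j : Fin n) : (g.R i j).trace = 0 := by
  have h1 := congrArg (fun M => (g.hi * M).trace) (g.h_mul_R i j)
  simp only [mul_add, mul_zero, trace_add, trace_zero] at h1
  rw [← mul_assoc, g.hi_mul, one_mul, trace_mul_comm, mul_assoc, g.mul_hi, mul_one,
    trace_transpose] at h1
  exact VelocityAlgebra.two_mul_cancel (by linear_combination h1)

lemma first_bianchi (i j b a : Fin n) : g.R i j a b + g.R j b a i + g.R b i a j = 0 := by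
  have e : ∀ i j b, (g.Γ i * g.Γ j) a b = (g.Γ i * g.Γ b) a j := fun i j b => by
    simp only [Matrix.mul_apply, g.torsion j b]
  simp only [R, Matrix.add_apply, Matrix.sub_apply, Matrix.map_apply]
  rw [e i j b, e j b i, e b i j, g.torsion j b, g.torsion b i, g.torsion i j]
  abel

/-- Contract the first Bianchi identity; the middle term is the trace of a skew endomorphism and
drops out. -/
lemma Ric_comm (j b : Fin n) : g.Ric j b = g.Ric b j := by
  have h1 : ∑ i, (g.R i j i b + g.R j b i i + g.R b i i j) = 0 :=
    Finset.sum_eq_zero fun i _ => g.first_bianchi i j b i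
  have h2 : ∑ i, g.R b i i j = -g.Ric b j := by
    rw [Ric, ← Finset.sum_neg_distrib]
    exact Finset.sum_congr rfl fun i _ => by rw [g.R_swap]; rfl
  have h3 : ∑ i, g.R j b i i = 0 := g.trace_R j b
  rw [Finset.sum_add_distrib, Finset.sum_add_distrib, h2, h3] at h1
  simp only [Ric] at h1 ⊢
  linear_combination h1

/-- The Jacobi identity for the operators Xₖ + Γₖ, whose commutators are the curvatures. -/
lemma second_bianchi (i j k : Fin n) :
    ((g.R i j).map (X k) + g.Γ k * g.R i j - g.R i j * g.Γ k)
      + ((g.R j k).map (X i) + g.Γ i * g.R j k - g.R j k * g.Γ i)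
      + ((g.R k i).map (X j) + g.Γ j * g.R k i - g.R k i * g.Γ j) = 0 := by
  have hc : ∀ i j k, ((g.Γ k).map (X j)).map (X i) = ((g.Γ k).map (X i)).map (X j) :=
    fun i j k => by ext a b; simp [g.comm i j]
  simp only [R, Derivation.map_matrix_add, Derivation.map_matrix_sub, Derivation.map_matrix_mul]
  rw [hc k i j, hc k j i, hc i j k]
  noncomm_ring

/-- The curvature with an index raised, as a skew-symmetric matrix. -/
def K (i j : Fin n) : Matrix (Fin n) (Fin n) A := g.R i j * g.hi

lemma K_swap (i j : Fin n) : g.K j i = -g.K i j := by rw [K, g.R_swap, neg_mul]; rfl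

lemma transpose_K (i j : Fin n) : (g.K i j)ᵀ = -g.K i j := by
  have h1 := congrArg (fun M => g.hi * M * g.hi) (g.h_mul_R i j)
  simp only [mul_add, add_mul, mul_zero, zero_mul] at h1
  rw [← mul_assoc, g.hi_mul, one_mul, mul_assoc, mul_assoc, g.mul_hi, mul_one] at h1
  rw [K, transpose_mul, g.hi_symm]
  exact eq_neg_of_add_eq_zero_right h1

lemma K_apply_swap (i j a b : Fin n) : g.K i j b a = -g.K i j a b :=
  congrFun (congrFun (g.transpose_K i j) a) b

/-- The covariant derivative of `K`, with respect to its upper indices. -/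
def DK (k i j : Fin n) : Matrix (Fin n) (Fin n) A :=
  (g.K i j).map (X k) + g.Γ k * g.K i j + g.K i j * (g.Γ k)ᵀ

lemma DK_eq (k i j : Fin n) :
    g.DK k i j = ((g.R i j).map (X k) + g.Γ k * g.R i j - g.R i j * g.Γ k) * g.hi := by
  rw [DK, K, Derivation.map_matrix_mul, map_hi]
  noncomm_ring

/-- Raising an index commutes with the derivative since the inverse metric is parallel. No
connection terms for the lower indices are needed, as they would cancel in the cyclic sum. -/
lemma DK_bianchi (i j k : Fin n) : g.DK k i j + g.DK i j k + g.DK j k i = 0 := by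
  rw [DK_eq, DK_eq, DK_eq, ← add_mul, ← add_mul, second_bianchi, zero_mul]

lemma DK_swap (k i j a b : Fin n) : g.DK k j i b a = g.DK k i j a b := by
  have h1 : (g.DK k j i)ᵀ = g.DK k i j := by
    rw [DK, transpose_add, transpose_add, transpose_mul, transpose_mul, transpose_transpose,
      ← transpose_map, g.transpose_K, g.K_swap i j, neg_neg, DK]
    abel
  exact congrFun (congrFun h1 a) b

/-- Schur's lemma. -/
lemma schur {δ : A} (hδ : ∀ i j, g.Ric i j = δ * g.h i j) (k : Fin n) :
    ((n : A) - 2) * X k δ = 0 := by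
  -- The Einstein condition turns each contraction of a lower with an upper index of K into ±δ times
  -- the identity.
  have c1 : ∀ j b, ∑ i, g.K i j i b = if j = b then δ else 0 := fun j b => by
    have : ∑ i, g.K i j i b = ∑ c, g.Ric j c * g.hi c b := by
      simp only [K, Matrix.mul_apply, Ric, Finset.sum_mul]
      exact Finset.sum_comm
    simp only [this, hδ, mul_assoc, ← Finset.mul_sum]
    rw [← Matrix.mul_apply, g.mul_hi, Matrix.one_apply]
    split_ifs <;> simp
  have c2 : ∀ j b, ∑ i, g.K i j b i = if j = b then -δ else 0 := fun j b => by
    have := congrArg Neg.neg (c1 j b)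
    rw [← Finset.sum_neg_distrib] at this
    simp only [g.K_apply_swap _ _ _ b, this]
    split_ifs <;> simp
  have c3 : ∀ i c, ∑ j, g.K i j c j = if i = c then δ else 0 := fun i c => by
    have := congrArg Neg.neg (c2 i c)
    rw [← Finset.sum_neg_distrib] at this
    simp only [g.K_swap _ i, Matrix.neg_apply, this]
    split_ifs <;> simp
  have hΓ : ∀ l, ∑ i, g.Γ i i l = ∑ i, g.Γ l i i := fun l =>
    Finset.sum_congr rfl fun i _ => g.torsion _ _ _
  -- The doubly contracted Bianchi identity: the term 2δ tr Γₖ here cancels against two copies of -δ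
  -- tr Γₖ from `t2`, leaving (n - 2) Xₖδ.
  have t1 : ∑ i, ∑ j, g.DK k i j i j = n * X k δ + 2 * δ * ∑ i, g.Γ k i i := by
    have a1 : ∑ i, ∑ j, X k (g.K i j i j) = n * X k δ := by
      simp only [← map_sum, c3]; simp
    have a2 : ∑ i, ∑ j, ∑ c, g.Γ k i c * g.K i j c j = δ * ∑ i, g.Γ k i i := by
      rw [Finset.mul_sum]
      refine Finset.sum_congr rfl fun i _ => ?_
      rw [Finset.sum_comm]
      simp only [← Finset.mul_sum, c3]
      simp [mul_comm]
    have a3 : ∑ i, ∑ j, ∑ c, g.K i j i c * g.Γ k j c = δ * ∑ i, g.Γ k i i := by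
      rw [Finset.mul_sum, Finset.sum_comm]
      refine Finset.sum_congr rfl fun i _ => ?_
      rw [Finset.sum_comm]
      simp only [← Finset.sum_mul, c1]
      simp
    simp only [DK, Matrix.add_apply, Matrix.map_apply, Matrix.mul_apply, Matrix.transpose_apply,
      Finset.sum_add_distrib, a1, a2, a3]
    ring
  have t2 : ∑ i, ∑ j, g.DK i j k i j = -X k δ - δ * ∑ i, g.Γ k i i := by
    have a1 : ∑ i, ∑ j, X i (g.K j k i j) = -X k δ := by
      simp only [← map_sum, c2, apply_ite, map_zero]; simp
    have a2 : ∑ i, ∑ j, ∑ c, g.Γ i i c * g.K j k c j = -(δ * ∑ i, g.Γ k i i) := by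
      rw [← hΓ, Finset.mul_sum, ← Finset.sum_neg_distrib]
      refine Finset.sum_congr rfl fun i _ => ?_
      rw [Finset.sum_comm]
      simp only [← Finset.mul_sum, c2]
      simp [mul_comm]
    -- K is skew and Γ symmetric in i and c, so the sum equals its negative.
    have a3 : ∑ i, ∑ j, ∑ c, g.K j k i c * g.Γ i j c = 0 := by
      rw [Finset.sum_comm]
      refine Finset.sum_eq_zero fun j _ => VelocityAlgebra.two_mul_cancel ?_
      rw [mul_zero, two_mul]
      nth_rewrite 2 [Finset.sum_comm]
      simp only [← Finset.sum_add_distrib]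
      refine Finset.sum_eq_zero fun i _ => Finset.sum_eq_zero fun c _ => ?_
      rw [g.K_apply_swap, g.torsion]; ring
    simp only [DK, Matrix.add_apply, Matrix.map_apply, Matrix.mul_apply, Matrix.transpose_apply,
      Finset.sum_add_distrib, a1, a2, a3]
    ring
  have t3 : ∑ i, ∑ j, g.DK j k i i j = ∑ i, ∑ j, g.DK i j k i j := by
    rw [Finset.sum_comm]
    exact Finset.sum_congr rfl fun i _ => Finset.sum_congr rfl fun j _ => g.DK_swap _ _ _ _ _
  have h0 : ∑ i, ∑ j, (g.DK k i j i j + g.DK i j k i j + g.DK j k i i j) = 0 :=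
    Finset.sum_eq_zero fun i _ => Finset.sum_eq_zero fun j _ =>
      congrFun (congrFun (g.DK_bianchi i j k) i) j
  simp only [Finset.sum_add_distrib] at h0
  rw [t3, t1, t2] at h0
  linear_combination h0

section VectorField

variable (W : Fin n → A)

/-- The covariant derivative `∇ⱼWᵏ` of a vector field, as a matrix. -/
def nabla : Matrix (Fin n) (Fin n) A :=
  Matrix.of fun k j => X j (W k) + (g.Γ j *ᵥ W) k

/-- The divergence `∇ₘBᵐⱼ` of an endomorphism field. -/
def div (B : Matrix (Fin n) (Fin n) A) (j : Fin n) : A :=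
  ∑ m, (X m (B m j) + (g.Γ m * B) m j - (B * g.Γ m) m j)

/-- The Ricci identity: exchanging ∇ₘ and ∇ⱼ in ∇ₘ∇ⱼWᵐ costs one contracted curvature. -/
lemma div_nabla (j : Fin n) :
    g.div (g.nabla W) j = X j (g.nabla W).trace + ∑ l, g.Ric j l * W l := by
  have h1 : ∀ m, X m (g.nabla W m j) = X m (X j (W m)) + ((g.Γ j).map (X m) *ᵥ W) m
      + (g.Γ j *ᵥ fun i => X m (W i)) m := fun m => by
    simp only [nabla, Matrix.of_apply, map_add, Derivation.map_mulVec, add_assoc]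
  have h2 : ∀ m, X j (g.nabla W m m) = X m (X j (W m)) + ((g.Γ m).map (X j) *ᵥ W) m
      + (g.Γ m *ᵥ fun i => X j (W i)) m := fun m => by
    simp only [nabla, Matrix.of_apply, map_add, Derivation.map_mulVec, add_assoc, g.comm m j]
  have h3 : ∀ m, (g.Γ m * g.nabla W) m j =
      (g.Γ m *ᵥ fun i => X j (W i)) m + ((g.Γ m * g.Γ j) *ᵥ W) m := fun m => by
    rw [← mulVec_mulVec]
    simp only [Matrix.mul_apply, mulVec, dotProduct, nabla, Matrix.of_apply, mul_add,
      Finset.sum_add_distrib]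
  have h4 : ∑ m, (g.nabla W * g.Γ m) m j =
      ∑ m, (g.Γ j *ᵥ fun i => X m (W i)) m + ∑ m, ((g.Γ j * g.Γ m) *ᵥ W) m := by
    simp only [← mulVec_mulVec]
    simp only [Matrix.mul_apply, mulVec, dotProduct, nabla, Matrix.of_apply, add_mul,
      Finset.sum_add_distrib]
    congr 1
    · rw [Finset.sum_comm]
      exact Finset.sum_congr rfl fun m _ => Finset.sum_congr rfl fun i _ => by
        rw [g.torsion j i m, mul_comm]
    · rw [Finset.sum_comm]
      exact Finset.sum_congr rfl fun m _ => Finset.sum_congr rfl fun i _ => by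
        rw [g.torsion j i m, mul_comm]
  have h5 : ∑ l, g.Ric j l * W l = ∑ m, (g.R m j *ᵥ W) m := by
    simp only [Ric, Finset.sum_mul, mulVec, dotProduct]
    exact Finset.sum_comm
  rw [h5, div, Matrix.trace, map_sum]
  simp only [Matrix.diag_apply, Finset.sum_add_distrib, Finset.sum_sub_distrib, h4]
  simp only [h1, h2, h3, R, add_mulVec, sub_mulVec, Pi.add_apply, Pi.sub_apply,
    Finset.sum_add_distrib, Finset.sum_sub_distrib]
  ring

/-- Take the divergence of ∇_W W = 0. One factor gives div ∇W = Ric(W), by `div_nabla` and the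
vanishing trace, and the other gives tr (∇W)². -/
lemma ric_of_nabla (htr : (g.nabla W).trace = 0) (hW : g.nabla W *ᵥ W = 0) :
    ∑ j, ∑ l, g.Ric j l * W j * W l = -(g.nabla W * g.nabla W).trace := by
  set B := g.nabla W with hB
  have h1 : ∀ j, ∑ l, g.Ric j l * W l = g.div B j := fun j => by
    rw [hB, div_nabla, htr, map_zero, zero_add]
  have h2 : ∀ m, ∑ j, X m (B m j) * W j = -∑ j, B m j * X m (W j) := fun m => by
    have := congrArg (X m) (congrFun hW m)
    rw [Derivation.map_mulVec, Pi.zero_apply, map_zero] at this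
    exact eq_neg_of_add_eq_zero_left this
  have h3 : ∀ m, ∑ j, (g.Γ m * B) m j * W j = 0 := fun m => by
    have : ((g.Γ m * B) *ᵥ W) m = 0 := by rw [← mulVec_mulVec, hW, mulVec_zero]; rfl
    exact this
  have h4 : ∀ m, ∑ j, (B * g.Γ m) m j * W j = ∑ j, B m j * (g.Γ m *ᵥ W) j := fun m => by
    have : ((B * g.Γ m) *ᵥ W) m = (B *ᵥ g.Γ m *ᵥ W) m := by rw [← mulVec_mulVec]
    exact this
  calc ∑ j, ∑ l, g.Ric j l * W j * W l = ∑ j, g.div B j * W j := by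
        refine Finset.sum_congr rfl fun j _ => ?_
        rw [← h1, Finset.sum_mul]
        exact Finset.sum_congr rfl fun l _ => by ring
    _ = ∑ m, (∑ j, X m (B m j) * W j + ∑ j, (g.Γ m * B) m j * W j
          - ∑ j, (B * g.Γ m) m j * W j) := by
        simp only [div, Finset.sum_mul, ← Finset.sum_add_distrib, ← Finset.sum_sub_distrib]
        rw [Finset.sum_comm]
        exact Finset.sum_congr rfl fun _ _ => Finset.sum_congr rfl fun _ _ => by ring
    _ = -∑ m, ∑ j, B m j * B j m := by
        rw [← Finset.sum_neg_distrib]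
        refine Finset.sum_congr rfl fun m _ => ?_
        rw [h2, h3, h4, add_zero, ← neg_add', ← Finset.sum_add_distrib]
        congr 1
        refine Finset.sum_congr rfl fun j _ => ?_
        simp only [hB, nabla, Matrix.of_apply]
        ring
    _ = -(B * B).trace := by simp only [Matrix.trace, Matrix.diag_apply, Matrix.mul_apply]

end VectorField

end MetricData
end

/-! ### The geodesic sprays of a Riemannian metric and of a Kropina metric -/

noncomputable section

open Matrix

namespace VelocityAlgebra

variable {n : ℕ} {A : Type*} [CommRing A] [Algebra ℝ A]

lemma sum_y_mul_Y (T : VelocityAlgebra n A) (v : Fin n → A) (k : Fin n) :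
    v ⬝ᵥ (fun i => T.Y k (T.y i)) = v k := by
  simp [T.Yy, dotProduct]

/-- A Riemannian metric `h` which depends on the position only. -/
structure BasicMetric (T : VelocityAlgebra n A) extends MetricData T.X where
  h_basic : ∀ i j, h i j ∈ T.basic
  Γ_basic : ∀ i j k, Γ i j k ∈ T.basic

namespace BasicMetric

variable {T : VelocityAlgebra n A} (N : BasicMetric T)

/-- The function `h(y, y)`. -/
def h2 : A := T.y ⬝ᵥ N.h *ᵥ T.y

/-- The coefficients `Γᵏᵢⱼ yⁱ yʲ` of the geodesic spray. -/
def γ (l : Fin n) : A := ∑ k, T.y k * (N.Γ k *ᵥ T.y) l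

lemma h_mulVec_dotProduct (u v : Fin n → A) : u ⬝ᵥ N.h *ᵥ v = (N.h *ᵥ u) ⬝ᵥ v := by
  rw [dotProduct_mulVec, ← mulVec_transpose, N.symm]

lemma map_Y_h (k : Fin n) : N.h.map (T.Y k) = 0 := by
  ext i j; exact basic.Y (N.h_basic i j) k

lemma map_Y_Γ (k l : Fin n) : (N.Γ l).map (T.Y k) = 0 := by
  ext i j; exact basic.Y (N.Γ_basic l i j) k

lemma Y_h_mulVec_y (k l : Fin n) : T.Y k ((N.h *ᵥ T.y) l) = N.h l k := by
  rw [Derivation.map_mulVec, map_Y_h]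
  simpa [mulVec] using T.sum_y_mul_Y (N.h l) k

lemma Y_Γ_mulVec_y (k l m : Fin n) : T.Y k ((N.Γ m *ᵥ T.y) l) = N.Γ m l k := by
  rw [Derivation.map_mulVec, map_Y_Γ]
  simpa [mulVec] using T.sum_y_mul_Y (N.Γ m l) k

lemma Y_γ (k l : Fin n) : T.Y k (N.γ l) = 2 * (N.Γ k *ᵥ T.y) l := by
  have h1 : (N.Γ k *ᵥ T.y) l = ∑ m, T.y m * N.Γ m l k := by
    rw [mulVec, dotProduct]
    exact Finset.sum_congr rfl fun m _ => by rw [N.torsion m k l, mul_comm]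
  have h2 : ∑ m, (N.Γ m *ᵥ T.y) l * T.Y k (T.y m) = (N.Γ k *ᵥ T.y) l := by
    simp [T.Yy]
  simp only [γ, map_sum, Derivation.leibniz, Y_Γ_mulVec_y, smul_eq_mul, Finset.sum_add_distrib]
  rw [h2, ← h1]; ring

lemma euler_γ (m : Fin n) : T.euler (N.γ m) = 2 * N.γ m := by
  rw [euler_apply]
  simp only [Y_γ]
  rw [γ, Finset.mul_sum]
  exact Finset.sum_congr rfl fun _ _ => by ring

lemma Y_h2 (k : Fin n) : T.Y k N.h2 = 2 * (N.h *ᵥ T.y) k := by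
  rw [h2, Derivation.map_dotProduct, dotProduct_comm, sum_y_mul_Y]
  simp only [Y_h_mulVec_y]
  have : T.y ⬝ᵥ (fun i => N.h i k) = (N.h *ᵥ T.y) k := by
    nth_rewrite 2 [← N.symm]
    rw [dotProduct_comm]; rfl
  rw [this]; ring

lemma X_h2 (l : Fin n) : T.X l N.h2 = T.y ⬝ᵥ N.h.map (T.X l) *ᵥ T.y := by
  have h0 : (fun i => T.X l (T.y i)) = 0 := funext fun i => T.Xy l i
  have h1 : (fun i => T.X l ((N.h *ᵥ T.y) i)) = N.h.map (T.X l) *ᵥ T.y := by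
    ext i; rw [Derivation.map_mulVec, h0]; simp
  rw [h2, Derivation.map_dotProduct, h0, h1]; simp

/-- Contract metric compatibility with y twice; by torsion freeness both transposed terms become
h(y, Γₗ y). -/
lemma geodesic (l : Fin n) : (N.h *ᵥ N.γ) l =
    T.y ⬝ᵥ (fun k => (N.h.map (T.X k) *ᵥ T.y) l) - half A * (T.y ⬝ᵥ N.h.map (T.X l) *ᵥ T.y) := by
  have h1 : (N.h *ᵥ N.γ) l = T.y ⬝ᵥ fun k => (N.h *ᵥ N.Γ k *ᵥ T.y) l := by
    simp only [γ, dotProduct, mulVec, Finset.mul_sum]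
    rw [Finset.sum_comm]
    exact Finset.sum_congr rfl fun _ _ => Finset.sum_congr rfl fun _ _ =>
      Finset.sum_congr rfl fun _ _ => by ring
  have h2 : T.y ⬝ᵥ (fun k => ((N.Γ k)ᵀ *ᵥ N.h *ᵥ T.y) l) = T.y ⬝ᵥ N.h *ᵥ N.Γ l *ᵥ T.y := by
    rw [h_mulVec_dotProduct]
    generalize N.h *ᵥ T.y = z
    simp only [dotProduct, mulVec, Finset.mul_sum, Matrix.transpose_apply]
    rw [Finset.sum_comm]
    exact Finset.sum_congr rfl fun _ _ => Finset.sum_congr rfl fun _ _ => by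
      rw [N.torsion]; ring
  have h3 : T.y ⬝ᵥ (N.Γ l)ᵀ *ᵥ N.h *ᵥ T.y = T.y ⬝ᵥ N.h *ᵥ N.Γ l *ᵥ T.y := by
    rw [dotProduct_mulVec, vecMul_transpose, h_mulVec_dotProduct, dotProduct_comm]
  have h4 : T.y ⬝ᵥ (fun k => (N.h.map (T.X k) *ᵥ T.y) l) =
      T.y ⬝ᵥ (fun k => (N.h *ᵥ N.Γ k *ᵥ T.y) l)
        + T.y ⬝ᵥ (fun k => ((N.Γ k)ᵀ *ᵥ N.h *ᵥ T.y) l) := by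
    rw [← dotProduct_add]
    congr 1; ext k
    simp only [N.compat, add_mulVec, ← mulVec_mulVec, Pi.add_apply]
  rw [h1, h4, h2, N.compat, add_mulVec, dotProduct_add, ← mulVec_mulVec, ← mulVec_mulVec, h3]
  linear_combination (T.y ⬝ᵥ N.h *ᵥ N.Γ l *ᵥ T.y) * two_mul_half A

/-- For K = γ this is the geodesic equation of h. Another spray misses it by h(γ - K), which allows
the Kropina spray to be tested against that of h. -/
lemma spray_h_mulVec_y (K : Fin n → A) (l : Fin n) : T.spray K ((N.h *ᵥ T.y) l) =
    half A * T.X l N.h2 + (N.h *ᵥ N.γ) l - (N.h *ᵥ K) l := by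
  have h1 : (N.h.map (T.spray K) *ᵥ T.y) l = T.y ⬝ᵥ fun k => (N.h.map (T.X k) *ᵥ T.y) l := by
    simp only [mulVec, dotProduct, Matrix.map_apply, basic.spray (N.h_basic _ _), Finset.sum_mul,
      Finset.mul_sum]
    rw [Finset.sum_comm]
    exact Finset.sum_congr rfl fun _ _ => Finset.sum_congr rfl fun _ _ => by ring
  have h2 : (N.h *ᵥ fun j => T.spray K (T.y j)) l = -(N.h *ᵥ K) l := by
    simp only [spray_y]
    exact congrFun (mulVec_neg K N.h) l
  rw [Derivation.map_mulVec, h1, N.geodesic, X_h2, h2]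
  ring

/-- The geodesic spray preserves h(y,y), so only V contributes. -/
lemma spray_h2 (V : Fin n → A) : T.spray (N.γ + V) N.h2 = -2 * (T.y ⬝ᵥ N.h *ᵥ V) := by
  have h1 : (fun i => T.spray (N.γ + V) ((N.h *ᵥ T.y) i)) =
      fun l => half A * T.X l N.h2 - (N.h *ᵥ V) l := by
    ext l; rw [spray_h_mulVec_y, mulVec_add, Pi.add_apply]; ring
  have h2 : (fun l => T.spray (N.γ + V) (T.y l)) = -(N.γ + V) := funext fun l => spray_y _ _ _
  have h3 : T.y ⬝ᵥ N.h *ᵥ N.γ = half A * T.y ⬝ᵥ fun l => T.X l N.h2 := by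
    have e : N.h *ᵥ N.γ = fun l => T.y ⬝ᵥ (fun k => (N.h.map (T.X k) *ᵥ T.y) l)
      - half A * T.X l N.h2 := by ext l; rw [N.geodesic, X_h2]
    have e2 : T.y ⬝ᵥ (fun l => T.y ⬝ᵥ (fun k => (N.h.map (T.X k) *ᵥ T.y) l)) =
        T.y ⬝ᵥ fun l => T.X l N.h2 := by
      simp only [X_h2, dotProduct, Finset.mul_sum]
      rw [Finset.sum_comm]
      exact Finset.sum_congr rfl fun _ _ => Finset.sum_congr rfl fun _ _ => by ring
    have e3 : T.y ⬝ᵥ (fun l => half A * T.X l N.h2) = half A * T.y ⬝ᵥ fun l => T.X l N.h2 := by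
      simp only [dotProduct, Finset.mul_sum]
      exact Finset.sum_congr rfl fun _ _ => by ring
    rw [e]
    change T.y ⬝ᵥ ((fun l => T.y ⬝ᵥ (fun k => (N.h.map (T.X k) *ᵥ T.y) l))
      - (fun l => half A * T.X l N.h2)) = _
    rw [dotProduct_sub, e2, e3]
    linear_combination (-(T.y ⬝ᵥ fun l => T.X l N.h2)) * (two_mul_half A)
  have e3 : T.y ⬝ᵥ (fun l => half A * T.X l N.h2 - (N.h *ᵥ V) l) =
      half A * (T.y ⬝ᵥ fun l => T.X l N.h2) - T.y ⬝ᵥ N.h *ᵥ V := by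
    simp only [dotProduct, Finset.mul_sum, ← Finset.sum_sub_distrib]
    exact Finset.sum_congr rfl fun _ _ => by ring
  rw [BasicMetric.h2, Derivation.map_dotProduct, h1, h2, e3, neg_dotProduct, add_dotProduct,
    dotProduct_comm N.γ, dotProduct_comm V, ← h_mulVec_dotProduct, ← h_mulVec_dotProduct, h3]
  ring

/-- The Euler-Lagrange equation of the metric. -/
lemma spray_Y_h2 (l : Fin n) : T.spray N.γ (T.Y l N.h2) = T.X l N.h2 := by
  rw [Y_h2, two_mul, map_add, spray_h_mulVec_y]
  linear_combination T.X l N.h2 * two_mul_half A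

/-- The Ricci curvature of the geodesic spray of a metric. -/
lemma ric4_γ : T.ric4 N.γ = 4 * ∑ j, ∑ b, N.Ric j b * T.y j * T.y b := by
  set c : Fin n → A := fun l => ∑ m, N.Γ m m l with hc
  have hcb : ∀ l, c l ∈ T.basic := fun l => sum_mem fun m _ => N.Γ_basic m m l
  have h1 : ∑ m, T.Y m (N.γ m) = 2 * (c ⬝ᵥ T.y) := by
    simp only [Y_γ, ← Finset.mul_sum, hc, mulVec, dotProduct, Finset.sum_mul]
    rw [Finset.sum_comm]
  have h2 : T.spray N.γ (c ⬝ᵥ T.y) = ∑ j, ∑ b, T.X j (c b) * T.y j * T.y b - c ⬝ᵥ N.γ := by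
    have : (fun i => T.spray N.γ (T.y i)) = -N.γ := funext fun i => spray_y _ _ _
    rw [Derivation.map_dotProduct, this, dotProduct_neg, ← sub_eq_add_neg]
    congr 1
    simp only [basic.spray (hcb _), dotProduct, Finset.sum_mul]
    rw [Finset.sum_comm]
    exact Finset.sum_congr rfl fun _ _ => Finset.sum_congr rfl fun _ _ => by ring
  have h3 : ∑ m, ∑ k, T.Y k (N.γ m) * T.Y m (N.γ k) =
      4 * ∑ m, ∑ k, (N.Γ k *ᵥ T.y) m * (N.Γ m *ᵥ T.y) k := by
    simp only [Y_γ, Finset.mul_sum]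
    exact Finset.sum_congr rfl fun _ _ => Finset.sum_congr rfl fun _ _ => by ring
  have h4 : ∑ m, T.X m (N.γ m) = ∑ j, ∑ b, (∑ i, T.X i (N.Γ j i b)) * T.y j * T.y b := by
    have : ∀ m, T.X m (N.γ m) = ∑ j, ∑ b, T.X m (N.Γ j m b) * T.y j * T.y b := fun m => by
      simp only [γ, map_sum, Derivation.leibniz, T.Xy, mulVec, dotProduct, smul_eq_mul, mul_zero,
        add_zero, Finset.mul_sum]
      exact Finset.sum_congr rfl fun _ _ => Finset.sum_congr rfl fun _ _ => by ring
    simp only [this, Finset.sum_mul]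
    rw [Finset.sum_comm]
    exact Finset.sum_congr rfl fun j _ => Finset.sum_comm
  have h5 : c ⬝ᵥ N.γ = ∑ j, ∑ b, (∑ i, (N.Γ i * N.Γ j) i b) * T.y j * T.y b := by
    have e : ∀ j b, ∑ i, (N.Γ i * N.Γ j) i b = ∑ a, c a * N.Γ j a b := fun j b => by
      simp only [Matrix.mul_apply, hc, Finset.sum_mul]
      exact Finset.sum_comm
    simp only [e, γ, dotProduct, mulVec, Finset.mul_sum, Finset.sum_mul]
    rw [Finset.sum_comm]
    refine Finset.sum_congr rfl fun j _ => ?_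
    rw [Finset.sum_comm]
    exact Finset.sum_congr rfl fun _ _ => Finset.sum_congr rfl fun _ _ => by ring
  have h6 : ∑ m, ∑ k, (N.Γ k *ᵥ T.y) m * (N.Γ m *ᵥ T.y) k =
      ∑ j, ∑ b, (∑ i, (N.Γ j * N.Γ i) i b) * T.y j * T.y b := by
    have e : ∀ i a, (N.Γ a *ᵥ T.y) i * (N.Γ i *ᵥ T.y) a =
        ∑ j, ∑ b, N.Γ j i a * N.Γ i a b * T.y j * T.y b := fun i a => by
      simp only [mulVec, dotProduct, Finset.sum_mul_sum]
      exact Finset.sum_congr rfl fun j _ => Finset.sum_congr rfl fun b _ => by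
        rw [N.torsion a j i]; ring
    simp only [e, Matrix.mul_apply, Finset.sum_mul]
    calc _ = ∑ i, ∑ j, ∑ b, ∑ a, N.Γ j i a * N.Γ i a b * T.y j * T.y b :=
          Finset.sum_congr rfl fun i _ => by
            rw [Finset.sum_comm]
            exact Finset.sum_congr rfl fun j _ => Finset.sum_comm
      _ = _ := by
          rw [Finset.sum_comm]
          exact Finset.sum_congr rfl fun j _ => Finset.sum_comm
  have h7 : ∑ j, ∑ b, N.Ric j b * T.y j * T.y b =
      ∑ j, ∑ b, (∑ i, T.X i (N.Γ j i b)) * T.y j * T.y b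
      - ∑ j, ∑ b, T.X j (c b) * T.y j * T.y b
      + ∑ j, ∑ b, (∑ i, (N.Γ i * N.Γ j) i b) * T.y j * T.y b
      - ∑ j, ∑ b, (∑ i, (N.Γ j * N.Γ i) i b) * T.y j * T.y b := by
    simp only [← Finset.sum_sub_distrib, ← Finset.sum_add_distrib]
    refine Finset.sum_congr rfl fun j _ => Finset.sum_congr rfl fun b _ => ?_
    simp only [MetricData.Ric, MetricData.R, Matrix.add_apply, Matrix.sub_apply, Matrix.map_apply,
      Finset.sum_add_distrib, Finset.sum_sub_distrib, hc, map_sum]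
    ring
  rw [ric4, h1, h3, h4, h7, h6, two_mul (c ⬝ᵥ T.y), map_add, h2, h5]
  ring

end BasicMetric

/-- A metric together with a unit vector field `W` with dual form `w`, such that `w(y)` is
invertible. -/
structure NavigationData (T : VelocityAlgebra n A) extends BasicMetric T where
  w : Fin n → A
  W : Fin n → A
  w0i : A
  w_basic : ∀ i, w i ∈ T.basic
  W_basic : ∀ i, W i ∈ T.basic
  h_mulVec_W : h *ᵥ W = w
  unit : w ⬝ᵥ W = 1
  w0_mul : (w ⬝ᵥ T.y) * w0i = 1

namespace NavigationData

variable {T : VelocityAlgebra n A} (N : NavigationData T)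

/-- The function `h(W, y)`. -/
def w0 : A := N.w ⬝ᵥ T.y

/-- The exterior derivative of `w`, contracted with `y`. -/
def S (l : Fin n) : A := T.y ⬝ᵥ fun k => T.X k (N.w l) - T.X l (N.w k)

/-- The function `h(∇_W W, y)`. -/
def ρ : A := -(N.W ⬝ᵥ N.S)

/-- The multiple of W is chosen to make τ orthogonal to W. Hence w(V) = r, and along the full spray
w(y) changes only through the projective term. -/
def τ : Fin n → A := -(N.ρ • N.W + N.hi *ᵥ N.S)

/-- The function `h(∇_y W, y)`. -/
def r : A := T.spray N.γ N.w0

/-- The Kropina metric `h(y, y) / (2 h(W, y))`. -/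
def F : A := half A * N.h2 * N.w0i

lemma two_w0_mul_F : 2 * N.w0 * N.F = N.h2 := by
  have := N.w0_mul
  unfold F w0
  linear_combination N.h2 * (two_mul_half A) + (N.h2 * 2 * half A) * this

lemma w0_cancel {a b : A} (hab : N.w0 * a = N.w0 * b) : a = b := by
  have := N.w0_mul
  unfold w0 at hab
  linear_combination N.w0i * hab - (a - b) * this

lemma W_dotProduct_h (v : Fin n → A) : N.W ⬝ᵥ N.h *ᵥ v = N.w ⬝ᵥ v := by
  rw [N.h_mulVec_dotProduct, N.h_mulVec_W]

lemma y_dotProduct_S : T.y ⬝ᵥ N.S = 0 := by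
  have h1 : T.y ⬝ᵥ N.S = ∑ l, ∑ k, T.y l * T.y k * T.X k (N.w l)
      - ∑ l, ∑ k, T.y l * T.y k * T.X l (N.w k) := by
    simp only [dotProduct, S, Finset.mul_sum, ← Finset.sum_sub_distrib]
    exact Finset.sum_congr rfl fun _ _ => Finset.sum_congr rfl fun _ _ => by ring
  rw [h1, Finset.sum_comm, sub_eq_zero]
  exact Finset.sum_congr rfl fun _ _ => Finset.sum_congr rfl fun _ _ => by ring

lemma h_mulVec_τ : N.h *ᵥ N.τ = -(N.ρ • N.w + N.S) := by
  rw [τ, mulVec_neg, mulVec_add, mulVec_smul, N.h_mulVec_W, mulVec_mulVec, N.mul_hi, one_mulVec]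

lemma w_dotProduct_τ : N.w ⬝ᵥ N.τ = 0 := by
  rw [← W_dotProduct_h, h_mulVec_τ, dotProduct_neg, dotProduct_add, dotProduct_smul,
    dotProduct_comm, N.unit]
  simp [ρ]

lemma y_dotProduct_h_τ : T.y ⬝ᵥ N.h *ᵥ N.τ = -(N.ρ * N.w0) := by
  rw [h_mulVec_τ, dotProduct_neg, dotProduct_add, dotProduct_smul, y_dotProduct_S,
    dotProduct_comm]
  simp [w0]

lemma Y_w0 (k : Fin n) : T.Y k N.w0 = N.w k := by
  have h0 : (fun i => T.Y k (N.w i)) = 0 := funext fun i => basic.Y (N.w_basic i) k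
  rw [w0, Derivation.map_dotProduct, h0, sum_y_mul_Y]
  simp

lemma w0_mul_Y_F (l : Fin n) : N.w0 * T.Y l N.F = (N.h *ᵥ T.y) l - N.F * N.w l := by
  have := congrArg (T.Y l) N.two_w0_mul_F
  rw [mul_assoc, two_mul, map_add, Derivation.leibniz, N.Y_h2, Y_w0] at this
  simp only [smul_eq_mul] at this
  exact two_mul_cancel (by linear_combination this)

lemma spray_w0 (V : Fin n → A) : T.spray (N.γ + V) N.w0 = N.r - N.w ⬝ᵥ V := by
  rw [spray_add, r]
  simp only [Y_w0, dotProduct]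
  congr 1
  exact Finset.sum_congr rfl fun _ _ => mul_comm _ _

/-- The Euler-Lagrange defect of a one-form is its exterior derivative contracted with y. The spray
does not matter, since w depends on the position only. -/
lemma S_eq (K : Fin n → A) (l : Fin n) : N.S l = T.spray K (N.w l) - T.X l N.w0 := by
  have h0 : (fun i => T.X l (T.y i)) = 0 := funext fun i => T.Xy l i
  rw [basic.spray (N.w_basic l), w0, Derivation.map_dotProduct, h0, dotProduct_zero, add_zero]
  simp only [S, dotProduct, ← Finset.sum_sub_distrib]
  exact Finset.sum_congr rfl fun _ _ => by ring

/-- The spray of the Kropina metric up to the projective factor. -/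
def V : Fin n → A := N.F • N.τ + N.r • N.W

lemma y_dotProduct_h_V : T.y ⬝ᵥ N.h *ᵥ N.V = N.r * N.w0 - N.F * N.ρ * N.w0 := by
  rw [V, mulVec_add, mulVec_smul, mulVec_smul, dotProduct_add, dotProduct_smul, dotProduct_smul,
    y_dotProduct_h_τ, N.h_mulVec_W, dotProduct_comm]
  simp [w0]; ring

lemma w_dotProduct_V : N.w ⬝ᵥ N.V = N.r := by
  rw [V, dotProduct_add, dotProduct_smul, dotProduct_smul, w_dotProduct_τ, N.unit]
  simp

lemma spray_w0_eq (p : A) : T.spray (N.γ + (N.V + p • T.y)) N.w0 = -(p * N.w0) := by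
  rw [spray_w0, dotProduct_add, w_dotProduct_V, dotProduct_smul]
  simp [w0]

section

variable {p : A} (hp : N.F * p = N.F * N.ρ - N.r)

include hp

/-- Since w(y) changes by -p w(y), the quotient h(y,y) / (2w(y)) is conserved when h(y,y) changes by
-p h(y,y), and the condition on p says this. It is kept in multiplied form because F need not be
invertible in A. -/
lemma spray_F : T.spray (N.γ + (N.V + p • T.y)) N.F = 0 := by
  have h1 := congrArg (T.spray (N.γ + (N.V + p • T.y))) N.two_w0_mul_F
  rw [N.spray_h2, mul_assoc, two_mul, map_add, Derivation.leibniz, N.spray_w0_eq p, mulVec_add,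
    dotProduct_add, y_dotProduct_h_V, mulVec_smul, dotProduct_smul] at h1
  change _ = -2 * (_ + p • N.h2) at h1
  simp only [smul_eq_mul] at h1
  refine N.w0_cancel (two_mul_cancel ?_)
  linear_combination h1 - (2 * N.w0) * hp + (2 * p) * N.two_w0_mul_F

/-- The Euler-Lagrange equation of the Kropina metric. -/
lemma spray_Y_F (l : Fin n) :
    T.spray (N.γ + (N.V + p • T.y)) (T.Y l N.F) = T.X l N.F := by
  set K := N.γ + (N.V + p • T.y) with hK
  have h1 := congrArg (T.spray K) (N.w0_mul_Y_F l)
  have h2 := congrArg (T.X l) N.two_w0_mul_F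
  have h3 : (N.h *ᵥ K) l = (N.h *ᵥ N.γ) l - N.F * (N.ρ * N.w l + N.S l) + N.r * N.w l
      + p * (N.h *ᵥ T.y) l := by
    simp only [hK, V, mulVec_add, mulVec_smul, N.h_mulVec_W, h_mulVec_τ]
    simp; ring
  rw [Derivation.leibniz, map_sub, N.spray_h_mulVec_y, Derivation.leibniz, N.spray_F hp,
    N.spray_w0_eq p, h3] at h1
  rw [mul_assoc, two_mul, map_add, Derivation.leibniz] at h2
  simp only [smul_eq_mul] at h1 h2
  -- After multiplication by w(y), the equation combines the derivative of `w0_mul_Y_F` along the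
  -- spray with the derivative of 2w(y)F = h(y,y) in xˡ.
  refine N.w0_cancel ?_
  linear_combination h1 - half A * h2 + N.F * N.S_eq K l + p * N.w0_mul_Y_F l - N.w l * hp
    + (N.w0 * T.X l N.F + N.F * T.X l N.w0) * two_mul_half A

end

end NavigationData

end VelocityAlgebra

end

/-! ### Homogeneity, and the part of the Ricci curvature that is singular on h(y,y) = 0 -/

noncomputable section

open Matrix

lemma Derivation.mem_adjoin {A : Type*} [CommRing A] [Algebra ℝ A] (D : Derivation ℝ A A)
    {s : Set A} (hs : ∀ a ∈ s, D a ∈ Algebra.adjoin ℝ s) {a : A} (ha : a ∈ Algebra.adjoin ℝ s) :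
    D a ∈ Algebra.adjoin ℝ s := by
  induction ha using Algebra.adjoin_induction with
  | mem a ha => exact hs a ha
  | algebraMap r => simp
  | add a b _ _ h1 h2 => rw [map_add]; exact add_mem h1 h2
  | mul a b ha hb h1 h2 =>
    rw [Derivation.leibniz]
    exact add_mem (mul_mem ha h2) (mul_mem hb h1)

namespace VelocityAlgebra

variable {n : ℕ} {A : Type*} [CommRing A] [Algebra ℝ A]

namespace NavigationData

variable {T : VelocityAlgebra n A} (N : NavigationData T)

section Homogeneity

lemma euler_dotProduct_y {b : Fin n → A} (hb : ∀ i, b i ∈ T.basic) :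
    T.euler (b ⬝ᵥ T.y) = b ⬝ᵥ T.y := by
  have h0 : (fun i => T.euler (b i)) = 0 := funext fun i => basic.euler (hb i)
  rw [Derivation.map_dotProduct, h0]
  simp

lemma euler_w0 : T.euler N.w0 = N.w0 := euler_dotProduct_y N.w_basic

lemma euler_S (l : Fin n) : T.euler (N.S l) = N.S l := by
  rw [S, dotProduct_comm]
  exact euler_dotProduct_y fun k => sub_mem (basic.X (N.w_basic _) _) (basic.X (N.w_basic _) _)

lemma euler_h2 : T.euler N.h2 = 2 * N.h2 := by
  rw [euler_apply]
  simp only [N.Y_h2]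
  rw [BasicMetric.h2, dotProduct, Finset.mul_sum]
  exact Finset.sum_congr rfl fun _ _ => by ring

lemma euler_F : T.euler N.F = N.F := by
  have h1 := congrArg T.euler N.two_w0_mul_F
  rw [mul_assoc, two_mul, map_add, Derivation.leibniz, euler_w0, euler_h2] at h1
  simp only [smul_eq_mul] at h1
  exact N.w0_cancel (two_mul_cancel (by linear_combination h1 - 2 * N.two_w0_mul_F))

lemma euler_ρ : T.euler N.ρ = N.ρ := by
  have h0 : (fun i => T.euler (N.W i)) = 0 := funext fun i => basic.euler (N.W_basic i)
  rw [ρ, map_neg, Derivation.map_dotProduct, h0]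
  simp [euler_S]

lemma euler_τ (i : Fin n) (hib : ∀ i j, N.hi i j ∈ T.basic) : T.euler (N.τ i) = N.τ i := by
  have h0 : N.hi.map T.euler = 0 := by ext i j; exact basic.euler (hib i j)
  rw [τ, Pi.neg_apply, Pi.add_apply, map_neg, map_add, Derivation.map_mulVec, h0]
  simp [euler_S, euler_ρ, basic.euler (N.W_basic i), mul_comm]

lemma X_w0 (k : Fin n) : T.X k N.w0 = (fun i => T.X k (N.w i)) ⬝ᵥ T.y := by
  have h0 : (fun i => T.X k (T.y i)) = 0 := funext fun i => T.Xy k i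
  rw [w0, Derivation.map_dotProduct, h0, dotProduct_zero, add_zero]

lemma euler_r : T.euler N.r = 2 * N.r := by
  have h1 : ∀ k, T.euler (T.X k N.w0) = T.X k N.w0 := fun k => by
    rw [X_w0]; exact euler_dotProduct_y fun i => basic.X (N.w_basic i) k
  rw [r, spray_apply, map_sum, Finset.mul_sum]
  refine Finset.sum_congr rfl fun k _ => ?_
  rw [map_sub, Derivation.leibniz, Derivation.leibniz, h1, N.euler_γ, Y_w0,
    basic.euler (N.w_basic k)]
  simp; ring

lemma euler_V (hib : ∀ i j, N.hi i j ∈ T.basic) (i : Fin n) : T.euler (N.V i) = 2 * N.V i := by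
  rw [V, Pi.add_apply, Pi.smul_apply, Pi.smul_apply, smul_eq_mul, smul_eq_mul, map_add,
    Derivation.leibniz, Derivation.leibniz, N.euler_τ i hib, euler_F, euler_r,
    basic.euler (N.W_basic i)]
  simp; ring

end Homogeneity

/-- The elements which are polynomials in the velocity and `w(y)⁻¹`. -/
def poly : Subalgebra ℝ A :=
  Algebra.adjoin ℝ ((T.basic : Set A) ∪ Set.range T.y ∪ {N.w0i})

lemma basic_le_poly {a : A} (ha : a ∈ T.basic) : a ∈ N.poly :=
  Algebra.subset_adjoin (Or.inl (Or.inl ha))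

lemma y_mem_poly (i : Fin n) : T.y i ∈ N.poly :=
  Algebra.subset_adjoin (Or.inl (Or.inr ⟨i, rfl⟩))

lemma w0i_mem_poly : N.w0i ∈ N.poly := Algebra.subset_adjoin (Or.inr rfl)

lemma dotProduct_mem_poly {u v : Fin n → A} (hu : ∀ i, u i ∈ N.poly) (hv : ∀ i, v i ∈ N.poly) :
    u ⬝ᵥ v ∈ N.poly := sum_mem fun i _ => mul_mem (hu i) (hv i)

lemma derivation_w0i (D : Derivation ℝ A A) : D N.w0i = -(N.w0i ^ 2 * D N.w0) := by
  have h1 := congrArg D N.w0_mul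
  rw [Derivation.leibniz, Derivation.map_one_eq_zero, smul_eq_mul, smul_eq_mul] at h1
  have h2 := N.w0_mul
  change N.w0 * D N.w0i + N.w0i * D N.w0 = 0 at h1
  change N.w0 * N.w0i = 1 at h2
  linear_combination N.w0i * h1 - D N.w0i * h2

lemma w0_mem_poly : N.w0 ∈ N.poly :=
  N.dotProduct_mem_poly (fun i => N.basic_le_poly (N.w_basic i)) N.y_mem_poly

/-- Only generators need checking: derivatives of position functions are position functions, y is
constant, and 1/w(y) differentiates to -(1/w(y))² times the derivative of w(y). -/
lemma X_mem_poly {a : A} (ha : a ∈ N.poly) (k : Fin n) : T.X k a ∈ N.poly := by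
  refine (T.X k).mem_adjoin ?_ ha
  rintro a ((ha | ⟨i, rfl⟩) | rfl)
  · exact N.basic_le_poly (basic.X ha k)
  · rw [T.Xy]; exact zero_mem _
  · rw [derivation_w0i, X_w0]
    exact neg_mem (mul_mem (pow_mem N.w0i_mem_poly _) (N.dotProduct_mem_poly
      (fun i => N.basic_le_poly (basic.X (N.w_basic i) k)) N.y_mem_poly))

lemma Y_mem_poly {a : A} (ha : a ∈ N.poly) (k : Fin n) : T.Y k a ∈ N.poly := by
  refine (T.Y k).mem_adjoin ?_ ha
  rintro a ((ha | ⟨i, rfl⟩) | rfl)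
  · rw [basic.Y ha]; exact zero_mem _
  · rw [T.Yy]; split_ifs
    exacts [one_mem _, zero_mem _]
  · rw [derivation_w0i, Y_w0]
    exact neg_mem (mul_mem (pow_mem N.w0i_mem_poly _) (N.basic_le_poly (N.w_basic k)))

lemma spray_mem_poly {K : Fin n → A} (hK : ∀ k, K k ∈ N.poly) {a : A} (ha : a ∈ N.poly) :
    T.spray K a ∈ N.poly := by
  rw [spray_apply]
  exact sum_mem fun k _ => sub_mem (mul_mem (N.y_mem_poly k) (N.X_mem_poly ha k))
    (mul_mem (hK k) (N.Y_mem_poly ha k))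

lemma ric4_mem_poly {K : Fin n → A} (hK : ∀ k, K k ∈ N.poly) : T.ric4 K ∈ N.poly := by
  have h2 : (2 : A) ∈ N.poly := ofNat_mem _ 2
  have h4 : (4 : A) ∈ N.poly := ofNat_mem _ 4
  exact sub_mem (sub_mem (mul_mem h4 (sum_mem fun k _ => N.X_mem_poly (hK k) k))
    (mul_mem h2 (N.spray_mem_poly hK (sum_mem fun k _ => N.Y_mem_poly (hK k) k))))
    (sum_mem fun m _ => sum_mem fun k _ => mul_mem (N.Y_mem_poly (hK m) k) (N.Y_mem_poly (hK k) m))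

lemma h2_mem_poly : N.h2 ∈ N.poly :=
  N.dotProduct_mem_poly N.y_mem_poly fun i =>
    N.dotProduct_mem_poly (fun j => N.basic_le_poly (N.h_basic i j)) N.y_mem_poly

lemma γ_mem_poly (k : Fin n) : N.γ k ∈ N.poly :=
  sum_mem fun i _ => mul_mem (N.y_mem_poly i)
    (N.dotProduct_mem_poly (fun j => N.basic_le_poly (N.Γ_basic i k j)) N.y_mem_poly)

lemma S_mem_poly (k : Fin n) : N.S k ∈ N.poly :=
  N.dotProduct_mem_poly N.y_mem_poly fun _ => N.basic_le_poly
    (sub_mem (basic.X (N.w_basic _) _) (basic.X (N.w_basic _) _))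

lemma ρ_mem_poly : N.ρ ∈ N.poly :=
  neg_mem (N.dotProduct_mem_poly (fun i => N.basic_le_poly (N.W_basic i)) N.S_mem_poly)

lemma r_mem_poly : N.r ∈ N.poly := N.spray_mem_poly N.γ_mem_poly N.w0_mem_poly

lemma V_mem_poly (hib : ∀ i j, N.hi i j ∈ T.basic) (k : Fin n) : N.V k ∈ N.poly := by
  have hF : N.F ∈ N.poly :=
    mul_mem (mul_mem (N.basic_le_poly half_mem_basic) N.h2_mem_poly) N.w0i_mem_poly
  have hτ : N.τ k ∈ N.poly := neg_mem (add_mem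
    (mul_mem N.ρ_mem_poly (N.basic_le_poly (N.W_basic k)))
    (N.dotProduct_mem_poly (fun j => N.basic_le_poly (hib k j)) N.S_mem_poly))
  exact add_mem (mul_mem hF hτ) (mul_mem N.r_mem_poly (N.basic_le_poly (N.W_basic k)))

/-- The projective factor of the Kropina spray; `h2i` is the inverse of `h(y, y)`. -/
def proj (h2i : A) : A := N.ρ - 2 * N.r * N.w0 * h2i

section

variable {h2i : A} (hh : N.h2 * h2i = 1)

include hh

lemma F_mul_proj : N.F * N.proj h2i = N.F * N.ρ - N.r := by
  rw [proj]
  linear_combination (-N.r * h2i) * N.two_w0_mul_F - N.r * hh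

/-- The principal part of the Ricci curvature of a Kropina metric along `h(y, y) = 0`. -/
lemma exists_h2_sq_mul_ric4 (hib : ∀ i j, N.hi i j ∈ T.basic) : ∃ a ∈ N.poly,
    N.h2 ^ 2 * T.ric4 (N.γ + (N.V + N.proj h2i • T.y)) =
      12 * ((n : A) - 1) * (N.r * N.w0) ^ 2 + N.h2 * a := by
  set p := N.proj h2i with hp
  -- The numerator of p over the denominator h(y,y).
  set q := N.ρ * N.h2 - 2 * N.r * N.w0 with hq
  have hpq : p * N.h2 = q := by
    rw [hp, hq, proj]; linear_combination (-2 * N.r * N.w0) * hh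
  have hK : ∀ k, (N.γ + N.V) k ∈ N.poly := fun k => add_mem (N.γ_mem_poly k) (N.V_mem_poly hib k)
  have h2m : (2 : A) ∈ N.poly := ofNat_mem _ 2
  have hqm : q ∈ N.poly := sub_mem (mul_mem N.ρ_mem_poly N.h2_mem_poly)
    (mul_mem (mul_mem h2m N.r_mem_poly) N.w0_mem_poly)
  -- The same q is the derivative of h(y,y) along Z, the spray of γ + V. Therefore h(y,y)²(p² - 2Zp)
  -- = q² + 2q² - 2h(y,y) Zq.
  have hZ : T.spray (N.γ + N.V) N.h2 = q := by
    rw [N.spray_h2, y_dotProduct_h_V, hq]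
    linear_combination N.ρ * N.two_w0_mul_F
  have hZq := congrArg (T.spray (N.γ + N.V)) hpq
  rw [Derivation.leibniz, hZ, smul_eq_mul, smul_eq_mul] at hZq
  have heu : T.euler p = p := by
    have h1 := congrArg T.euler hpq
    rw [hq, Derivation.leibniz, euler_h2, map_sub, Derivation.leibniz, euler_h2, euler_ρ,
      mul_assoc, two_mul (N.r * N.w0), map_add, Derivation.leibniz, euler_r, euler_w0] at h1
    simp only [smul_eq_mul] at h1
    linear_combination h2i * h1 - (T.euler p - p) * hh - 3 * h2i * hpq
  have hpc := T.ric4_add_smul_y (N.γ + N.V) p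
    (fun m => by rw [Pi.add_apply, map_add, N.euler_γ, N.euler_V hib]; ring) heu
  -- Modulo h(y,y), 3q² is 12(r w(y))²; the witness collects the rest.
  refine ⟨N.h2 * T.ric4 (N.γ + N.V) + ((n : A) - 1) *
    (3 * (N.ρ ^ 2 * N.h2 - 4 * N.ρ * (N.r * N.w0)) - 2 * T.spray (N.γ + N.V) q), ?_, ?_⟩
  · refine add_mem (mul_mem N.h2_mem_poly (N.ric4_mem_poly hK)) (mul_mem (sub_mem
      (natCast_mem _ n) (one_mem _)) (sub_mem (mul_mem (ofNat_mem _ 3) (sub_mem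
      (mul_mem (pow_mem N.ρ_mem_poly _) N.h2_mem_poly) (mul_mem (mul_mem (ofNat_mem _ 4)
        N.ρ_mem_poly) (mul_mem N.r_mem_poly N.w0_mem_poly)))) (mul_mem h2m
          (N.spray_mem_poly hK hqm))))
  · rw [← add_assoc]
    change N.h2 ^ 2 * T.ric4 (N.γ + N.V + fun m => p * T.y m) = _
    rw [hpc]
    linear_combination (n - 1 : A) * (p * N.h2 + q) * hpq - 2 * (n - 1 : A) * N.h2 * hZq
      + 2 * (n - 1 : A) * q * hpq + 3 * (n - 1 : A) * (q + N.ρ * N.h2 - 2 * N.r * N.w0) * hq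

end

section Covariant

/-- Metric compatibility: lowering the index commutes with ∇, so the entry (i, j) is w_{i;j}. -/
lemma h_mul_nabla (j i : Fin n) : (N.h * N.nabla N.W) i j =
    T.X j (N.w i) - ∑ k, N.Γ j k i * N.w k := by
  have h1 : N.w i = (N.h *ᵥ N.W) i := by rw [N.h_mulVec_W]
  have h2 : ∑ k, N.Γ j k i * N.w k = ((N.Γ j)ᵀ *ᵥ N.h *ᵥ N.W) i := by rw [N.h_mulVec_W]; rfl
  have h3 : (N.h * N.nabla N.W) i j = (N.h *ᵥ (fun k => T.X j (N.W k))) i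
      + (N.h *ᵥ N.Γ j *ᵥ N.W) i := by
    simp only [Matrix.mul_apply, MetricData.nabla, Matrix.of_apply, mul_add,
      Finset.sum_add_distrib]
    rfl
  rw [h1, Derivation.map_mulVec, N.compat, add_mulVec, h2, h3, Pi.add_apply, mulVec_mulVec]
  simp only [mulVec_mulVec]
  ring

/-- Half the derivative of the constant h(W,W). -/
lemma w_vecMul_nabla : N.w ᵥ* N.nabla N.W = 0 := by
  ext j
  refine two_mul_cancel ?_
  have h1 := congrArg (T.X j) N.unit
  rw [Derivation.map_dotProduct, Derivation.map_one_eq_zero] at h1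
  have h2 : (fun i => T.X j (N.w i)) = fun i => (N.h * N.nabla N.W) i j
      + ((N.Γ j)ᵀ *ᵥ N.w) i := by
    ext i
    rw [h_mul_nabla]; simp [mulVec, dotProduct]
  have h3 : (fun i => (N.h * N.nabla N.W) i j) ⬝ᵥ N.W = (N.w ᵥ* N.nabla N.W) j := by
    rw [dotProduct_comm]
    change (N.W ᵥ* (N.h * N.nabla N.W)) j = _
    rw [← vecMul_vecMul, ← N.h_mulVec_W, ← vecMul_transpose, N.symm]
  have h4 : ((N.Γ j)ᵀ *ᵥ N.w) ⬝ᵥ N.W = N.w ⬝ᵥ N.Γ j *ᵥ N.W := by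
    rw [mulVec_transpose, dotProduct_mulVec]
  have h5 : (N.w ᵥ* N.nabla N.W) j = N.w ⬝ᵥ (fun k => T.X j (N.W k)) + N.w ⬝ᵥ N.Γ j *ᵥ N.W := by
    rw [← dotProduct_add]; rfl
  rw [h2] at h1
  change ((fun i => (N.h * N.nabla N.W) i j) + ((N.Γ j)ᵀ *ᵥ N.w)) ⬝ᵥ N.W + _ = 0 at h1
  rw [add_dotProduct, h3, h4] at h1
  rw [Pi.zero_apply]
  linear_combination h1 + h5

lemma r_eq : N.r = T.y ⬝ᵥ (N.h * N.nabla N.W) *ᵥ T.y := by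
  have h1 : ∑ k, N.γ k * N.w k = ∑ i, ∑ j, (∑ k, N.Γ j k i * N.w k) * T.y i * T.y j := by
    simp only [BasicMetric.γ, mulVec, dotProduct, Finset.sum_mul, Finset.mul_sum]
    rw [Finset.sum_comm]
    conv_rhs => rw [Finset.sum_comm]
    refine Finset.sum_congr rfl fun j _ => ?_
    rw [Finset.sum_comm]
    exact Finset.sum_congr rfl fun i _ => Finset.sum_congr rfl fun k _ => by ring
  have h2 : T.y ⬝ᵥ (N.h * N.nabla N.W) *ᵥ T.y =
      ∑ i, ∑ j, (N.h * N.nabla N.W) i j * T.y i * T.y j := by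
    simp only [dotProduct, mulVec, Finset.mul_sum]
    exact Finset.sum_congr rfl fun _ _ => Finset.sum_congr rfl fun _ _ => by ring
  simp only [r, spray_apply, Y_w0, Finset.sum_sub_distrib, h1, h2, X_w0, h_mul_nabla, sub_mul]
  congr 1
  simp only [dotProduct, Finset.mul_sum]
  rw [Finset.sum_comm]
  exact Finset.sum_congr rfl fun _ _ => Finset.sum_congr rfl fun _ _ => by ring

end Covariant

end NavigationData

end VelocityAlgebra

end

/-! ### The Ricci curvature of a Kropina metric with Killing navigation field -/

noncomputable section

open Matrix

namespace VelocityAlgebra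

variable {n : ℕ} {A : Type*} [CommRing A] [Algebra ℝ A]

namespace BasicMetric

variable {T : VelocityAlgebra n A} (N : BasicMetric T)

/-- The horizontal derivative `∂/∂xᵏ - Γʲₖᵢ yⁱ ∂/∂yʲ`. -/
def hor (k : Fin n) (a : A) : A := T.X k a - ∑ j, (N.Γ k *ᵥ T.y) j * T.Y j a

lemma hor_mul (k : Fin n) (a b : A) : N.hor k (a * b) = a * N.hor k b + b * N.hor k a := by
  have : ∑ j, (N.Γ k *ᵥ T.y) j * T.Y j (a * b) = a * ∑ j, (N.Γ k *ᵥ T.y) j * T.Y j b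
      + b * ∑ j, (N.Γ k *ᵥ T.y) j * T.Y j a := by
    simp only [Derivation.leibniz, smul_eq_mul, Finset.mul_sum, ← Finset.sum_add_distrib]
    exact Finset.sum_congr rfl fun _ _ => by ring
  rw [hor, this, Derivation.leibniz, hor, hor]
  simp only [smul_eq_mul]; ring

/-- h is parallel. -/
lemma hor_h2 (k : Fin n) : N.hor k N.h2 = 0 := by
  have h1 : ∑ j, (N.Γ k *ᵥ T.y) j * T.Y j N.h2 = 2 * (T.y ⬝ᵥ N.h *ᵥ N.Γ k *ᵥ T.y) := by
    rw [N.h_mulVec_dotProduct, dotProduct, Finset.mul_sum]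
    exact Finset.sum_congr rfl fun _ _ => by rw [N.Y_h2]; ring
  have h2 : T.y ⬝ᵥ (N.Γ k)ᵀ *ᵥ N.h *ᵥ T.y = T.y ⬝ᵥ N.h *ᵥ N.Γ k *ᵥ T.y := by
    rw [dotProduct_mulVec, vecMul_transpose, N.h_mulVec_dotProduct, dotProduct_comm]
  rw [hor, h1, N.X_h2, N.compat, add_mulVec, dotProduct_add, ← mulVec_mulVec, ← mulVec_mulVec, h2]
  ring

/-- The change of the Ricci curvature of a geodesic spray under a divergence free change. -/
lemma ric4_γ_add {V : Fin n → A} (hV : ∑ m, T.Y m (V m) = 0) :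
    T.ric4 (N.γ + V) = T.ric4 N.γ + 4 * (∑ k, (N.hor k (V k) + (N.Γ k *ᵥ V) k))
      - ∑ m, ∑ k, T.Y k (V m) * T.Y m (V k) := by
  have h1 : ∑ k, V k * T.Y k (∑ m, T.Y m (N.γ m)) = 2 * ∑ k, (N.Γ k *ᵥ V) k := by
    have e : ∀ k, T.Y k (∑ m, T.Y m (N.γ m)) = 2 * ∑ m, N.Γ m m k := fun k => by
      simp only [N.Y_γ, map_sum, two_mul, map_add, N.Y_Γ_mulVec_y, Finset.sum_add_distrib]
    simp only [e, mulVec, dotProduct, Finset.mul_sum]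
    rw [Finset.sum_comm]
    exact Finset.sum_congr rfl fun _ _ => Finset.sum_congr rfl fun _ _ => by ring
  have h2 : ∑ m, ∑ k, T.Y k (N.γ m) * T.Y m (V k) =
      2 * ∑ k, ∑ j, (N.Γ k *ᵥ T.y) j * T.Y j (V k) := by
    rw [Finset.sum_comm]
    simp only [N.Y_γ, Finset.mul_sum]
    exact Finset.sum_congr rfl fun _ _ => Finset.sum_congr rfl fun _ _ => by ring
  rw [ric4_add, hV, h1, h2]
  simp only [hor, map_zero, mul_zero, Finset.sum_const_zero, Finset.sum_add_distrib,
    Finset.sum_sub_distrib]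
  ring

/-- For a field linear in y, the connection terms assemble into the covariant divergence of the
endomorphism B. -/
lemma sum_hor_mulVec_y {B : Matrix (Fin n) (Fin n) A} (hB : ∀ i j, B i j ∈ T.basic) :
    ∑ k, (N.hor k ((B *ᵥ T.y) k) + (N.Γ k *ᵥ B *ᵥ T.y) k) = N.div B ⬝ᵥ T.y := by
  have h1 : ∀ k, N.hor k ((B *ᵥ T.y) k) = ∑ j, T.X k (B k j) * T.y j
      - ((B * N.Γ k) *ᵥ T.y) k := fun k => by
    have h0 : B.map (T.Y k) = 0 := by ext i j; exact basic.Y (hB i j) k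
    have e1 : ∀ j, T.Y j ((B *ᵥ T.y) k) = B k j := fun j => by
      have h0 : B.map (T.Y j) = 0 := by ext a b; exact basic.Y (hB a b) j
      rw [Derivation.map_mulVec, h0]
      simpa [mulVec] using T.sum_y_mul_Y (B k) j
    have e2 : ∑ j, (N.Γ k *ᵥ T.y) j * B k j = ((B * N.Γ k) *ᵥ T.y) k := by
      rw [← mulVec_mulVec]
      exact dotProduct_comm _ _
    have e3 : T.X k ((B *ᵥ T.y) k) = ∑ j, T.X k (B k j) * T.y j := by
      have h0 : (fun i => T.X k (T.y i)) = 0 := funext fun i => T.Xy k i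
      rw [Derivation.map_mulVec, h0]
      simp [mulVec, dotProduct]
    simp only [hor, e1, e2, e3]
  simp only [h1, mulVec_mulVec, MetricData.div, dotProduct, Finset.sum_mul]
  rw [Finset.sum_comm]
  refine Finset.sum_congr rfl fun k _ => ?_
  simp only [mulVec, dotProduct, ← Finset.sum_sub_distrib, ← Finset.sum_add_distrib]
  exact Finset.sum_congr rfl fun j _ => by ring

end BasicMetric

namespace NavigationData

variable {T : VelocityAlgebra n A} (N : NavigationData T)

/-- Torsion freeness: in dw partial derivatives may be replaced by covariant ones. -/
lemma S_eq_covariant : N.S = (N.h * N.nabla N.W - (N.h * N.nabla N.W)ᵀ) *ᵥ T.y := by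
  ext l
  simp only [S, mulVec, dotProduct, Matrix.sub_apply, Matrix.transpose_apply, h_mul_nabla]
  refine Finset.sum_congr rfl fun k _ => ?_
  have : ∑ m, N.Γ k m l * N.w m = ∑ m, N.Γ l m k * N.w m :=
    Finset.sum_congr rfl fun m _ => by rw [N.torsion]
  rw [this]; ring

lemma Y_F_dotProduct (v : Fin n → A) :
    N.w0 * ((fun k => T.Y k N.F) ⬝ᵥ v) = T.y ⬝ᵥ N.h *ᵥ v - N.F * (N.w ⬝ᵥ v) := by
  rw [N.h_mulVec_dotProduct]
  simp only [dotProduct, Finset.mul_sum, ← Finset.sum_sub_distrib]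
  refine Finset.sum_congr rfl fun k _ => ?_
  linear_combination v k * N.w0_mul_Y_F k

lemma hor_w0 (k : Fin n) : N.hor k N.w0 = (T.y ᵥ* (N.h * N.nabla N.W)) k := by
  have h1 : ∑ j, (N.Γ k *ᵥ T.y) j * N.w j = ∑ i, (∑ m, N.Γ k m i * N.w m) * T.y i := by
    simp only [mulVec, dotProduct, Finset.sum_mul]
    rw [Finset.sum_comm]
    exact Finset.sum_congr rfl fun _ _ => Finset.sum_congr rfl fun _ _ => by ring
  simp only [BasicMetric.hor, Y_w0, h1, X_w0, vecMul, dotProduct, ← Finset.sum_sub_distrib,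
    h_mul_nabla]
  exact Finset.sum_congr rfl fun _ _ => by ring

lemma nabla_mem_basic (i j : Fin n) : N.nabla N.W i j ∈ T.basic := by
  have h1 : (N.Γ j *ᵥ N.W) i ∈ T.basic := by
    rw [mulVec, dotProduct]
    exact sum_mem fun k _ => mul_mem (N.Γ_basic j i k) (N.W_basic k)
  exact add_mem (basic.X (N.W_basic i) j) h1

section Killing

variable (hC : (N.h * N.nabla N.W)ᵀ = -(N.h * N.nabla N.W))

include hC

lemma y_dotProduct_C : T.y ⬝ᵥ (N.h * N.nabla N.W) *ᵥ T.y = 0 := by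
  refine two_mul_cancel ?_
  have h1 : T.y ⬝ᵥ (N.h * N.nabla N.W) *ᵥ T.y = T.y ⬝ᵥ (N.h * N.nabla N.W)ᵀ *ᵥ T.y := by
    rw [dotProduct_mulVec, ← mulVec_transpose, dotProduct_comm]
  rw [hC, neg_mulVec, dotProduct_neg] at h1
  linear_combination h1

lemma r_eq_zero : N.r = 0 := by rw [r_eq, N.y_dotProduct_C hC]

/-- Every unit field satisfies h(∇_v W, W) = 0; skewness turns this into h(∇_W W, v) = 0. -/
lemma nabla_mulVec_W : N.nabla N.W *ᵥ N.W = 0 := by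
  have h1 : N.W ᵥ* (N.h * N.nabla N.W) = 0 := by
    rw [← vecMul_vecMul, ← N.symm, vecMul_transpose, N.h_mulVec_W, w_vecMul_nabla]
  rw [← mulVec_transpose, hC, neg_mulVec, neg_eq_zero, ← mulVec_mulVec] at h1
  have h2 := congrArg (N.hi *ᵥ ·) h1
  simpa [mulVec_mulVec, N.hi_mul, mulVec_zero, ← mul_assoc] using h2

lemma S_eq_of_killing : N.S = 2 • N.h *ᵥ N.nabla N.W *ᵥ T.y := by
  rw [S_eq_covariant, hC, sub_neg_eq_add, add_mulVec, two_smul, mulVec_mulVec]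

lemma ρ_eq_zero : N.ρ = 0 := by
  rw [ρ, N.S_eq_of_killing hC, dotProduct_smul, W_dotProduct_h, dotProduct_mulVec, w_vecMul_nabla]
  simp

/-- With r = ρ = 0 only Fτ survives, and τ = -2∇_y W because dw is twice ∇w. -/
lemma V_eq_of_killing : N.V = fun m => -2 * (N.F * (N.nabla N.W *ᵥ T.y) m) := by
  ext m
  rw [V, N.r_eq_zero hC, τ, N.ρ_eq_zero hC, N.S_eq_of_killing hC, mulVec_smul, mulVec_mulVec,
    N.hi_mul, one_mulVec]
  simp; ring

lemma trace_nabla : (N.nabla N.W).trace = 0 := by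
  have h1 : N.nabla N.W = N.hi * (N.h * N.nabla N.W) := by rw [← mul_assoc, N.hi_mul, one_mul]
  have h2 := congrArg (fun M => (N.hi * M).trace) hC
  simp only [mul_neg, trace_neg] at h2
  rw [← h1, ← trace_transpose, transpose_mul, transpose_transpose, N.hi_symm, trace_mul_comm,
    ← h1] at h2
  exact two_mul_cancel (by linear_combination h2)

/-- The Ricci curvature of a Kropina metric whose navigation field is Killing. -/
lemma ric4_of_killing : T.ric4 (N.γ + N.V) =
    4 * ∑ j, ∑ b, N.Ric j b * (T.y j - N.F * N.W j) * (T.y b - N.F * N.W b) := by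
  set B := N.nabla N.W with hB
  set b := B *ᵥ T.y with hb
  set s := b ⬝ᵥ N.h *ᵥ b with hs
  have hBb : ∀ i j, B i j ∈ T.basic := N.nabla_mem_basic
  have yhb : T.y ⬝ᵥ N.h *ᵥ b = 0 := by rw [hb, mulVec_mulVec]; exact N.y_dotProduct_C hC
  have wB : ∀ v, N.w ⬝ᵥ B *ᵥ v = 0 := fun v => by
    rw [dotProduct_mulVec, w_vecMul_nabla, zero_dotProduct]
  have yC : T.y ᵥ* (N.h * B) = -(N.h *ᵥ b) := by
    rw [← mulVec_transpose, hC, neg_mulVec, ← mulVec_mulVec]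
  have yhBb : T.y ⬝ᵥ N.h *ᵥ B *ᵥ b = -s := by
    rw [mulVec_mulVec, dotProduct_mulVec, yC, neg_dotProduct, dotProduct_comm]
  set dF : Fin n → A := fun k => T.Y k N.F with hdF
  -- Since w(y) dF(v) = h(y,v) - F w(v), this says that b = ∇_y W is orthogonal to y, by skewness,
  -- and to W, by unit length. With tr B = 0 it makes V divergence free.
  have dFb : dF ⬝ᵥ b = 0 := N.w0_cancel (by rw [hdF, Y_F_dotProduct, yhb, hb, wB]; ring)
  have dFBb : N.w0 * (dF ⬝ᵥ B *ᵥ b) = -s := by rw [hdF, Y_F_dotProduct, yhBb, wB]; ring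
  have Yb : ∀ k m, T.Y k (b m) = B m k := fun k m => by
    have h0 : B.map (T.Y k) = 0 := by ext i j; exact basic.Y (hBb i j) k
    rw [hb, Derivation.map_mulVec, h0]
    simpa [mulVec] using T.sum_y_mul_Y (B m) k
  have YFb : ∀ k m, T.Y k (N.F * b m) = N.F * B m k + b m * dF k := fun k m => by
    rw [Derivation.leibniz, Yb]; rfl
  have Y2 : ∀ (D : Derivation ℝ A A) a, D (-2 * a) = -2 * D a := fun D a => by
    rw [neg_mul, map_neg, two_mul, map_add]; ring
  have hV : N.V = fun m => -2 * (N.F * b m) := N.V_eq_of_killing hC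
  have hdiv : ∑ m, T.Y m (N.V m) = 0 := by
    rw [hV]
    have : ∑ m, b m * dF m = 0 := by rw [← dFb, dotProduct_comm]; rfl
    have h2 : ∑ m, B m m = 0 := N.trace_nabla hC
    simp only [Y2, YFb, ← Finset.mul_sum, Finset.sum_add_distrib, this, h2]
    ring
  have hquad : ∑ m, ∑ k, T.Y k (N.F * b m) * T.Y m (N.F * b k) =
      2 * N.F * (dF ⬝ᵥ B *ᵥ b) + N.F ^ 2 * (B * B).trace := by
    have e1 : ∑ m, ∑ k, (b m * dF m) * (b k * dF k) = 0 := by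
      rw [← Finset.sum_mul_sum]
      have : ∑ m, b m * dF m = 0 := by rw [← dFb, dotProduct_comm]; rfl
      rw [this, zero_mul]
    have e2 : dF ⬝ᵥ B *ᵥ b = ∑ m, ∑ k, dF m * B m k * b k := by
      simp only [dotProduct, mulVec, Finset.mul_sum, mul_assoc]
    have e3 : ∑ m, ∑ k, dF m * B m k * b k = ∑ m, ∑ k, dF k * B k m * b m := Finset.sum_comm
    have e4 : (B * B).trace = ∑ m, ∑ k, B m k * B k m := by
      simp only [Matrix.trace, Matrix.diag_apply, Matrix.mul_apply]
    have e5 : ∑ m, ∑ k, T.Y k (N.F * b m) * T.Y m (N.F * b k) =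
        ∑ m, ∑ k, (b m * dF m) * (b k * dF k) + N.F * (∑ m, ∑ k, dF m * B m k * b k)
        + N.F * (∑ m, ∑ k, dF k * B k m * b m) + N.F ^ 2 * ∑ m, ∑ k, B m k * B k m := by
      simp only [YFb, Finset.mul_sum, ← Finset.sum_add_distrib]
      exact Finset.sum_congr rfl fun _ _ => Finset.sum_congr rfl fun _ _ => by ring
    rw [e5, e1, ← e3, ← e2, e4]
    ring
  -- 2F w(y) = h(y,y) is horizontally constant, so the horizontal derivative of F comes from that of
  -- w(y), which is -h b by skewness.
  have hhorF : N.w0 * ∑ k, b k * N.hor k N.F = N.F * s := by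
    have h1 : ∀ k, N.w0 * N.hor k N.F = N.F * (N.h *ᵥ b) k := fun k => by
      have h1 : N.hor k (N.w0 * (2 * N.F)) = 0 := by
        rw [show N.w0 * (2 * N.F) = N.h2 by rw [← N.two_w0_mul_F]; ring, N.hor_h2]
      have h2 : N.hor k (2 * N.F) = 2 * N.hor k N.F := by
        simp only [BasicMetric.hor, two_mul, map_add, mul_add, Finset.sum_add_distrib]
        ring
      rw [N.hor_mul, h2, hor_w0, ← hB, yC, Pi.neg_apply] at h1
      exact two_mul_cancel (by linear_combination h1)
    rw [hs, dotProduct, Finset.mul_sum, Finset.mul_sum]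
    exact Finset.sum_congr rfl fun k _ => by linear_combination b k * h1 k
  have hhor : ∑ k, (N.hor k (N.V k) + (N.Γ k *ᵥ N.V) k) =
      -2 * (∑ k, b k * N.hor k N.F + N.F * (N.div B ⬝ᵥ T.y)) := by
    have h1 : ∀ k, N.hor k (N.V k) = -2 * (N.F * N.hor k (b k) + b k * N.hor k N.F) := fun k => by
      rw [hV, ← N.hor_mul]
      simp only [BasicMetric.hor, Y2, mul_sub, Finset.mul_sum]
      congr 1
      exact Finset.sum_congr rfl fun _ _ => by ring
    have h2 : ∀ k, (N.Γ k *ᵥ N.V) k = -2 * (N.F * (N.Γ k *ᵥ b) k) := fun k => by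
      rw [hV]
      simp only [mulVec, dotProduct, Finset.mul_sum]
      exact Finset.sum_congr rfl fun _ _ => by ring
    rw [← N.sum_hor_mulVec_y hBb]
    simp only [h1, h2, Finset.mul_sum, ← Finset.sum_add_distrib]
    exact Finset.sum_congr rfl fun _ _ => by ring
  have hquadV : ∑ m, ∑ k, T.Y k (N.V m) * T.Y m (N.V k) =
      4 * (2 * N.F * (dF ⬝ᵥ B *ᵥ b) + N.F ^ 2 * (B * B).trace) := by
    rw [← hquad, hV]
    simp only [Y2, Finset.mul_sum]
    exact Finset.sum_congr rfl fun _ _ => Finset.sum_congr rfl fun _ _ => by ring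
  have hdivB : N.div B ⬝ᵥ T.y = ∑ j, ∑ l, N.Ric j l * T.y j * N.W l := by
    have : ∀ j, N.div B j = ∑ l, N.Ric j l * N.W l := fun j => by
      rw [hB, N.div_nabla, N.trace_nabla hC, map_zero, zero_add]
    simp only [dotProduct, this, Finset.sum_mul]
    exact Finset.sum_congr rfl fun _ _ => Finset.sum_congr rfl fun _ _ => by ring
  have htr := N.ric_of_nabla N.W (N.trace_nabla hC) (N.nabla_mulVec_W hC)
  have hcomm : ∑ j, ∑ l, N.Ric j l * T.y j * N.W l = ∑ j, ∑ l, N.Ric j l * N.W j * T.y l := by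
    rw [Finset.sum_comm]
    exact Finset.sum_congr rfl fun _ _ => Finset.sum_congr rfl fun _ _ => by
      rw [N.Ric_comm]; ring
  have hexp : ∑ j, ∑ b, N.Ric j b * (T.y j - N.F * N.W j) * (T.y b - N.F * N.W b) =
      ∑ j, ∑ b, N.Ric j b * T.y j * T.y b - N.F * (∑ j, ∑ l, N.Ric j l * T.y j * N.W l)
      - N.F * (∑ j, ∑ l, N.Ric j l * N.W j * T.y l)
      + N.F ^ 2 * ∑ j, ∑ l, N.Ric j l * N.W j * N.W l := by
    simp only [Finset.mul_sum, ← Finset.sum_sub_distrib, ← Finset.sum_add_distrib]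
    exact Finset.sum_congr rfl fun _ _ => Finset.sum_congr rfl fun _ _ => by ring
  -- Times w(y), the two terms in derivatives of F are F h(b,b) and -F h(b,b). What remains of the
  -- curvature is the expansion of Ric(y - FW, y - FW).
  have hF : ∑ k, b k * N.hor k N.F + N.F * (dF ⬝ᵥ B *ᵥ b) = 0 :=
    N.w0_cancel (by linear_combination hhorF + N.F * dFBb)
  rw [N.ric4_γ_add hdiv, hhor, hquadV, hexp, htr, ← hcomm, N.ric4_γ, hdivB]
  linear_combination (-8) * hF

end Killing

end NavigationData

end VelocityAlgebra

end

/-! ### Smooth functions on an open set as an algebra with commuting derivations -/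

noncomputable section

open TopologicalSpace

namespace SmoothFunctions

section

variable {H : Type*} [TopologicalSpace H]

/-- The extension by zero of a function on an open set. -/
def extend (Ω : Opens H) (f : Ω → ℝ) (z : H) : ℝ :=
  open scoped Classical in if h : z ∈ Ω then f ⟨z, h⟩ else 0

lemma extend_apply {Ω : Opens H} (f : Ω → ℝ) (z : Ω) : extend Ω f z = f z := by
  simp [extend]

lemma extend_of_mem {Ω : Opens H} (f : Ω → ℝ) {z : H} (hz : z ∈ Ω) :
    extend Ω f z = f ⟨z, hz⟩ := by simp [extend, hz]

lemma eventually_mem {Ω : Opens H} {z : H} (hz : z ∈ Ω) : ∀ᶠ w in nhds z, w ∈ Ω :=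
  Ω.isOpen.mem_nhds hz

lemma eventuallyEq_of_eqOn {Ω : Opens H} {f g : H → ℝ} (h : ∀ z ∈ Ω, f z = g z) {z : H}
    (hz : z ∈ Ω) : f =ᶠ[nhds z] g :=
  (eventually_mem hz).mono fun w hw => h w hw

end

variable {H : Type*} [NormedAddCommGroup H] [NormedSpace ℝ H]

/-- The algebra of smooth functions on an open set. -/
def smoothSubalgebra (Ω : Opens H) : Subalgebra ℝ (Ω → ℝ) where
  carrier := {f | ∀ z ∈ Ω, ContDiffAt ℝ ∞ (extend Ω f) z}
  mul_mem' {f g} hf hg z hz := ((hf z hz).mul (hg z hz)).congr_of_eventuallyEq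
    (eventuallyEq_of_eqOn (fun w hw => by simp [extend_of_mem, hw]) hz)
  add_mem' {f g} hf hg z hz := ((hf z hz).add (hg z hz)).congr_of_eventuallyEq
    (eventuallyEq_of_eqOn (fun w hw => by simp [extend_of_mem, hw]) hz)
  algebraMap_mem' r z hz := (contDiffAt_const (c := r)).congr_of_eventuallyEq
    (eventuallyEq_of_eqOn (fun w hw => by simp [extend_of_mem, hw]) hz)

/-- The type of smooth functions on an open set. -/
def smoothAlg (Ω : Opens H) : Type _ := smoothSubalgebra Ω

instance (Ω : Opens H) : CommRing (smoothAlg Ω) := inferInstanceAs (CommRing (smoothSubalgebra Ω))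

instance (Ω : Opens H) : Algebra ℝ (smoothAlg Ω) := inferInstanceAs (Algebra ℝ (smoothSubalgebra Ω))

variable {Ω : Opens H}

/-- The restriction of a function which is smooth on an open set. -/
def ofFun (f : H → ℝ) (hf : ∀ z ∈ Ω, ContDiffAt ℝ ∞ f z) : smoothAlg Ω :=
  ⟨fun z => f z, fun z hz => (hf z hz).congr_of_eventuallyEq
    (eventuallyEq_of_eqOn (fun w hw => by simp [extend_of_mem, hw]) hz)⟩

lemma contDiffAt_fderiv_apply {f : H → ℝ} {z : H} (hf : ContDiffAt ℝ ∞ f z) (u : H) :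
    ContDiffAt ℝ ∞ (fun w => fderiv ℝ f w u) z :=
  (hf.fderiv_right (m := ∞) (by simp)).clm_apply contDiffAt_const

lemma two_le_smooth : (2 : WithTop ℕ∞) ≤ ∞ :=
  WithTop.coe_le_coe.2 (le_top : (2 : ℕ∞) ≤ ⊤)

lemma differentiableAt_extend (a : smoothAlg Ω) {z : H} (hz : z ∈ Ω) :
    DifferentiableAt ℝ (extend Ω a.1) z :=
  (a.2 z hz).differentiableAt (by simp)

/-- The directional derivative, as a derivation of the algebra of smooth functions. -/
def dir (Ω : Opens H) (u : H) : Derivation ℝ (smoothAlg Ω) (smoothAlg Ω) :=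
  Derivation.mk'
    { toFun := fun a => ofFun (fun z => fderiv ℝ (extend Ω a.1) z u)
        fun z hz => contDiffAt_fderiv_apply (a.2 z hz) u
      map_add' := fun a b => Subtype.ext <| funext fun z => by
        have h1 : extend Ω (a + b : smoothAlg Ω).1 =ᶠ[nhds (z : H)] extend Ω a.1 + extend Ω b.1 :=
          eventuallyEq_of_eqOn (fun w hw => by simp [extend_of_mem, hw]; rfl) z.2
        change fderiv ℝ (extend Ω (a + b : smoothAlg Ω).1) z u =
          fderiv ℝ (extend Ω a.1) z u + fderiv ℝ (extend Ω b.1) z u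
        rw [h1.fderiv_eq, fderiv_add (differentiableAt_extend a z.2)
          (differentiableAt_extend b z.2)]
        rfl
      map_smul' := fun r a => Subtype.ext <| funext fun z => by
        have h1 : extend Ω (r • a : smoothAlg Ω).1 =ᶠ[nhds (z : H)] r • extend Ω a.1 :=
          eventuallyEq_of_eqOn (fun w hw => by simp [extend_of_mem, hw]; rfl) z.2
        change fderiv ℝ (extend Ω (r • a : smoothAlg Ω).1) z u = r * fderiv ℝ (extend Ω a.1) z u
        rw [h1.fderiv_eq, fderiv_const_smul (differentiableAt_extend a z.2)]
        rfl }
    fun a b => Subtype.ext <| funext fun z => by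
      have h1 : extend Ω (a * b : smoothAlg Ω).1 =ᶠ[nhds (z : H)] extend Ω a.1 * extend Ω b.1 :=
        eventuallyEq_of_eqOn (fun w hw => by simp [extend_of_mem, hw]; rfl) z.2
      change fderiv ℝ (extend Ω (a * b : smoothAlg Ω).1) z u =
        a.1 z * fderiv ℝ (extend Ω b.1) z u + b.1 z * fderiv ℝ (extend Ω a.1) z u
      rw [h1.fderiv_eq, fderiv_mul (differentiableAt_extend a z.2) (differentiableAt_extend b z.2)]
      simp [extend_of_mem]

lemma dir_apply (u : H) (a : smoothAlg Ω) (z : Ω) :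
    (dir Ω u a).1 z = fderiv ℝ (extend Ω a.1) z u := rfl

/-- Derivatives are local, so agreement on the open set is enough. Functions defined everywhere can
thus be exchanged for elements of the algebra. -/
lemma fderiv_eq_dir {f : H → ℝ} {a : smoothAlg Ω} (h : ∀ z : Ω, f z = a.1 z) (u : H) (z : Ω) :
    fderiv ℝ f z u = (dir Ω u a).1 z := by
  have h1 : f =ᶠ[nhds (z : H)] extend Ω a.1 :=
    eventuallyEq_of_eqOn (fun w hw => by rw [extend_of_mem _ hw]; exact h ⟨w, hw⟩) z.2
  rw [h1.fderiv_eq, dir_apply]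

lemma contDiffAt_of_eq {f : H → ℝ} {a : smoothAlg Ω} (h : ∀ z : Ω, f z = a.1 z) {z : H}
    (hz : z ∈ Ω) : ContDiffAt ℝ ∞ f z :=
  (a.2 z hz).congr_of_eventuallyEq
    (eventuallyEq_of_eqOn (fun w hw => by rw [extend_of_mem _ hw]; exact h ⟨w, hw⟩) hz)

lemma dir_comm (u v : H) (a : smoothAlg Ω) : dir Ω u (dir Ω v a) = dir Ω v (dir Ω u a) := by
  have key : ∀ u v (z : Ω), (dir Ω u (dir Ω v a)).1 z = fderiv ℝ (fderiv ℝ (extend Ω a.1)) z u v := by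
    intro u v z
    rw [← fderiv_eq_dir (f := fun w => fderiv ℝ (extend Ω a.1) w v) (fun z => rfl)]
    have hd : DifferentiableAt ℝ (fderiv ℝ (extend Ω a.1)) (z : H) :=
      ((a.2 z z.2).fderiv_right (m := 1)
        (by exact two_le_smooth)).differentiableAt (by simp)
    rw [fderiv_clm_apply hd (differentiableAt_const v)]
    simp
  refine Subtype.ext <| funext fun z => ?_
  rw [key, key]
  exact ((a.2 z z.2).isSymmSndFDerivAt
    (by simp only [minSmoothness_of_isRCLikeNormedField]; exact two_le_smooth)) u v

/-- Supplies the inverses of w(y), of h(y,y) and of the determinant of the metric. -/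
lemma exists_mul_eq_one (a : smoothAlg Ω) (ha : ∀ z, a.1 z ≠ 0) : ∃ b : smoothAlg Ω,
    a * b = 1 := by
  refine ⟨ofFun (fun z => (extend Ω a.1 z)⁻¹) fun z hz =>
    (a.2 z hz).inv (by rw [extend_of_mem _ hz]; exact ha _), Subtype.ext <| funext fun z => ?_⟩
  change a.1 z * (extend Ω a.1 z)⁻¹ = 1
  rw [extend_apply]
  exact mul_inv_cancel₀ (ha z)

end SmoothFunctions

namespace Kropina

open SmoothFunctions

variable {n : ℕ}

/-- The algebra of smooth functions on an open set of positions and velocities. -/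
def velocityAlgebra (Ω : Opens (E n × E n)) : VelocityAlgebra n (smoothAlg Ω) where
  X i := dir Ω (EuclideanSpace.single i 1, 0)
  Y i := dir Ω (0, EuclideanSpace.single i 1)
  y i := ofFun (fun z => z.2 i) fun z _ => by fun_prop
  XX _ _ a := dir_comm _ _ a
  XY _ _ a := dir_comm _ _ a
  YY _ _ a := dir_comm _ _ a
  Xy i j := Subtype.ext <| funext fun z => by
    rw [← fderiv_eq_dir (f := fun z => z.2 j) (fun _ => rfl)]
    change fderiv ℝ (fun z : E n × E n => (EuclideanSpace.proj j ∘L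
      ContinuousLinearMap.snd ℝ (E n) (E n)) z) _ _ = 0
    rw [ContinuousLinearMap.fderiv]; simp
  Yy i j := Subtype.ext <| funext fun z => by
    rw [← fderiv_eq_dir (f := fun z => z.2 j) (fun _ => rfl)]
    change fderiv ℝ (fun z : E n × E n => (EuclideanSpace.proj j ∘L
      ContinuousLinearMap.snd ℝ (E n) (E n)) z) _ _ = _
    rw [ContinuousLinearMap.fderiv]
    by_cases hij : i = j
    · simp [hij]; rfl
    · simp [hij, Ne.symm hij]; rfl

/-- The function `f` of a position and a velocity coincides on `Ω` with `a`. -/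
def Rep (Ω : Opens (E n × E n)) (f : E n → E n → ℝ) (a : smoothAlg Ω) : Prop :=
  ∀ z : Ω, f z.1.1 z.1.2 = a.1 z

variable {Ω : Opens (E n × E n)} {f g : E n → E n → ℝ} {a b : smoothAlg Ω}

/-- A partial derivative is the joint derivative composed with the inclusion of a slice; the
representing smooth function supplies joint differentiability. Iteration carries whole coordinate
expressions into the algebra. -/
lemma Rep.dX (h : Rep Ω f a) (i : Fin n) : Rep Ω (dX i f) ((velocityAlgebra Ω).X i a) := fun z => by
  have h1 : DifferentiableAt ℝ (fun w : E n × E n => f w.1 w.2) (z.1.1, z.1.2) :=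
    (contDiffAt_of_eq (f := fun w : E n × E n => f w.1 w.2) h z.2).differentiableAt (by simp)
  have h2 := fderiv_eq_dir (f := fun w : E n × E n => f w.1 w.2) h (EuclideanSpace.single i 1, 0) z
  refine Eq.trans ?_ h2
  have h3 : HasFDerivAt (fun q : E n => (q, z.1.2)) (ContinuousLinearMap.inl ℝ (E n) (E n)) z.1.1 :=
    hasFDerivAt_prodMk_left _ _
  have h4 := (h1.hasFDerivAt.comp z.1.1 h3).fderiv
  change fderiv ℝ ((fun w : E n × E n => f w.1 w.2) ∘ fun q : E n => (q, z.1.2)) z.1.1 _ = _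
  rw [h4]; simp

lemma Rep.dY (h : Rep Ω f a) (i : Fin n) : Rep Ω (dY i f) ((velocityAlgebra Ω).Y i a) := fun z => by
  have h1 : DifferentiableAt ℝ (fun w : E n × E n => f w.1 w.2) (z.1.1, z.1.2) :=
    (contDiffAt_of_eq (f := fun w : E n × E n => f w.1 w.2) h z.2).differentiableAt (by simp)
  have h2 := fderiv_eq_dir (f := fun w : E n × E n => f w.1 w.2) h (0, EuclideanSpace.single i 1) z
  refine Eq.trans ?_ h2
  have h3 : HasFDerivAt (fun q : E n => (z.1.1, q)) (ContinuousLinearMap.inr ℝ (E n) (E n)) z.1.2 :=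
    hasFDerivAt_prodMk_right _ _
  have h4 := (h1.hasFDerivAt.comp z.1.2 h3).fderiv
  change fderiv ℝ ((fun w : E n × E n => f w.1 w.2) ∘ fun q : E n => (z.1.1, q)) z.1.2 _ = _
  rw [h4]; simp

/-- The evaluation at a point of `Ω`. -/
def ev (z : Ω) : smoothAlg Ω →ₐ[ℝ] ℝ where
  toFun a := a.1 z
  map_one' := rfl
  map_mul' _ _ := rfl
  map_zero' := rfl
  map_add' _ _ := rfl
  commutes' _ := rfl

lemma ev_apply (z : Ω) (a : smoothAlg Ω) : ev z a = a.1 z := rfl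

lemma ext_ev (h : ∀ z, ev z a = ev z b) : a = b := Subtype.ext (funext h)

lemma ev_y (z : Ω) (i : Fin n) : ev z ((velocityAlgebra Ω).y i) = z.1.2 i := rfl

lemma ev_half (z : Ω) : ev z (VelocityAlgebra.half (smoothAlg Ω)) = 1 / 2 := by
  rw [VelocityAlgebra.half, AlgHom.commutes]; norm_num

end Kropina

end

/-! ### Coordinate expressions for spray and curvature, represented in the algebra -/

noncomputable section

open Matrix TopologicalSpace SmoothFunctions

namespace VelocityAlgebra

variable {n : ℕ} {A : Type*} [CommRing A] [Algebra ℝ A] (T : VelocityAlgebra n A)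

lemma map_ric4 {B : Type*} [CommRing B] [Algebra ℝ B] (φ : A →ₐ[ℝ] B) (K : Fin n → A) :
    φ (T.ric4 K) = 4 * ∑ m, φ (T.X m (K m))
      - 2 * ∑ i, ∑ m, (φ (T.y m) * φ (T.X m (T.Y i (K i)))
        - φ (K m) * φ (T.Y m (T.Y i (K i))))
      - ∑ i, ∑ m, φ (T.Y m (K i)) * φ (T.Y i (K m)) := by
  simp only [ric4, spray_apply, map_sub, map_mul, map_sum, map_ofNat]

section OfMetric

variable (h hi : Matrix (Fin n) (Fin n) A)

/-- The Christoffel symbols of a metric `h` with inverse `hi`. -/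
def christoffelSymbol (i : Fin n) : Matrix (Fin n) (Fin n) A :=
  Matrix.of fun k j => half A * ∑ l, hi k l * (T.X i (h j l) + T.X j (h i l) - T.X l (h i j))

variable {h hi}

lemma inv_mem_basic (mul_hi : h * hi = 1) (h_basic : ∀ i j, h i j ∈ T.basic) (i j : Fin n) :
    hi i j ∈ T.basic := fun k => by
  have h0 : h.map (T.Y k) = 0 := by ext i j; exact basic.Y (h_basic i j) k
  have h1 := (T.Y k).map_matrix_mul h hi
  have h2 : (1 : Matrix (Fin n) (Fin n) A).map (T.Y k) = 0 := by
    ext i j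
    by_cases hij : i = j <;> simp [hij]
  rw [mul_hi, h2, h0, zero_mul, zero_add] at h1
  have h3 := congrArg (hi * ·) h1
  simp only [mul_zero, ← mul_assoc, mul_eq_one_comm.mp mul_hi, one_mul] at h3
  exact (congrFun (congrFun h3 i) j).symm

/-- The Levi-Civita connection of a metric. -/
def BasicMetric.ofMetric (symm : hᵀ = h) (mul_hi : h * hi = 1)
    (h_basic : ∀ i j, h i j ∈ T.basic) : BasicMetric T where
  comm := T.XX
  h := h
  hi := hi
  Γ := T.christoffelSymbol h hi
  symm := symm
  mul_hi := mul_hi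
  torsion i j k := by
    have hs : ∀ i j, h i j = h j i := fun i j => congrFun (congrFun symm.symm i) j
    simp only [christoffelSymbol, Matrix.of_apply]
    congr 1
    exact Finset.sum_congr rfl fun l _ => by rw [hs i j]; ring
  compat k := by
    have hs : ∀ i j, h i j = h j i := fun i j => congrFun (congrFun symm.symm i) j
    have key : ∀ k i j, (h * T.christoffelSymbol h hi k) i j =
        half A * (T.X k (h j i) + T.X j (h k i) - T.X i (h k j)) := fun k i j => by
      have : (h * T.christoffelSymbol h hi k) i j = half A * ((h * hi) *ᵥ fun l =>
          T.X k (h j l) + T.X j (h k l) - T.X l (h k j)) i := by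
        rw [← mulVec_mulVec]
        simp only [Matrix.mul_apply, christoffelSymbol, Matrix.of_apply, mulVec, dotProduct]
        rw [Finset.mul_sum]
        exact Finset.sum_congr rfl fun _ _ => by ring
      rw [this, mul_hi, one_mulVec]
    have key2 : ∀ k i j, ((T.christoffelSymbol h hi k)ᵀ * h) i j =
        (h * T.christoffelSymbol h hi k) j i := fun k i j => by
      rw [← transpose_apply (h * T.christoffelSymbol h hi k), transpose_mul, symm]
    ext i j
    rw [Matrix.map_apply, Matrix.add_apply, key2, key, key, hs j i]
    linear_combination (-T.X k (h i j)) * two_mul_half A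
  h_basic := h_basic
  Γ_basic i k j := mul_mem half_mem_basic (sum_mem fun l _ =>
    mul_mem (T.inv_mem_basic mul_hi h_basic k l) (sub_mem (add_mem (basic.X (h_basic _ _) _)
      (basic.X (h_basic _ _) _)) (basic.X (h_basic _ _) _)))

end OfMetric

end VelocityAlgebra

namespace Kropina

open VelocityAlgebra

variable {n : ℕ} {Ω : Opens (E n × E n)}

lemma Rep.eq_ev {f : E n → E n → ℝ} {a : smoothAlg Ω} (h : Rep Ω f a) (z : Ω) :
    f z.1.1 z.1.2 = ev z a := h z

/-! ### Geodesic coefficients and curvature -/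

/-- Rearranged, the Euler-Lagrange equation is yᵏXₖYₗL - XₗL = KᵏYₖYₗL, and the right side is
2(gK)ₗ. So ¼ g⁻¹ applied to it is K/2, given that g is invertible. -/
lemma rep_geodesicCoeff {F : E n → E n → ℝ} {L : smoothAlg Ω} (hL : Rep Ω (sqF F) L)
    {K : Fin n → smoothAlg Ω}
    (hK : ∀ l, (velocityAlgebra Ω).spray K ((velocityAlgebra Ω).Y l L) = (velocityAlgebra Ω).X l L)
    (hdet : ∀ z : Ω, IsUnit (Matrix.of fun i j =>
      ev z ((velocityAlgebra Ω).Y i ((velocityAlgebra Ω).Y j L))).det) (i : Fin n) :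
    Rep Ω (geodesicCoeff F i) (half _ * K i) := fun z => by
  set T := velocityAlgebra Ω
  set g := fundamentalTensor F z.1.1 z.1.2 with hg
  have hg1 : g = (1 / 2 : ℝ) • Matrix.of fun i j => ev z (T.Y i (T.Y j L)) := by
    ext i j
    simp only [hg, fundamentalTensor, Matrix.of_apply, Matrix.smul_apply, smul_eq_mul]
    rw [(hL.dY j).dY i z]; rfl
  have hgdet : IsUnit g.det := by
    rw [hg1, det_smul, isUnit_iff_ne_zero]
    exact mul_ne_zero (by positivity) (hdet z).ne_zero
  have hrhs : ∀ l, (∑ k, dX k (dY l (sqF F)) z.1.1 z.1.2 * z.1.2 k) - dX l (sqF F) z.1.1 z.1.2 =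
      2 * (g *ᵥ fun k => ev z (K k)) l := fun l => by
    have h1 := congrArg (ev z) (hK l)
    rw [spray_apply, map_sum] at h1
    simp only [map_sub, map_mul, Finset.sum_sub_distrib] at h1
    have h2 : ∑ k, dX k (dY l (sqF F)) z.1.1 z.1.2 * z.1.2 k =
        ∑ k, ev z (T.y k) * ev z (T.X k (T.Y l L)) := Finset.sum_congr rfl fun k _ => by
      rw [(hL.dY l).dX k z, mul_comm]; rfl
    have h3 : 2 * (g *ᵥ fun k => ev z (K k)) l = ∑ k, ev z (K k) * ev z (T.Y k (T.Y l L)) := by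
      rw [hg1, smul_mulVec, Pi.smul_apply, smul_eq_mul, ← mul_assoc]
      simp only [mulVec, dotProduct, Matrix.of_apply, T.YY l]
      norm_num
      exact Finset.sum_congr rfl fun _ _ => mul_comm _ _
    rw [h2, h3, hL.dX l z, ← ev_apply, ← h1]; ring
  have h4 : geodesicCoeff F i z.1.1 z.1.2 = 1 / 2 * (g⁻¹ *ᵥ g *ᵥ fun k => ev z (K k)) i := by
    simp only [geodesicCoeff, hrhs]
    rw [← hg]
    simp only [mulVec, dotProduct, Finset.mul_sum]
    exact Finset.sum_congr rfl fun _ _ => Finset.sum_congr rfl fun _ _ => by ring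
  rw [h4, mulVec_mulVec, nonsing_inv_mul _ hgdet, one_mulVec, ← ev_apply, map_mul, ev_half]

lemma ricciCurvature_eq {F : E n → E n → ℝ} {K : Fin n → smoothAlg Ω}
    (hG : ∀ i, Rep Ω (geodesicCoeff F i) (half _ * K i)) (z : Ω) :
    ricciCurvature F z.1.1 z.1.2 = ev z ((velocityAlgebra Ω).ric4 K) / 4 := by
  set T := velocityAlgebra Ω
  have hX : ∀ (D : Derivation ℝ (smoothAlg Ω) (smoothAlg Ω)) a, ev z (D (half _ * a)) =
      1 / 2 * ev z (D a) := fun D a => by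
    rw [Derivation.leibniz]; simp [ev_half]
  have hXX : ∀ (D D' : Derivation ℝ (smoothAlg Ω) (smoothAlg Ω)) a,
      ev z (D (D' (half _ * a))) = 1 / 2 * ev z (D (D' a)) := fun D D' a => by
    rw [Derivation.leibniz D', derivation_half, smul_zero, add_zero, smul_eq_mul, hX]
  have h1 : ∀ i, riemannCurvature F i i z.1.1 z.1.2 = ev z (T.X i (K i))
      - 1 / 2 * ∑ m, (ev z (T.y m) * ev z (T.X m (T.Y i (K i)))
        - ev z (K m) * ev z (T.Y m (T.Y i (K i))))
      - 1 / 4 * ∑ m, ev z (T.Y m (K i)) * ev z (T.Y i (K m)) := fun i => by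
    simp only [riemannCurvature]
    rw [(hG i).dX i |>.eq_ev z, hX]
    have e1 : ∑ m, dX m (dY i (geodesicCoeff F i)) z.1.1 z.1.2 * z.1.2 m =
        1 / 2 * ∑ m, ev z (T.y m) * ev z (T.X m (T.Y i (K i))) := by
      rw [Finset.mul_sum]
      refine Finset.sum_congr rfl fun m _ => ?_
      rw [((hG i).dY i).dX m |>.eq_ev z, hXX, ← ev_y]; ring
    have e2 : ∑ m, geodesicCoeff F m z.1.1 z.1.2 * dY m (dY i (geodesicCoeff F i)) z.1.1 z.1.2 =
        1 / 4 * ∑ m, ev z (K m) * ev z (T.Y m (T.Y i (K i))) := by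
      rw [Finset.mul_sum]
      refine Finset.sum_congr rfl fun m _ => ?_
      rw [((hG i).dY i).dY m |>.eq_ev z, hXX, (hG m).eq_ev z, map_mul, ev_half]; ring
    have e3 : ∑ m, dY m (geodesicCoeff F i) z.1.1 z.1.2 * dY i (geodesicCoeff F m) z.1.1 z.1.2 =
        1 / 4 * ∑ m, ev z (T.Y m (K i)) * ev z (T.Y i (K m)) := by
      rw [Finset.mul_sum]
      refine Finset.sum_congr rfl fun m _ => ?_
      rw [(hG i).dY m |>.eq_ev z, (hG m).dY i |>.eq_ev z, hX, hX]; ring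
    rw [e1, e2, e3, Finset.sum_sub_distrib]
    ring
  have key : ∀ (a : Fin n → ℝ) (b c : Fin n → Fin n → ℝ),
      ∑ i, (a i - 1 / 2 * ∑ m, b i m - 1 / 4 * ∑ m, c i m) =
        (4 * ∑ i, a i - 2 * ∑ i, ∑ m, b i m - ∑ i, ∑ m, c i m) / 4 := fun a b c => by
    rw [Finset.sum_sub_distrib, Finset.sum_sub_distrib, ← Finset.mul_sum, ← Finset.mul_sum]
    ring
  rw [T.map_ric4 (ev z) K, ricciCurvature, Finset.sum_congr rfl fun i _ => h1 i]
  exact key _ _ _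

/-! ### Metrics in coordinates -/

/-- The components of a smooth Riemannian metric in a coordinate domain. -/
structure LocalMetric (U : Opens (E n)) (g : E n → Matrix (Fin n) (Fin n) ℝ) : Prop where
  smooth : ∀ i j, ∀ p ∈ U, ContDiffAt ℝ ∞ (fun q => g q i j) p
  posDef : ∀ p ∈ U, (g p).PosDef

/-- A function of the position as an element of the algebra of smooth functions. -/
def ofPos {U : Opens (E n)} (hΩ : ∀ z ∈ Ω, z.1 ∈ U) (f : E n → ℝ)
    (hf : ∀ p ∈ U, ContDiffAt ℝ ∞ f p) : smoothAlg Ω :=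
  ofFun (fun z => f z.1) fun z hz => (hf z.1 (hΩ z hz)).comp z contDiffAt_fst

lemma ofPos_mem_basic {U : Opens (E n)} (hΩ : ∀ z ∈ Ω, z.1 ∈ U) (f : E n → ℝ)
    (hf : ∀ p ∈ U, ContDiffAt ℝ ∞ f p) : ofPos hΩ f hf ∈ (velocityAlgebra Ω).basic := fun k => by
  have h1 : Rep Ω (fun p _ => f p) (ofPos hΩ f hf) := fun z => rfl
  refine ext_ev fun z => ?_
  rw [ev_apply, ← h1.dY k z]
  simp [dY]

variable {U : Opens (E n)} {g : E n → Matrix (Fin n) (Fin n) ℝ}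

lemma LocalMetric.isUnit_det (hg : LocalMetric U g) {p : E n} (hp : p ∈ U) : IsUnit (g p).det :=
  (isUnit_iff_isUnit_det _).mp (hg.posDef p hp).isUnit

lemma LocalMetric.symm (hg : LocalMetric U g) {p : E n} (hp : p ∈ U) : (g p)ᵀ = g p := by
  simpa [IsHermitian, conjTranspose_eq_transpose_of_trivial] using (hg.posDef p hp).isHermitian

/-- The metric as a matrix over the algebra of smooth functions. -/
def LocalMetric.mat (hg : LocalMetric U g) (hΩ : ∀ z ∈ Ω, z.1 ∈ U) :
    Matrix (Fin n) (Fin n) (smoothAlg Ω) :=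
  Matrix.of fun i j => ofPos hΩ (fun q => g q i j) (hg.smooth i j)

lemma LocalMetric.map_ev_mat (hg : LocalMetric U g) (hΩ : ∀ z ∈ Ω, z.1 ∈ U) (z : Ω) :
    (hg.mat hΩ).map (ev z) = g z.1.1 := rfl

/-- The determinant has no zeros, hence is a unit of the algebra, so the matrix inverse exists over
the algebra itself. -/
lemma LocalMetric.mat_mul_inv (hg : LocalMetric U g) (hΩ : ∀ z ∈ Ω, z.1 ∈ U) :
    hg.mat hΩ * (hg.mat hΩ)⁻¹ = 1 := by
  refine mul_nonsing_inv _ ?_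
  obtain ⟨b, hb⟩ := exists_mul_eq_one (hg.mat hΩ).det fun z => by
    rw [← ev_apply]
    have := (ev z).map_det (hg.mat hΩ)
    rw [this]
    exact (hg.isUnit_det (hΩ z z.2)).ne_zero
  exact IsUnit.of_mul_eq_one b hb

/-- The metric over the algebra of smooth functions. -/
def LocalMetric.basicMetric (hg : LocalMetric U g) (hΩ : ∀ z ∈ Ω, z.1 ∈ U) :
    BasicMetric (velocityAlgebra Ω) :=
  BasicMetric.ofMetric _ (h := hg.mat hΩ) (hi := (hg.mat hΩ)⁻¹)
    (by
      ext i j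
      exact ext_ev fun z => congrFun (congrFun (hg.symm (hΩ z z.2)) i) j)
    (hg.mat_mul_inv hΩ) (fun i j => ofPos_mem_basic hΩ (fun q => g q i j) (hg.smooth i j))

lemma LocalMetric.map_ev_inv (hg : LocalMetric U g) (hΩ : ∀ z ∈ Ω, z.1 ∈ U) (z : Ω) :
    (hg.basicMetric hΩ).hi.map (ev z) = (g z.1.1)⁻¹ := by
  refine (inv_eq_right_inv ?_).symm
  rw [← hg.map_ev_mat hΩ z]
  have := congrArg (fun M => M.map (ev z)) (hg.mat_mul_inv hΩ)
  simp only [Matrix.map_mul] at this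
  rw [Matrix.map_one _ (map_zero _) (map_one _)] at this
  exact this

lemma LocalMetric.rep_h (hg : LocalMetric U g) (hΩ : ∀ z ∈ Ω, z.1 ∈ U) (i j : Fin n) :
    Rep Ω (fun p _ => g p i j) ((hg.basicMetric hΩ).h i j) := fun _ => rfl

lemma LocalMetric.rep_hi (hg : LocalMetric U g) (hΩ : ∀ z ∈ Ω, z.1 ∈ U) (i j : Fin n) :
    Rep Ω (fun p _ => (g p)⁻¹ i j) ((hg.basicMetric hΩ).hi i j) := fun z =>
  (congrFun (congrFun (hg.map_ev_inv hΩ z) i) j).symm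

lemma LocalMetric.rep_Γ (hg : LocalMetric U g) (hΩ : ∀ z ∈ Ω, z.1 ∈ U) (i k j : Fin n) :
    Rep Ω (fun p _ => christoffel g k i j p) ((hg.basicMetric hΩ).Γ i k j) := fun z => by
  have e : (hg.basicMetric hΩ).Γ i k j = half _ * ∑ l, (hg.basicMetric hΩ).hi k l *
    ((velocityAlgebra Ω).X i ((hg.basicMetric hΩ).h j l)
      + (velocityAlgebra Ω).X j ((hg.basicMetric hΩ).h i l)
      - (velocityAlgebra Ω).X l ((hg.basicMetric hΩ).h i j)) := rfl
  rw [e, ← ev_apply, map_mul, ev_half, map_sum]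
  change (1 / 2 : ℝ) * ∑ l, _ = _
  refine congrArg _ (Finset.sum_congr rfl fun l _ => ?_)
  rw [map_mul, map_sub, map_add, ev_apply, ev_apply, ev_apply, ev_apply, ← hg.rep_hi hΩ k l z,
    ← (hg.rep_h hΩ j l).dX i z, ← (hg.rep_h hΩ i l).dX j z, ← (hg.rep_h hΩ i j).dX l z]
  rfl

/-- The Ricci tensor of a metric in coordinates. -/
def ricciTensor (g : E n → Matrix (Fin n) (Fin n) ℝ) (j b : Fin n) (p : E n) : ℝ :=
  ∑ i, (dPos i (christoffel g i j b) p - dPos j (christoffel g i i b) p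
    + ∑ c, christoffel g i i c p * christoffel g c j b p
    - ∑ c, christoffel g i j c p * christoffel g c i b p)

lemma LocalMetric.rep_Ric (hg : LocalMetric U g) (hΩ : ∀ z ∈ Ω, z.1 ∈ U) (j b : Fin n) :
    Rep Ω (fun p _ => ricciTensor g j b p) ((hg.basicMetric hΩ).Ric j b) := fun z => by
  simp only [MetricData.Ric, MetricData.R, Matrix.add_apply, Matrix.sub_apply, Matrix.map_apply,
    Matrix.mul_apply]
  rw [← ev_apply, map_sum, ricciTensor]
  refine Finset.sum_congr rfl fun i _ => ?_
  simp only [map_sub, map_add, map_sum, map_mul, ev_apply, ← hg.rep_Γ hΩ _ _ _ z]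
  rw [← (hg.rep_Γ hΩ j i b).dX i z, ← (hg.rep_Γ hΩ i i b).dX j z]
  rfl

end Kropina

end

/-! ### Real linear algebra: divisibility by 1 + t², nondegeneracy, trace of a skew square -/

noncomputable section

open Matrix TopologicalSpace SmoothFunctions

section RealLemmas

open Polynomial in
-- An identity of real polynomials may be evaluated at t = i, where the left side vanishes; this
-- gives bi - c = 0.
lemma eq_zero_of_one_add_sq_mul {q : ℝ[X]} {k b c : ℝ} (hk : k ≠ 0)
    (h : ∀ t : ℝ, (1 + t ^ 2) * q.eval t = k * (b * t + c * t ^ 2) ^ 2) : b = 0 ∧ c = 0 := by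
  have h1 : (1 + X ^ 2) * q = C k * (C b * X + C c * X ^ 2) ^ 2 :=
    Polynomial.funext fun t => by simpa using h t
  have h2 := congrArg (aeval Complex.I) h1
  simp only [map_mul, map_add, map_one, map_pow, aeval_X, aeval_C, Complex.I_sq,
    Complex.coe_algebraMap] at h2
  rw [add_neg_cancel, zero_mul, eq_comm, mul_eq_zero] at h2
  have h3 := pow_eq_zero_iff (two_ne_zero) |>.mp (h2.resolve_left (by exact_mod_cast hk))
  have h4 := congrArg Complex.re h3
  have h5 := congrArg Complex.im h3
  simp at h4 h5
  exact ⟨h5, h4⟩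

variable {n : ℕ} {g : Matrix (Fin n) (Fin n) ℝ}

lemma Matrix.PosDef.dotProduct_pos (hg : g.PosDef) {x : Fin n → ℝ} (hx : x ≠ 0) :
    0 < x ⬝ᵥ g *ᵥ x := by simpa using hg.dotProduct_mulVec_pos hx

lemma Matrix.PosDef.dotProduct_nonneg (hg : g.PosDef) (x : Fin n → ℝ) : 0 ≤ x ⬝ᵥ g *ᵥ x := by
  rcases eq_or_ne x 0 with rfl | hx
  · simp
  · exact (hg.dotProduct_pos hx).le

lemma Matrix.PosDef.dotProduct_comm' (hg : g.PosDef) (x y : Fin n → ℝ) :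
    x ⬝ᵥ g *ᵥ y = y ⬝ᵥ g *ᵥ x := by
  have hs : gᵀ = g := by
    simpa [IsHermitian, conjTranspose_eq_transpose_of_trivial] using hg.isHermitian
  rw [dotProduct_mulVec, ← mulVec_transpose, hs, dotProduct_comm]

lemma Matrix.PosDef.cauchy_schwarz (hg : g.PosDef) (x y : Fin n → ℝ) :
    (x ⬝ᵥ g *ᵥ y) ^ 2 ≤ (x ⬝ᵥ g *ᵥ x) * (y ⬝ᵥ g *ᵥ y) := by
  rcases eq_or_ne x 0 with rfl | hx
  · simp
  have hq := hg.dotProduct_pos hx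
  have h1 := hg.dotProduct_nonneg ((x ⬝ᵥ g *ᵥ x) • y - (x ⬝ᵥ g *ᵥ y) • x)
  simp only [mulVec_sub, mulVec_smul, dotProduct_sub, sub_dotProduct, dotProduct_smul,
    smul_dotProduct, smul_eq_mul, hg.dotProduct_comm' y x] at h1
  have h2 : 0 ≤ (x ⬝ᵥ g *ᵥ x) * ((x ⬝ᵥ g *ᵥ x) * (y ⬝ᵥ g *ᵥ y) - (x ⬝ᵥ g *ᵥ y) ^ 2) := by
    linarith
  have := nonneg_of_mul_nonneg_right h2 hq
  linarith

/-- The fundamental tensor of a Kropina metric is nondegenerate. -/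
lemma isUnit_det_kropina (hg : g.PosDef) {y w f : Fin n → ℝ} {f2 : Matrix (Fin n) (Fin n) ℝ}
    {F w0 : ℝ} (hF : 0 < F) (hw0 : 0 < w0) (hH : y ⬝ᵥ g *ᵥ y = 2 * w0 * F)
    (hf : ∀ i, w0 * f i = (g *ᵥ y) i - F * w i)
    (hf2 : ∀ i j, w0 * f2 i j = g i j - w j * f i - w i * f j) :
    IsUnit (Matrix.of fun i j => 2 * (f i * f j + F * f2 i j)).det := by
  rw [isUnit_iff_ne_zero]
  intro hdet
  obtain ⟨x, hx, hMx⟩ := exists_mulVec_eq_zero_iff.mpr hdet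
  have h1 : ∑ i, ∑ j, (f i * f j + F * f2 i j) * x i * x j = 0 := by
    have : x ⬝ᵥ (Matrix.of fun i j => 2 * (f i * f j + F * f2 i j)) *ᵥ x =
        2 * ∑ i, ∑ j, (f i * f j + F * f2 i j) * x i * x j := by
      simp only [dotProduct, mulVec, Matrix.of_apply, Finset.mul_sum]
      exact Finset.sum_congr rfl fun _ _ => Finset.sum_congr rfl fun _ _ => by ring
    rw [hMx, dotProduct_zero] at this
    linarith
  set q := x ⬝ᵥ g *ᵥ x with hq
  set e := w0 * (f ⬝ᵥ x) with he
  set c := w ⬝ᵥ x with hc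
  set a := y ⬝ᵥ g *ᵥ x with ha
  have hea : e = a - F * c := by
    rw [he, ha, hg.dotProduct_comm', hc]
    simp only [dotProduct, Finset.mul_sum, ← Finset.sum_sub_distrib]
    exact Finset.sum_congr rfl fun i _ => by linear_combination x i * hf i
  have h2 : w0 * ∑ i, ∑ j, f2 i j * x i * x j = q - 2 * c * (f ⬝ᵥ x) := by
    have e1 : c * (f ⬝ᵥ x) = ∑ i, ∑ j, w i * f j * x i * x j := by
      simp only [hc, dotProduct, Finset.sum_mul_sum]
      exact Finset.sum_congr rfl fun _ _ => Finset.sum_congr rfl fun _ _ => by ring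
    have e2 : c * (f ⬝ᵥ x) = ∑ i, ∑ j, w j * f i * x i * x j := by
      rw [e1, Finset.sum_comm]
      exact Finset.sum_congr rfl fun _ _ => Finset.sum_congr rfl fun _ _ => by ring
    have e3 : q = ∑ i, ∑ j, g i j * x i * x j := by
      simp only [hq, dotProduct, mulVec, Finset.mul_sum]
      exact Finset.sum_congr rfl fun _ _ => Finset.sum_congr rfl fun _ _ => by ring
    have e4 : q - c * (f ⬝ᵥ x) - c * (f ⬝ᵥ x) =
        w0 * ∑ i, ∑ j, f2 i j * x i * x j := by
      nth_rewrite 1 [e2]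
      rw [e3, e1]
      simp only [← Finset.sum_sub_distrib, Finset.mul_sum]
      exact Finset.sum_congr rfl fun i _ => Finset.sum_congr rfl fun j _ => by
        linear_combination (-(x i * x j)) * hf2 i j
    linarith
  have h3 : (f ⬝ᵥ x) ^ 2 + F * ∑ i, ∑ j, f2 i j * x i * x j = 0 := by
    rw [← h1, sq, dotProduct, Finset.sum_mul_sum, Finset.mul_sum, ← Finset.sum_add_distrib]
    refine Finset.sum_congr rfl fun i _ => ?_
    rw [Finset.mul_sum, ← Finset.sum_add_distrib]
    exact Finset.sum_congr rfl fun _ _ => by ring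
  -- For x in the kernel, with q = g(x,x), c = w(x), e = w0 f(x), the form gives e² + F w0 q = 2Fec.
  -- Cauchy-Schwarz gives (e + Fc)² ≤ 2F w0 q. Together 2e² + (e - Fc)² ≤ 0, so e = 0 and F w0 q =
  -- 0, a contradiction.
  have h4 : e ^ 2 + F * w0 * q - 2 * F * e * c = 0 := by
    rw [he]; linear_combination w0 ^ 2 * h3 - F * w0 * h2
  have hcs := hg.cauchy_schwarz y x
  rw [hH, ← ha, ← hq] at hcs
  have hqpos := hg.dotProduct_pos hx
  rw [← hq] at hqpos
  have h5 : 0 < F * w0 * q := by positivity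
  have ha2 : a = e + F * c := by linarith
  rw [ha2] at hcs
  have h6 : 3 * e ^ 2 - 2 * e * (F * c) + (F * c) ^ 2 ≤ 0 := by nlinarith
  have h7 : e = 0 := by
    have : e ^ 2 ≤ 0 := by nlinarith [sq_nonneg (e - F * c)]
    exact pow_eq_zero_iff two_ne_zero |>.mp (le_antisymm this (sq_nonneg e))
  rw [h7] at h4
  linarith

open scoped MatrixOrder in
/-- The trace of the square of a skew-adjoint endomorphism is not positive. -/
lemma trace_sq_nonpos (hg : g.PosDef) {B : Matrix (Fin n) (Fin n) ℝ}
    (hB : (g * B)ᵀ = -(g * B)) : (B * B).trace ≤ 0 := by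
  have hdet : IsUnit g.det := (isUnit_iff_isUnit_det _).mp hg.isUnit
  -- With g⁻¹ = SᵀS and C = gB skew, tr B² = tr (SCSᵀ)², which is minus the squared Hilbert-Schmidt
  -- norm of the skew matrix SCSᵀ.
  obtain ⟨S, hS⟩ := CStarAlgebra.nonneg_iff_eq_star_mul_self.mp hg.inv.posSemidef.nonneg
  rw [star_eq_conjTranspose, conjTranspose_eq_transpose_of_trivial] at hS
  set C := g * B with hC
  have hBC : B = g⁻¹ * C := by rw [hC, ← mul_assoc, nonsing_inv_mul _ hdet, one_mul]
  have h1 : (B * B).trace = -((S * C * Sᵀ)ᵀ * (S * C * Sᵀ)).trace := by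
    rw [hBC, hS, transpose_mul, transpose_mul, transpose_transpose, hB]
    have : Sᵀ * S * C * (Sᵀ * S * C) = Sᵀ * (S * C * Sᵀ * (S * C)) := by
      simp only [mul_assoc]
    rw [this, trace_mul_comm, ← trace_neg]
    congr 1
    simp only [mul_assoc, neg_mul, mul_neg, neg_neg]
  have h2 := (posSemidef_conjTranspose_mul_self (S * C * Sᵀ)).trace_nonneg
  rw [conjTranspose_eq_transpose_of_trivial] at h2
  linarith

end RealLemmas

namespace VelocityAlgebra

variable {n : ℕ} {A : Type*} [CommRing A] [Algebra ℝ A] {T : VelocityAlgebra n A}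

lemma map_dotProduct' {B : Type*} [CommRing B] [Algebra ℝ B] (φ : A →ₐ[ℝ] B) (u v : Fin n → A) :
    φ (u ⬝ᵥ v) = (fun i => φ (u i)) ⬝ᵥ fun i => φ (v i) := by
  simp [dotProduct]

lemma map_mulVec' {B : Type*} [CommRing B] [Algebra ℝ B] (φ : A →ₐ[ℝ] B)
    (M : Matrix (Fin n) (Fin n) A) (v : Fin n → A) (i : Fin n) :
    φ ((M *ᵥ v) i) = (M.map φ *ᵥ fun i => φ (v i)) i := map_dotProduct' φ _ _

namespace NavigationData

variable (N : NavigationData T)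

lemma w0_mul_Y_Y_F (i j : Fin n) : N.w0 * T.Y i (T.Y j N.F) =
    N.h i j - N.w j * T.Y i N.F - N.w i * T.Y j N.F := by
  have h1 := congrArg (T.Y i) (N.w0_mul_Y_F j)
  rw [Derivation.leibniz, map_sub, N.Y_h_mulVec_y, Derivation.leibniz, Y_w0,
    basic.Y (N.w_basic j)] at h1
  simp only [smul_eq_mul] at h1
  have hs : N.h j i = N.h i j := congrFun (congrFun N.symm i) j
  rw [hs] at h1
  linear_combination h1

lemma Y_Y_sq_F (i j : Fin n) : T.Y i (T.Y j (N.F ^ 2)) =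
    2 * (T.Y i N.F * T.Y j N.F + N.F * T.Y i (T.Y j N.F)) := by
  simp only [sq, Derivation.leibniz, smul_eq_mul, map_add]
  ring

lemma spray_Y_sq_F {p : A} (hp : N.F * p = N.F * N.ρ - N.r) (l : Fin n) :
    T.spray (N.γ + (N.V + p • T.y)) (T.Y l (N.F ^ 2)) = T.X l (N.F ^ 2) := by
  simp only [sq, Derivation.leibniz, smul_eq_mul, map_add, N.spray_F hp, N.spray_Y_F hp]
  ring

end NavigationData

end VelocityAlgebra

end

/-! ### Riemannian and Kropina metrics in a coordinate domain -/

noncomputable section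

open Matrix TopologicalSpace SmoothFunctions

namespace Kropina

open VelocityAlgebra

variable {n : ℕ}

/-! ### Riemannian metrics -/

/-- All positions in `U` with arbitrary velocities. -/
def fullDomain (U : Opens (E n)) : Opens (E n × E n) :=
  ⟨Prod.fst ⁻¹' (U : Set (E n)), U.isOpen.preimage continuous_fst⟩

variable {U : Opens (E n)} {g : E n → Matrix (Fin n) (Fin n) ℝ}

namespace LocalMetric

variable (hg : LocalMetric U g)

lemma ev_h2 {Ω : Opens (E n × E n)} (hΩ : ∀ z ∈ Ω, z.1 ∈ U) (z : Ω) :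
    ev z (hg.basicMetric hΩ).h2 = z.1.2.ofLp ⬝ᵥ g z.1.1 *ᵥ z.1.2.ofLp := by
  rw [BasicMetric.h2, map_dotProduct']
  simp only [map_mulVec']
  rfl

include hg

/-- The Ricci curvature of a Riemannian metric is given by its Ricci tensor. -/
lemma ricciCurvature_eq {F : E n → E n → ℝ}
    (hF : ∀ p ∈ U, ∀ v, F p v ^ 2 = v.ofLp ⬝ᵥ g p *ᵥ v.ofLp) {p : E n} (hp : p ∈ U) (v : E n) :
    ricciCurvature F p v = ∑ j, ∑ b, ricciTensor g j b p * v j * v b := by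
  have hΩ : ∀ z ∈ fullDomain U, z.1 ∈ U := fun _ h => h
  set N := hg.basicMetric hΩ
  have hL : Rep (fullDomain U) (sqF F) N.h2 := fun z => by
    rw [← ev_apply, hg.ev_h2]; exact hF _ z.2 _
  have hdet : ∀ z : fullDomain U, IsUnit (Matrix.of fun i j =>
      ev z ((velocityAlgebra _).Y i ((velocityAlgebra _).Y j N.h2))).det := fun z => by
    have : (Matrix.of fun i j => ev z ((velocityAlgebra _).Y i ((velocityAlgebra _).Y j N.h2))) =
        (2 : ℝ) • g z.1.1 := by
      ext i j
      have e : (velocityAlgebra _).Y i ((velocityAlgebra _).Y j N.h2) = 2 * N.h j i := by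
        rw [N.Y_h2, two_mul, map_add, N.Y_h_mulVec_y, two_mul]
      rw [Matrix.of_apply, e, map_mul, map_ofNat, Matrix.smul_apply, smul_eq_mul]
      congr 1
      exact congrFun (congrFun (hg.symm z.2) i) j
    rw [this, det_smul, isUnit_iff_ne_zero]
    exact mul_ne_zero (by positivity) (hg.isUnit_det z.2).ne_zero
  have hG := fun i => rep_geodesicCoeff hL (K := N.γ) N.spray_Y_h2 hdet i
  have h1 := Kropina.ricciCurvature_eq hG ⟨(p, v), hp⟩
  have h2 : ev ⟨(p, v), hp⟩ (∑ j, ∑ b, N.Ric j b * (velocityAlgebra (fullDomain U)).y j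
      * (velocityAlgebra (fullDomain U)).y b) =
      ∑ j, ∑ b, ricciTensor g j b p * v j * v b := by
    simp only [map_sum, map_mul]
    refine Finset.sum_congr rfl fun j _ => Finset.sum_congr rfl fun b _ => ?_
    rw [show ev ⟨(p, v), hp⟩ (N.Ric j b) = ricciTensor g j b p from
      ((hg.rep_Ric hΩ j b).eq_ev ⟨(p, v), hp⟩).symm]
    rfl
  rw [N.ric4_γ, map_mul, h2, map_ofNat] at h1
  simpa using h1

lemma ricciTensor_comm {p : E n} (hp : p ∈ U) (i j : Fin n) :
    ricciTensor g i j p = ricciTensor g j i p := by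
  have hΩ : ∀ z ∈ fullDomain U, z.1 ∈ U := fun _ h => h
  have h1 := (hg.rep_Ric hΩ i j).eq_ev ⟨(p, 0), hp⟩
  have h2 := (hg.rep_Ric hΩ j i).eq_ev ⟨(p, 0), hp⟩
  rw [(hg.basicMetric hΩ).Ric_comm] at h1
  exact h1.trans h2.symm

/-- Schur's lemma in coordinates. -/
lemma schur (hn : 3 ≤ n) {δ : E n → ℝ}
    (hδ : ∀ p ∈ U, ∀ i j, ricciTensor g i j p = δ p * g p i j) {p : E n} (hp : p ∈ U) :
    HasFDerivAt δ (0 : E n →L[ℝ] ℝ) p := by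
  have hΩ : ∀ z ∈ fullDomain U, z.1 ∈ U := fun _ h => h
  set N := hg.basicMetric hΩ
  -- δ is an arbitrary function a priori. Writing it as the normalised scalar curvature (1/n) tr(h⁻¹
  -- Ric) shows that it is smooth.
  set d : smoothAlg (fullDomain U) := (n : ℝ)⁻¹ • ∑ i, ∑ j, N.Ric i j * N.hi j i with hd
  have hR : ∀ (z : fullDomain U) i j, ev z (N.Ric i j) = ricciTensor g i j z.1.1 :=
    fun z i j => ((hg.rep_Ric hΩ i j).eq_ev z).symm
  have hhi : ∀ (z : fullDomain U) i j, ev z (N.hi i j) = (g z.1.1)⁻¹ i j :=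
    fun z i j => ((hg.rep_hi hΩ i j).eq_ev z).symm
  have hh : ∀ (z : fullDomain U) i j, ev z (N.h i j) = g z.1.1 i j := fun _ _ _ => rfl
  have hdR : Rep (fullDomain U) (fun p _ => δ p) d := fun z => by
    have e : ev z d = (n : ℝ)⁻¹ * ∑ i, ∑ j, ev z (N.Ric i j) * ev z (N.hi j i) := by
      rw [hd]; simp only [map_smul, map_sum, map_mul, smul_eq_mul]
    have hinv : g z.1.1 * (g z.1.1)⁻¹ = 1 := mul_nonsing_inv _ (hg.isUnit_det z.2)
    have e2 : ∑ i, ∑ j, ev z (N.Ric i j) * ev z (N.hi j i) = n * δ z.1.1 := by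
      simp only [hR, hhi, hδ _ z.2, mul_assoc,
        ← Finset.mul_sum]
      simp only [← Matrix.mul_apply, hinv]
      simp [mul_comm]
    rw [← ev_apply, e, e2]
    have : (n : ℝ) ≠ 0 := by positivity
    field_simp
  have hRic : ∀ i j, N.Ric i j = d * N.h i j := fun i j => ext_ev fun z => by
    rw [map_mul, hR, hh, hδ _ z.2, ← hdR.eq_ev z]
  have hX : ∀ k, dPos k δ p = 0 := fun k => by
    have h1 := congrArg (ev ⟨(p, 0), hp⟩) (N.schur hRic k)
    rw [map_mul, map_sub, map_natCast, map_ofNat, map_zero, mul_eq_zero] at h1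
    have h2 : (n : ℝ) - 2 ≠ 0 := by
      have : (3 : ℝ) ≤ n := by exact_mod_cast hn
      linarith
    rw [← h1.resolve_left h2]
    exact (hdR.dX k).eq_ev ⟨(p, 0), hp⟩
  have hdiff : DifferentiableAt ℝ δ p := by
    have h1 : DifferentiableAt ℝ (fun z : E n × E n => δ z.1) (p, 0) :=
      (contDiffAt_of_eq (f := fun z : E n × E n => δ z.1) hdR (z := (p, 0)) hp).differentiableAt
        (by simp)
    exact h1.comp p (f := fun q : E n => (q, (0 : E n))) (by fun_prop)
  have h0 : fderiv ℝ δ p = 0 := by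
    ext v
    have hv : v = ∑ i, v i • EuclideanSpace.single i (1 : ℝ) := by
      ext j; simp [Finset.sum_apply, Pi.single_apply]
    rw [hv, map_sum]
    simp only [map_smul]
    exact Finset.sum_eq_zero fun i _ => by
      have := hX i
      simp only [dPos] at this
      rw [this]; simp
  rw [← h0]
  exact hdiff.hasFDerivAt

end LocalMetric

/-! ### Kropina metrics -/

/-- The components of a Riemannian metric and of a one-form of unit length. -/
structure LocalData (U : Opens (E n)) (g : E n → Matrix (Fin n) (Fin n) ℝ)
    (w : Fin n → E n → ℝ) : Prop where
  metric : LocalMetric U g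
  smooth : ∀ i, ∀ p ∈ U, ContDiffAt ℝ ∞ (w i) p
  unit : ∀ p ∈ U, (fun i => w i p) ⬝ᵥ (g p)⁻¹ *ᵥ (fun i => w i p) = 1

/-- The vector field dual to a one-form. -/
def dual (g : E n → Matrix (Fin n) (Fin n) ℝ) (w : Fin n → E n → ℝ) (p : E n) : E n :=
  WithLp.toLp 2 ((g p)⁻¹ *ᵥ fun i => w i p)

variable {w : Fin n → E n → ℝ}

namespace LocalData

variable (D : LocalData U g w)

/-- The half spaces `w(y) > 0`. -/
def domain (D : LocalData U g w) : Opens (E n × E n) :=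
  ⟨{z | z.1 ∈ U ∧ 0 < ∑ i, w i z.1 * z.2 i}, by
    have h1 : ContinuousOn (fun z : E n × E n => ∑ i, w i z.1 * z.2 i)
        (fullDomain U : Set (E n × E n)) := by
      refine continuousOn_finsetSum _ fun i _ => ?_
      refine ContinuousOn.mul (fun z hz => ?_) (by fun_prop)
      exact ((D.smooth i z.1 hz).continuousAt.comp continuousAt_fst).continuousWithinAt
    exact h1.isOpen_inter_preimage (fullDomain U).isOpen isOpen_Ioi⟩

lemma domain_fst (z) (hz : z ∈ D.domain) : z.1 ∈ U := hz.1

/-- The one-form over the algebra of smooth functions. -/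
def vec (i : Fin n) : smoothAlg D.domain := ofPos D.domain_fst (w i) (D.smooth i)

lemma exists_inv : ∃ b : smoothAlg D.domain, (D.vec ⬝ᵥ (velocityAlgebra _).y) * b = 1 :=
  exists_mul_eq_one _ fun z => by
    rw [← ev_apply, map_dotProduct']
    exact z.2.2.ne'

/-- The navigation data over the algebra of smooth functions. -/
def nav : NavigationData (velocityAlgebra D.domain) where
  toBasicMetric := D.metric.basicMetric D.domain_fst
  w := D.vec
  W := (D.metric.basicMetric D.domain_fst).hi *ᵥ D.vec
  w0i := D.exists_inv.choose
  w_basic i := ofPos_mem_basic D.domain_fst (w i) (D.smooth i)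
  W_basic i := by
    rw [mulVec, dotProduct]
    exact sum_mem fun j _ => mul_mem (inv_mem_basic _ (D.metric.basicMetric D.domain_fst).mul_hi
      (D.metric.basicMetric D.domain_fst).h_basic i j)
      (ofPos_mem_basic D.domain_fst (w j) (D.smooth j))
  h_mulVec_W := by
    rw [mulVec_mulVec, (D.metric.basicMetric D.domain_fst).mul_hi, one_mulVec]
  unit := ext_ev fun z => by
    rw [map_dotProduct', map_one, ← D.unit z.1.1 z.2.1]
    simp only [map_mulVec', D.metric.map_ev_inv]
    rfl
  w0_mul := D.exists_inv.choose_spec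

lemma hi_basic (i j : Fin n) : D.nav.hi i j ∈ (velocityAlgebra D.domain).basic :=
  inv_mem_basic _ D.nav.mul_hi D.nav.h_basic i j

lemma rep_w (i : Fin n) : Rep D.domain (fun p _ => w i p) (D.nav.w i) := fun _ => rfl

lemma ev_W (z : D.domain) (i : Fin n) : ev z (D.nav.W i) = dual g w z.1.1 i := by
  change ev z (((D.metric.basicMetric D.domain_fst).hi *ᵥ D.vec) i) = _
  rw [map_mulVec', D.metric.map_ev_inv]
  rfl

lemma ev_w0 (z : D.domain) : ev z D.nav.w0 = ∑ i, w i z.1.1 * z.1.2 i := by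
  rw [NavigationData.w0, map_dotProduct']
  rfl

lemma ev_h2 (z : D.domain) : ev z D.nav.h2 = z.1.2.ofLp ⬝ᵥ g z.1.1 *ᵥ z.1.2.ofLp :=
  D.metric.ev_h2 D.domain_fst z

lemma ne_zero (z : D.domain) : z.1.2.ofLp ≠ 0 := fun h => by
  have := z.2.2
  simp [h] at this

lemma ev_h2_pos (z : D.domain) : 0 < ev z D.nav.h2 := by
  rw [D.ev_h2]
  exact (D.metric.posDef _ z.2.1).dotProduct_pos (D.ne_zero z)

lemma ev_F (z : D.domain) : ev z D.nav.F =
    (z.1.2.ofLp ⬝ᵥ g z.1.1 *ᵥ z.1.2.ofLp) / (2 * ∑ i, w i z.1.1 * z.1.2 i) := by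
  have h1 := congrArg (ev z) D.nav.two_w0_mul_F
  rw [map_mul, map_mul, map_ofNat, D.ev_w0, D.ev_h2] at h1
  rw [eq_div_iff (mul_pos two_pos z.2.2).ne', ← h1]; ring

lemma isUnit_det (z : D.domain) : IsUnit (Matrix.of fun i j =>
    ev z ((velocityAlgebra _).Y i ((velocityAlgebra _).Y j (D.nav.F ^ 2)))).det := by
  set T := velocityAlgebra D.domain
  have h0 : ∀ i j, ev z (T.Y i (T.Y j (D.nav.F ^ 2))) =
      2 * (ev z (T.Y i D.nav.F) * ev z (T.Y j D.nav.F)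
        + ev z D.nav.F * ev z (T.Y i (T.Y j D.nav.F))) := fun i j => by
    rw [D.nav.Y_Y_sq_F, map_mul, map_add, map_mul, map_mul, map_ofNat]
  have hM : (Matrix.of fun i j => ev z (T.Y i (T.Y j (D.nav.F ^ 2)))) =
      Matrix.of fun i j => 2 * (ev z (T.Y i D.nav.F) * ev z (T.Y j D.nav.F)
        + ev z D.nav.F * ev z (T.Y i (T.Y j D.nav.F))) := by
    ext i j; exact h0 i j
  rw [hM]
  have hw0 : 0 < ev z D.nav.w0 := by rw [D.ev_w0]; exact z.2.2
  refine isUnit_det_kropina (D.metric.posDef _ z.2.1) (y := z.1.2.ofLp)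
    (w := fun i => w i z.1.1) (f := fun i => ev z (T.Y i D.nav.F))
    (f2 := Matrix.of fun i j => ev z (T.Y i (T.Y j D.nav.F))) (F := ev z D.nav.F)
    (w0 := ev z D.nav.w0) ?_ hw0 ?_ ?_ ?_
  · have h1 := congrArg (ev z) D.nav.two_w0_mul_F
    rw [map_mul, map_mul, map_ofNat] at h1
    have h2 := D.ev_h2_pos z
    rw [← h1] at h2
    exact pos_of_mul_pos_right h2 (by positivity)
  · have h1 := congrArg (ev z) D.nav.two_w0_mul_F
    rw [map_mul, map_mul, map_ofNat, D.ev_h2] at h1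
    exact h1.symm
  · intro i
    have h1 := congrArg (ev z) (D.nav.w0_mul_Y_F i)
    rw [map_mul, map_sub, map_mul, map_mulVec'] at h1
    exact h1
  · intro i j
    have h1 := congrArg (ev z) (D.nav.w0_mul_Y_Y_F i j)
    rw [map_mul, map_sub, map_sub, map_mul, map_mul] at h1
    exact h1

/-- The function `F` is the Kropina metric with the given navigation data. -/
def IsKropina (U : Opens (E n)) (g : E n → Matrix (Fin n) (Fin n) ℝ) (w : Fin n → E n → ℝ)
    (F : E n → E n → ℝ) : Prop :=
  ∀ p ∈ U, ∀ v : E n, 0 < ∑ i, w i p * v i →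
    F p v = (v.ofLp ⬝ᵥ g p *ᵥ v.ofLp) / (2 * ∑ i, w i p * v i)

variable {F : E n → E n → ℝ} (hF : IsKropina U g w F)

include hF

/-- The Euler-Lagrange equation for F² and the nondegenerate fundamental tensor identify the spray
of F. The factor p stays free so that the general case and the Killing case, with p = 0, are both
covered. -/
lemma ricciCurvature_eq {p : smoothAlg D.domain}
    (hp : D.nav.F * p = D.nav.F * D.nav.ρ - D.nav.r) (z : D.domain) :
    ricciCurvature F z.1.1 z.1.2 = ev z ((velocityAlgebra D.domain).ric4
      (D.nav.γ + (D.nav.V + p • (velocityAlgebra D.domain).y))) / 4 := by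
  have hL : Rep D.domain (sqF F) (D.nav.F ^ 2) := fun z => by
    rw [← ev_apply, map_pow, D.ev_F, sqF, hF _ z.2.1 _ z.2.2]
  exact Kropina.ricciCurvature_eq
    (fun i => rep_geodesicCoeff hL (D.nav.spray_Y_sq_F hp) D.isUnit_det i) z

end LocalData

end Kropina

end

/-! ### Einstein implies Killing, and the Ricci curvature for Killing fields in coordinates -/

noncomputable section

open Matrix TopologicalSpace SmoothFunctions

namespace Kropina

open VelocityAlgebra

variable {n : ℕ} {U : Opens (E n)} {g : E n → Matrix (Fin n) (Fin n) ℝ} {w : Fin n → E n → ℝ}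

/-- A function of the position only is constant along lines of velocities. -/
lemma ev_basic_eq {Ω : Opens (E n × E n)} {a : smoothAlg Ω} (ha : a ∈ (velocityAlgebra Ω).basic)
    {p v x : E n} (hline : ∀ t : ℝ, (p, v + t • x) ∈ Ω) (t s : ℝ) :
    ev ⟨_, hline t⟩ a = ev ⟨_, hline s⟩ a := by
  set f : ℝ → ℝ := fun t => extend Ω a.1 (p, v + t • x) with hf
  have hx : ((0 : E n), x) = ∑ i, x i • ((0 : E n), EuclideanSpace.single i (1 : ℝ)) := by
    have h1 : x = ∑ i, x i • EuclideanSpace.single i (1 : ℝ) := by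
      ext j; simp [Finset.sum_apply, Pi.single_apply]
    ext1
    · simp [Prod.fst_sum]
    · rw [Prod.snd_sum]; exact h1
  have hd : ∀ t, HasDerivAt f 0 t := fun t => by
    have h1 := (differentiableAt_extend a (hline t)).hasFDerivAt
    have h2 : HasDerivAt (fun t : ℝ => (p, v + t • x)) ((0 : E n), x) t :=
      (hasDerivAt_const t p).prodMk (by simpa using ((hasDerivAt_id t).smul_const x).const_add v)
    have h3 := h1.comp_hasDerivAt t h2
    have h4 : fderiv ℝ (extend Ω a.1) (p, v + t • x) ((0 : E n), x) = 0 := by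
      rw [hx, map_sum]
      refine Finset.sum_eq_zero fun i _ => ?_
      rw [map_smul]
      have : ev ⟨_, hline t⟩ ((velocityAlgebra Ω).Y i a) = 0 := by rw [basic.Y ha, map_zero]
      change fderiv ℝ (extend Ω a.1) (p, v + t • x) _ = 0 at this
      rw [this, smul_zero]
    rw [h4] at h3
    exact h3
  have h1 := is_const_of_deriv_eq_zero (fun t => (hd t).differentiableAt) (fun t => (hd t).deriv) t s
  simp only [hf] at h1
  rwa [extend_of_mem _ (hline t), extend_of_mem _ (hline s)] at h1

namespace LocalData

variable (D : LocalData U g w)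

lemma ev_h_mul_nabla (z : D.domain) (i j : Fin n) :
    ev z ((D.nav.h * D.nav.nabla D.nav.W) i j) = covDeriv g w i j z.1.1 := by
  have h1 : ev z ((velocityAlgebra _).X j (D.nav.w i)) = dPos j (w i) z.1.1 :=
    ((D.rep_w i).dX j |>.eq_ev z).symm
  have h2 : ∀ k, ev z (D.nav.Γ i k j) = christoffel g k i j z.1.1 := fun k =>
    (D.metric.rep_Γ D.domain_fst i k j |>.eq_ev z).symm
  rw [D.nav.h_mul_nabla, map_sub, map_sum, h1, covDeriv]
  congr 1
  refine Finset.sum_congr rfl fun k _ => ?_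
  rw [map_mul, D.nav.torsion, h2]
  rfl

/-- The covariant derivative of the one-form. -/
def cov (g : E n → Matrix (Fin n) (Fin n) ℝ) (w : Fin n → E n → ℝ) (p : E n) :
    Matrix (Fin n) (Fin n) ℝ := Matrix.of fun i j => covDeriv g w i j p

lemma map_ev_h_mul_nabla (z : D.domain) :
    (D.nav.h * D.nav.nabla D.nav.W).map (ev z) = cov g w z.1.1 := by
  ext i j; exact D.ev_h_mul_nabla z i j

lemma ev_r (z : D.domain) : ev z D.nav.r = z.1.2.ofLp ⬝ᵥ cov g w z.1.1 *ᵥ z.1.2.ofLp := by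
  rw [D.nav.r_eq, map_dotProduct']
  simp only [map_mulVec', D.map_ev_h_mul_nabla]
  rfl

include D in
lemma sum_w_dual {p : E n} (hp : p ∈ U) : ∑ i, w i p * dual g w p i = 1 := D.unit p hp

include D in
lemma g_mulVec_dual {p : E n} (hp : p ∈ U) : g p *ᵥ (dual g w p).ofLp = fun i => w i p := by
  change g p *ᵥ (g p)⁻¹ *ᵥ (fun i => w i p) = _
  rw [mulVec_mulVec, mul_nonsing_inv _ (D.metric.isUnit_det hp), one_mulVec]

/-- The point of the domain given by the dual vector field. -/
def dualPoint {p : E n} (hp : p ∈ U) : D.domain :=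
  ⟨(p, dual g w p), hp, by rw [D.sum_w_dual hp]; exact one_pos⟩

include D in
-- W has constant length. This removes the constant term of r on lines through W.
lemma dual_cov_dual {p : E n} (hp : p ∈ U) :
    (dual g w p).ofLp ⬝ᵥ cov g w p *ᵥ (dual g w p).ofLp = 0 := by
  have h1 : D.nav.W ⬝ᵥ (D.nav.h * D.nav.nabla D.nav.W) *ᵥ D.nav.W = 0 := by
    rw [← mulVec_mulVec, D.nav.W_dotProduct_h, dotProduct_mulVec, D.nav.w_vecMul_nabla,
      zero_dotProduct]
  have h2 := congrArg (ev (D.dualPoint hp)) h1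
  rw [map_dotProduct', map_zero] at h2
  simp only [map_mulVec', D.map_ev_h_mul_nabla, D.ev_W] at h2
  exact h2

section Line

variable {p : E n} (hp : p ∈ U) {x : E n} (hx : ∑ i, w i p * x i = 0)

include hp hx

include D in
lemma sum_w_line (t : ℝ) : ∑ i, w i p * (dual g w p + t • x) i = 1 := by
  have h1 := D.sum_w_dual hp
  have : ∑ i, w i p * (dual g w p + t • x) i =
      ∑ i, w i p * dual g w p i + t * ∑ i, w i p * x i := by
    rw [Finset.mul_sum, ← Finset.sum_add_distrib]
    exact Finset.sum_congr rfl fun i _ => by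
      rw [PiLp.add_apply, PiLp.smul_apply, smul_eq_mul]; ring
  rw [this, h1, hx]; ring

lemma line_mem (t : ℝ) : (p, dual g w p + t • x) ∈ D.domain :=
  ⟨hp, by rw [D.sum_w_line hp hx]; exact one_pos⟩

open Polynomial in
-- Along the line the position is fixed and w(y) = 1, so position functions and 1/w(y) are constant
-- and y is affine in t.
lemma exists_polynomial {a : smoothAlg D.domain} (ha : a ∈ D.nav.poly) :
    ∃ q : ℝ[X], ∀ t, ev ⟨_, D.line_mem hp hx t⟩ a = q.eval t := by
  induction ha using Algebra.adjoin_induction with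
  | mem a ha =>
    rcases ha with (ha | ⟨i, rfl⟩) | rfl
    · exact ⟨C (ev ⟨_, D.line_mem hp hx 0⟩ a), fun t => by
        rw [eval_C]; exact ev_basic_eq ha (D.line_mem hp hx) t 0⟩
    · refine ⟨C (dual g w p i) + Polynomial.X * C (x i), fun t => ?_⟩
      rw [ev_y, eval_add, eval_C, eval_mul, eval_X, eval_C]; simp only [PiLp.add_apply, PiLp.smul_apply, smul_eq_mul]
    · refine ⟨1, fun t => ?_⟩
      have h1 := congrArg (ev ⟨_, D.line_mem hp hx t⟩) D.nav.w0_mul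
      have h2 := D.ev_w0 ⟨_, D.line_mem hp hx t⟩
      rw [D.sum_w_line hp hx t] at h2
      rw [map_mul, map_one] at h1
      change ev _ D.nav.w0 * _ = 1 at h1
      rw [h2, one_mul] at h1
      rw [h1, eval_one]
  | algebraMap r => exact ⟨C r, fun t => by rw [AlgHom.commutes, eval_C]; rfl⟩
  | add a b _ _ h1 h2 =>
    obtain ⟨q1, h1⟩ := h1
    obtain ⟨q2, h2⟩ := h2
    exact ⟨q1 + q2, fun t => by rw [map_add, h1, h2, eval_add]⟩
  | mul a b _ _ h1 h2 =>
    obtain ⟨q1, h1⟩ := h1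
    obtain ⟨q2, h2⟩ := h2
    exact ⟨q1 * q2, fun t => by rw [map_mul, h1, h2, eval_mul]⟩

end Line

section Einstein

variable {F : E n → E n → ℝ} (hF : IsKropina U g w F)

include hF

open Polynomial in
include D in
/-- The deformation tensor of the navigation field of an Einstein Kropina metric vanishes on the
planes through the navigation field. -/
lemma cov_eq_zero_of_orthogonal (hn : 2 ≤ n) {p : E n} (hp : p ∈ U) {σ : ℝ}
    (hE : ∀ v : E n, 0 < ∑ i, w i p * v i → ricciCurvature F p v = σ * F p v ^ 2) {x : E n}
    (hx : ∑ i, w i p * x i = 0) (hx1 : x.ofLp ⬝ᵥ g p *ᵥ x.ofLp = 1) :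
    (dual g w p).ofLp ⬝ᵥ cov g w p *ᵥ x.ofLp + x.ofLp ⬝ᵥ cov g w p *ᵥ (dual g w p).ofLp = 0 ∧
      x.ofLp ⬝ᵥ cov g w p *ᵥ x.ofLp = 0 := by
  obtain ⟨h2i, hh⟩ := exists_mul_eq_one D.nav.h2 fun z => (D.ev_h2_pos z).ne'
  obtain ⟨a, ha, hric⟩ := D.nav.exists_h2_sq_mul_ric4 hh D.hi_basic
  obtain ⟨q, hq⟩ := D.exists_polynomial hp hx ha
  have hk : (12 * ((n : ℝ) - 1)) ≠ 0 := by
    have : (2 : ℝ) ≤ n := by exact_mod_cast hn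
    have : (n : ℝ) - 1 ≠ 0 := by linarith
    positivity
  -- Here F = (1 + t²)/2, so 4σF² = σ(1 + t²)². Multiplication by h(y,y)² gives σ(1 + t²)⁴ =
  -- 12(n-1)r² + (1 + t²)q.
  refine eq_zero_of_one_add_sq_mul (q := C σ * (1 + Polynomial.X ^ 2) ^ 3 - q) hk fun t => ?_
  set z : D.domain := ⟨_, D.line_mem hp hx t⟩ with hz
  have hw0 : ev z D.nav.w0 = 1 := (D.ev_w0 z).trans (D.sum_w_line hp hx t)
  have hgW := D.g_mulVec_dual hp
  have hWW : (dual g w p).ofLp ⬝ᵥ g p *ᵥ (dual g w p).ofLp = 1 := by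
    rw [hgW, dotProduct_comm]; exact D.sum_w_dual hp
  have hxW : x.ofLp ⬝ᵥ g p *ᵥ (dual g w p).ofLp = 0 := by
    rw [hgW, dotProduct_comm]; exact hx
  have hWx : (dual g w p).ofLp ⬝ᵥ g p *ᵥ x.ofLp = 0 := by
    rw [(D.metric.posDef p hp).dotProduct_comm', hxW]
  have hv : z.1.2.ofLp = (dual g w p).ofLp + t • x.ofLp := rfl
  have hh2 : ev z D.nav.h2 = 1 + t ^ 2 := by
    rw [D.ev_h2, hv]
    change _ ⬝ᵥ g p *ᵥ _ = _
    simp only [mulVec_add, mulVec_smul, dotProduct_add, add_dotProduct, dotProduct_smul,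
      smul_dotProduct, hWW, hxW, hWx, hx1, smul_eq_mul]
    ring
  have hr : ev z D.nav.r = ((dual g w p).ofLp ⬝ᵥ cov g w p *ᵥ x.ofLp
      + x.ofLp ⬝ᵥ cov g w p *ᵥ (dual g w p).ofLp) * t
      + (x.ofLp ⬝ᵥ cov g w p *ᵥ x.ofLp) * t ^ 2 := by
    rw [D.ev_r, hv]
    change _ ⬝ᵥ cov g w p *ᵥ _ = _
    simp only [mulVec_add, mulVec_smul, dotProduct_add, add_dotProduct, dotProduct_smul,
      smul_dotProduct, D.dual_cov_dual hp, smul_eq_mul]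
    ring
  have hFz : F p (dual g w p + t • x) = (1 + t ^ 2) / 2 := by
    rw [hF p hp _ z.2.2, ← hh2, D.ev_h2, D.sum_w_line hp hx, mul_one]
  have hR := D.ricciCurvature_eq hF (D.nav.F_mul_proj hh) z
  have hR2 := hE _ z.2.2
  have e : ricciCurvature F z.1.1 z.1.2 = σ * ((1 + t ^ 2) / 2) ^ 2 := by
    rw [← hFz]; exact hR2
  rw [e] at hR
  have h3 := congrArg (ev z) hric
  rw [map_mul, map_pow, map_add, map_mul, map_mul, map_mul, map_pow, map_mul, map_sub, map_natCast,
    map_one, hh2, hw0, hr, hq, map_ofNat] at h3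
  simp only [eval_sub, eval_mul, eval_C, eval_pow, eval_add, eval_one, eval_X]
  linear_combination h3 + 4 * (1 + t ^ 2) ^ 2 * hR

include D in
/-- The navigation field of an Einstein Kropina metric is a Killing field. -/
lemma killing_of_einstein (hn : 2 ≤ n) {p : E n} (hp : p ∈ U) {σ : ℝ}
    (hE : ∀ v : E n, 0 < ∑ i, w i p * v i → ricciCurvature F p v = σ * F p v ^ 2) (i j : Fin n) :
    covDeriv g w i j p + covDeriv g w j i p = 0 := by
  -- Split v = sW + x with w(x) = 0 and rescale x to unit length. Once the quadratic form of ∇w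
  -- vanishes, polarization gives the Killing equation.
  have hquad : ∀ v : E n, v.ofLp ⬝ᵥ cov g w p *ᵥ v.ofLp = 0 := fun v => by
    set s := ∑ i, w i p * v i with hs
    set x : E n := v - s • dual g w p with hx
    have hwx : ∑ i, w i p * x i = 0 := by
      have : ∑ i, w i p * x i = ∑ i, w i p * v i - s * ∑ i, w i p * dual g w p i := by
        rw [Finset.mul_sum, ← Finset.sum_sub_distrib]
        exact Finset.sum_congr rfl fun i _ => by
          rw [hx, PiLp.sub_apply, PiLp.smul_apply, smul_eq_mul]; ring
      rw [this, D.sum_w_dual hp]; ring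
    have hv : v.ofLp = s • (dual g w p).ofLp + x.ofLp := by
      rw [hx]; ext i; simp
    have hxx : (dual g w p).ofLp ⬝ᵥ cov g w p *ᵥ x.ofLp
        + x.ofLp ⬝ᵥ cov g w p *ᵥ (dual g w p).ofLp = 0 ∧ x.ofLp ⬝ᵥ cov g w p *ᵥ x.ofLp = 0 := by
      rcases eq_or_ne x.ofLp 0 with h0 | h0
      · simp [h0]
      set q := x.ofLp ⬝ᵥ g p *ᵥ x.ofLp with hq
      have hqpos : 0 < q := (D.metric.posDef p hp).dotProduct_pos h0
      have hsq : √q ≠ 0 := (Real.sqrt_pos.mpr hqpos).ne'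
      have h1 := D.cov_eq_zero_of_orthogonal hF hn hp hE (x := (√q)⁻¹ • x)
        (by
          simp only [PiLp.smul_apply, smul_eq_mul, mul_left_comm _ (√q)⁻¹]
          rw [← Finset.mul_sum, hwx, mul_zero])
        (by
          rw [WithLp.ofLp_smul, mulVec_smul, dotProduct_smul, smul_dotProduct, ← hq, smul_eq_mul,
            smul_eq_mul]
          nth_rewrite 3 [← Real.mul_self_sqrt hqpos.le]
          field_simp)
      simp only [WithLp.ofLp_smul, mulVec_smul, dotProduct_smul, smul_dotProduct, smul_eq_mul,
        ← mul_add] at h1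
      exact ⟨(mul_eq_zero.mp h1.1).resolve_left (inv_ne_zero hsq),
        (mul_eq_zero.mp ((mul_eq_zero.mp h1.2).resolve_left (inv_ne_zero hsq))).resolve_left
          (inv_ne_zero hsq)⟩
    rw [hv]
    simp only [mulVec_add, mulVec_smul, dotProduct_add, add_dotProduct, dotProduct_smul,
      smul_dotProduct, D.dual_cov_dual hp, smul_eq_mul, hxx.2]
    linear_combination s * hxx.1
  have hs : ∀ a b : Fin n, (Pi.single a 1 : Fin n → ℝ) ⬝ᵥ cov g w p *ᵥ Pi.single b 1 =
      covDeriv g w a b p := fun a b => by simp [cov]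
  have h1 := hquad (WithLp.toLp 2 (Pi.single i 1 + Pi.single j 1))
  have h2 := hquad (WithLp.toLp 2 (Pi.single i 1))
  have h3 := hquad (WithLp.toLp 2 (Pi.single j 1))
  simp only [mulVec_add, dotProduct_add, add_dotProduct, hs] at h1 h2 h3
  linarith

end Einstein

lemma ev_Ric (z : D.domain) (i j : Fin n) : ev z (D.nav.Ric i j) = ricciTensor g i j z.1.1 :=
  ((D.metric.rep_Ric D.domain_fst i j).eq_ev z).symm

section Killing

variable (hK : ∀ p ∈ U, ∀ i j, covDeriv g w i j p + covDeriv g w j i p = 0)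

include hK

lemma transpose_h_mul_nabla :
    (D.nav.h * D.nav.nabla D.nav.W)ᵀ = -(D.nav.h * D.nav.nabla D.nav.W) := by
  ext i j
  refine ext_ev fun z => ?_
  rw [Matrix.neg_apply, Matrix.transpose_apply, map_neg, D.ev_h_mul_nabla, D.ev_h_mul_nabla]
  linarith [hK _ z.2.1 i j]

include D in
/-- The Ricci curvature of a Kropina metric whose navigation field is a Killing field. -/
lemma ricciCurvature_of_killing {F : E n → E n → ℝ} (hF : IsKropina U g w F) {p : E n}
    (hp : p ∈ U) {v : E n} (hv : 0 < ∑ i, w i p * v i) :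
    ricciCurvature F p v = ∑ j, ∑ b, ricciTensor g j b p * (v j - F p v * dual g w p j)
      * (v b - F p v * dual g w p b) := by
  have hC := D.transpose_h_mul_nabla hK
  have h0 : D.nav.F * 0 = D.nav.F * D.nav.ρ - D.nav.r := by
    rw [D.nav.ρ_eq_zero hC, D.nav.r_eq_zero hC]; ring
  have h1 := D.ricciCurvature_eq hF h0 ⟨(p, v), hp, hv⟩
  rw [zero_smul, add_zero, D.nav.ric4_of_killing hC, map_mul, map_ofNat] at h1
  have h2 : F p v = ev (⟨(p, v), hp, hv⟩ : D.domain) D.nav.F := by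
    rw [D.ev_F, hF p hp v hv]
  have h3 : ev (⟨(p, v), hp, hv⟩ : D.domain) (∑ j, ∑ b, D.nav.Ric j b *
      ((velocityAlgebra D.domain).y j - D.nav.F * D.nav.W j) *
      ((velocityAlgebra D.domain).y b - D.nav.F * D.nav.W b)) =
      ∑ j, ∑ b, ricciTensor g j b p * (v j - F p v * dual g w p j)
        * (v b - F p v * dual g w p b) := by
    simp only [map_sum, map_mul, map_sub, D.ev_Ric, D.ev_W, ev_y, h2]
  rw [← h3]
  change ricciCurvature F p v = _ at h1
  rw [h1]; ring

include D in
/-- The Ricci curvature is nonnegative in the direction of a unit Killing field. -/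
lemma ricciTensor_dual_nonneg {p : E n} (hp : p ∈ U) :
    0 ≤ ∑ j, ∑ b, ricciTensor g j b p * dual g w p j * dual g w p b := by
  have hC := D.transpose_h_mul_nabla hK
  set z := D.dualPoint hp
  have h1 := congrArg (ev z)
    (D.nav.ric_of_nabla D.nav.W (D.nav.trace_nabla hC) (D.nav.nabla_mulVec_W hC))
  set B := (D.nav.nabla D.nav.W).map (ev z) with hB
  have h2 : ev z ((D.nav.nabla D.nav.W * D.nav.nabla D.nav.W).trace) = (B * B).trace := by
    simp only [Matrix.trace, Matrix.diag_apply, Matrix.mul_apply, map_sum, map_mul, hB,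
      Matrix.map_apply]
  have h3 : (g p * B)ᵀ = -(g p * B) := by
    have e : g p * B = (D.nav.h * D.nav.nabla D.nav.W).map (ev z) := by
      rw [Matrix.map_mul]; rfl
    rw [e, ← transpose_map, hC]
    ext i j
    rw [Matrix.map_apply, Matrix.neg_apply, map_neg, Matrix.neg_apply, Matrix.map_apply]
  have h4 := trace_sq_nonpos (D.metric.posDef p hp) h3
  simp only [map_sum, map_mul, map_neg, D.ev_Ric, D.ev_W, h2] at h1
  change ∑ j, ∑ b, ricciTensor g j b p * dual g w p j * dual g w p b = _ at h1
  rw [h1]; linarith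

end Killing

end LocalData

end Kropina

end

/-! ### Einstein condition for F against Einstein condition for h -/

noncomputable section

open Matrix TopologicalSpace

namespace Kropina

variable {n : ℕ} {U : Opens (E n)} {g : E n → Matrix (Fin n) (Fin n) ℝ} {w : Fin n → E n → ℝ}

/-- The Ricci tensor as a matrix. -/
def ricciMatrix (g : E n → Matrix (Fin n) (Fin n) ℝ) (p : E n) : Matrix (Fin n) (Fin n) ℝ :=
  Matrix.of fun i j => ricciTensor g i j p

lemma sum_ricciTensor (p : E n) (v : Fin n → ℝ) :
    ∑ j, ∑ b, ricciTensor g j b p * v j * v b = v ⬝ᵥ ricciMatrix g p *ᵥ v := by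
  simp only [dotProduct, mulVec, ricciMatrix, Matrix.of_apply, Finset.mul_sum]
  exact Finset.sum_congr rfl fun i _ => Finset.sum_congr rfl fun j _ => by ring

/-- A symmetric matrix is determined by its quadratic form. -/
lemma eq_of_quadratic_eq {A B : Matrix (Fin n) (Fin n) ℝ} (hA : Aᵀ = A) (hB : Bᵀ = B)
    (h : ∀ v, v ⬝ᵥ A *ᵥ v = v ⬝ᵥ B *ᵥ v) : A = B := by
  ext i j
  have hs : ∀ (C : Matrix (Fin n) (Fin n) ℝ) (a b : Fin n),
      (Pi.single a 1 : Fin n → ℝ) ⬝ᵥ C *ᵥ Pi.single b 1 = C a b := fun C a b => by simp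
  have h1 := h (Pi.single i 1 + Pi.single j 1)
  have h2 := h (Pi.single i 1)
  have h3 := h (Pi.single j 1)
  simp only [mulVec_add, dotProduct_add, add_dotProduct, hs] at h1 h2 h3
  have h4 : A j i = A i j := congrFun (congrFun hA i) j
  have h5 : B j i = B i j := congrFun (congrFun hB i) j
  linarith

/-- The Ricci tensor of an Einstein metric, in coordinates. -/
lemma LocalMetric.ricciTensor_eq (hg : LocalMetric U g) {p : E n} (hp : p ∈ U) {σ : ℝ}
    (h : ∀ v, v ⬝ᵥ ricciMatrix g p *ᵥ v = σ * (v ⬝ᵥ g p *ᵥ v)) (i j : Fin n) :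
    ricciTensor g i j p = σ * g p i j := by
  have : ricciMatrix g p = σ • g p := by
    refine eq_of_quadratic_eq ?_ ?_ fun v => ?_
    · ext i j; exact hg.ricciTensor_comm hp j i
    · rw [transpose_smul, hg.symm hp]
    · rw [h, smul_mulVec, dotProduct_smul, smul_eq_mul]
  exact congrFun (congrFun this i) j

namespace LocalData

variable (D : LocalData U g w) (hK : ∀ p ∈ U, ∀ i j, covDeriv g w i j p + covDeriv g w j i p = 0)
  {F : E n → E n → ℝ} (hF : IsKropina U g w F)

include D in
lemma dual_dotProduct {p : E n} (hp : p ∈ U) :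
    (dual g w p).ofLp ⬝ᵥ g p *ᵥ (dual g w p).ofLp = 1 := by
  rw [D.g_mulVec_dual hp, dotProduct_comm]; exact D.sum_w_dual hp

include D in
lemma dotProduct_dual {p : E n} (hp : p ∈ U) (v : Fin n → ℝ) :
    v ⬝ᵥ g p *ᵥ (dual g w p).ofLp = ∑ i, w i p * v i := by
  rw [D.g_mulVec_dual hp, dotProduct_comm]; rfl

include D in
lemma dual_dotProduct' {p : E n} (hp : p ∈ U) (v : Fin n → ℝ) :
    (dual g w p).ofLp ⬝ᵥ g p *ᵥ v = ∑ i, w i p * v i := by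
  rw [(D.metric.posDef p hp).dotProduct_comm', D.dotProduct_dual hp]

include D hK hF in
lemma ricciCurvature_eq_dotProduct {p : E n} (hp : p ∈ U) {v : E n}
    (hv : 0 < ∑ i, w i p * v i) : ricciCurvature F p v =
      (v - F p v • dual g w p).ofLp ⬝ᵥ ricciMatrix g p *ᵥ (v - F p v • dual g w p).ofLp := by
  rw [D.ricciCurvature_of_killing hK hF hp hv, ← sum_ricciTensor]
  rfl

include D hK hF in
/-- If the metric of the navigation data is Einstein, and the field is Killing, then the Kropina
metric is Einstein. -/
lemma ricciCurvature_of_quadratic {p : E n} (hp : p ∈ U) {δ : ℝ}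
    (h : ∀ v, v ⬝ᵥ ricciMatrix g p *ᵥ v = δ * (v ⬝ᵥ g p *ᵥ v)) {v : E n}
    (hv : 0 < ∑ i, w i p * v i) : ricciCurvature F p v = δ * F p v ^ 2 := by
  rw [D.ricciCurvature_eq_dotProduct hK hF hp hv, h]
  -- h(y - FW, y - FW) = h(y,y) - 2F w(y) + F² = F².
  congr 1
  have h1 : v.ofLp ⬝ᵥ g p *ᵥ v.ofLp = F p v * (2 * ∑ i, w i p * v i) := by
    rw [hF p hp v hv, div_mul_cancel₀ _ (by positivity)]
  rw [WithLp.ofLp_sub, WithLp.ofLp_smul]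
  simp only [mulVec_sub, mulVec_smul, dotProduct_sub, sub_dotProduct, dotProduct_smul,
    smul_dotProduct, D.dual_dotProduct hp, D.dotProduct_dual hp v.ofLp,
    D.dual_dotProduct' hp v.ofLp, smul_eq_mul, h1]
  ring

include D hK hF in
/-- If the Kropina metric is Einstein, and the field is Killing, then the metric of the navigation
data is Einstein. -/
lemma quadratic_of_einstein {p : E n} (hp : p ∈ U) {σ : ℝ}
    (hE : ∀ v : E n, 0 < ∑ i, w i p * v i → ricciCurvature F p v = σ * F p v ^ 2)
    (v : Fin n → ℝ) : v ⬝ᵥ ricciMatrix g p *ᵥ v = σ * (v ⬝ᵥ g p *ᵥ v) := by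
  -- u is y - F(y)W for y = u + W: here w(y) = w(u) + 1 > 0 and h(y,y) = 2w(y), so F(y) = 1.
  have hunit : ∀ u : Fin n → ℝ, u ⬝ᵥ g p *ᵥ u = 1 → -1 < ∑ i, w i p * u i →
      u ⬝ᵥ ricciMatrix g p *ᵥ u = σ := fun u hu hu1 => by
    set x : E n := WithLp.toLp 2 u + dual g w p with hx
    have hxo : x.ofLp = u + (dual g w p).ofLp := rfl
    have hwx : ∑ i, w i p * x i = ∑ i, w i p * u i + 1 := by
      rw [← D.sum_w_dual hp, ← Finset.sum_add_distrib]
      exact Finset.sum_congr rfl fun i _ => by rw [hxo, Pi.add_apply]; ring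
    have hpos : 0 < ∑ i, w i p * x i := by rw [hwx]; linarith
    have hFx : F p x = 1 := by
      rw [hF p hp x hpos, div_eq_one_iff_eq (by positivity), hwx, hxo]
      simp only [mulVec_add, dotProduct_add, add_dotProduct, D.dual_dotProduct hp,
        D.dotProduct_dual hp u, D.dual_dotProduct' hp u, hu]
      ring
    have h1 := hE x hpos
    rw [D.ricciCurvature_eq_dotProduct hK hF hp hpos, hFx, one_smul, hx, add_sub_cancel_right,
      one_pow, mul_one] at h1
    exact h1
  -- If w(u) ≤ -1, then -u is covered instead, and a quadratic form is even.
  have hunit' : ∀ u : Fin n → ℝ, u ⬝ᵥ g p *ᵥ u = 1 → u ⬝ᵥ ricciMatrix g p *ᵥ u = σ := fun u hu => by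
    rcases lt_or_ge (-1) (∑ i, w i p * u i) with h1 | h1
    · exact hunit u hu h1
    · have h2 := hunit (-u) (by simpa [mulVec_neg] using hu) (by
        have : ∑ i, w i p * (-u) i = - ∑ i, w i p * u i := by
          rw [← Finset.sum_neg_distrib]
          exact Finset.sum_congr rfl fun i _ => by rw [Pi.neg_apply]; ring
        rw [this]; linarith)
      simpa [mulVec_neg] using h2
  rcases eq_or_ne v 0 with h0 | h0
  · simp [h0]
  set q := v ⬝ᵥ g p *ᵥ v with hq
  have hqpos : 0 < q := (D.metric.posDef p hp).dotProduct_pos h0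
  have hsq : √q ≠ 0 := (Real.sqrt_pos.mpr hqpos).ne'
  have hsq2 := Real.mul_self_sqrt hqpos.le
  have h1 := hunit' ((√q)⁻¹ • v) (by
    rw [mulVec_smul, dotProduct_smul, smul_dotProduct, ← hq, smul_eq_mul, smul_eq_mul]
    nth_rewrite 3 [← hsq2]
    field_simp)
  rw [mulVec_smul, dotProduct_smul, smul_dotProduct, smul_eq_mul, smul_eq_mul] at h1
  have h2 : v ⬝ᵥ ricciMatrix g p *ᵥ v = σ * (√q * √q) := by rw [← h1]; field_simp
  rw [h2, hsq2]

end LocalData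

end Kropina

end

/-! ### Charts, and the navigation data on the manifold -/

noncomputable section

open Matrix TopologicalSpace

namespace Kropina

variable {n : ℕ} {M : Type*} [TopologicalSpace M] [ChartedSpace (E n) M]
  {e : OpenPartialHomeomorph M (E n)}

lemma ofCoord_eq_sum (e : OpenPartialHomeomorph M (E n)) (p v : E n) :
    ofCoord e p v = ∑ i, v i • ofCoord e p (EuclideanSpace.single i 1) := by
  have h1 : v = ∑ i, v i • EuclideanSpace.single i (1 : ℝ) := by
    ext j; simp [Finset.sum_apply, Pi.single_apply]
  conv_lhs => rw [h1]
  exact (map_sum (mfderiv (𝓡 n) (𝓡 n) e.symm p) _ _).trans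
    (Finset.sum_congr rfl fun i _ => map_smul (mfderiv (𝓡 n) (𝓡 n) e.symm p) _ _)

section Chart

variable (he : e ∈ IsManifold.maximalAtlas (𝓡 n) ∞ M)

include he

lemma mdifferentiable_of_mem : e.MDifferentiable (𝓡 n) (𝓡 n) :=
  ⟨(contMDiffOn_of_mem_maximalAtlas he).mdifferentiableOn (by simp),
    (contMDiffOn_symm_of_mem_maximalAtlas he).mdifferentiableOn (by simp)⟩

lemma ofCoord_injective {p : E n} (hp : p ∈ e.target) : Function.Injective (ofCoord e p) := by
  have h1 := (mdifferentiable_of_mem he).comp_symm_deriv hp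
  intro v u hvu
  have h2 := congrArg (fun f => f v) h1
  have h3 := congrArg (fun f => f u) h1
  have h4 : mfderiv (𝓡 n) (𝓡 n) e (e.symm p) (ofCoord e p v) = v := h2
  have h5 : mfderiv (𝓡 n) (𝓡 n) e (e.symm p) (ofCoord e p u) = u := h3
  rw [← h4, ← h5, hvu]

lemma exists_ofCoord {p : E n} (hp : p ∈ e.target) (y : TangentSpace (𝓡 n) (e.symm p)) :
    ∃ v, ofCoord e p v = y := by
  let L : E n →L[ℝ] E n := mfderiv (𝓡 n) (𝓡 n) e.symm p
  have hL : Function.Injective L.toLinearMap := ofCoord_injective he hp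
  exact LinearMap.injective_iff_surjective.mp hL y

variable [IsManifold (𝓡 n) ∞ M]

/-- Coordinate vector fields are smooth. -/
lemma contMDiffAt_ofCoord {p : E n} (hp : p ∈ e.target) (v : E n) :
    ContMDiffAt (𝓡 n) (𝓡 n).tangent ∞
      (fun q => (⟨e.symm q, ofCoord e q v⟩ : TangentBundle (𝓡 n) M)) p := by
  have h1 := (contMDiffOn_symm_of_mem_maximalAtlas he).contMDiffOn_tangentMapWithin (m := ∞) le_rfl
    e.open_target.uniqueMDiffOn
  have h2 : ContMDiffAt (𝓡 n) (𝓡 n).tangent ∞ (fun q => (⟨q, v⟩ : TangentBundle (𝓡 n) (E n))) p :=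
    contMDiffAt_vectorSpace_iff_contDiffAt.mpr contDiffAt_const
  have h3 : ContMDiffAt (𝓡 n).tangent (𝓡 n).tangent ∞
      (tangentMapWithin (𝓡 n) (𝓡 n) e.symm e.target) ⟨p, v⟩ :=
    h1.contMDiffAt ((e.open_target.preimage (FiberBundle.continuous_proj _ _)).mem_nhds hp)
  refine (h3.comp p h2).congr_of_eventuallyEq ?_
  filter_upwards [e.open_target.mem_nhds hp] with q hq
  simp only [Function.comp, tangentMapWithin, mfderivWithin_of_isOpen e.open_target hq]
  rfl

lemma contDiffAt_inner (h : Metric (n := n) M) {p : E n} (hp : p ∈ e.target)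
    {X Y : ∀ q : E n, TangentSpace (𝓡 n) (e.symm q)}
    (hX : ContMDiffAt (𝓡 n) (𝓡 n).tangent ∞
      (fun q => (⟨e.symm q, X q⟩ : TangentBundle (𝓡 n) M)) p)
    (hY : ContMDiffAt (𝓡 n) (𝓡 n).tangent ∞
      (fun q => (⟨e.symm q, Y q⟩ : TangentBundle (𝓡 n) M)) p) :
    ContDiffAt ℝ ∞ (fun q => h.inner (e.symm q) (X q) (Y q)) p := by
  have he' : ContMDiffAt (𝓡 n) (𝓡 n) ∞ e.symm p :=
    (contMDiffOn_symm_of_mem_maximalAtlas he).contMDiffAt (e.open_target.mem_nhds hp)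
  have h1 := (h.contMDiff (e.symm p)).comp p he'
  have h2 : ContMDiffAt (𝓡 n) ((𝓡 n).prod 𝓘(ℝ)) ∞ (fun q => Bundle.TotalSpace.mk' ℝ
    (E := Bundle.Trivial M ℝ) (e.symm q) (h.inner (e.symm q) (X q) (Y q))) p :=
    ContMDiffAt.clm_bundle_apply₂ (F₁ := E n) (F₂ := E n) h1 hX hY
  rw [Bundle.contMDiffAt_totalSpace] at h2
  exact h2.2.contDiffAt

end Chart

variable [IsManifold (𝓡 n) ∞ M]

lemma inner_ofCoord_right (h : Metric (n := n) M) (e : OpenPartialHomeomorph M (E n)) (p v : E n)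
    (y : TangentSpace (𝓡 n) (e.symm p)) : h.inner (e.symm p) y (ofCoord e p v) =
      ∑ i, h.inner (e.symm p) y (ofCoord e p (EuclideanSpace.single i 1)) * v i := by
  rw [ofCoord_eq_sum, map_sum]
  exact Finset.sum_congr rfl fun i _ => by rw [map_smul, smul_eq_mul, mul_comm]

lemma inner_ofCoord (h : Metric (n := n) M) (e : OpenPartialHomeomorph M (E n)) (p v u : E n) :
    h.inner (e.symm p) (ofCoord e p v) (ofCoord e p u) =
      v.ofLp ⬝ᵥ metricCoord h e p *ᵥ u.ofLp := by
  rw [h.symm, inner_ofCoord_right]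
  simp only [dotProduct]
  refine Finset.sum_congr rfl fun i _ => ?_
  rw [h.symm, inner_ofCoord_right, mul_comm]
  rfl

lemma inner_field_ofCoord (h : Metric (n := n) M) (W : VField (n := n) M)
    (e : OpenPartialHomeomorph M (E n)) (p v : E n) :
    h.inner (e.symm p) (W (e.symm p)) (ofCoord e p v) = ∑ i, lowerCoord h W e i p * v i :=
  inner_ofCoord_right h e p v _

/-- The target of a chart. -/
def chartTarget (e : OpenPartialHomeomorph M (E n)) : Opens (E n) := ⟨e.target, e.open_target⟩

lemma sq_norm (h : Metric (n := n) M) (x : M) (y : TangentSpace (𝓡 n) x) :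
    h.norm x y ^ 2 = h.inner x y y := by
  refine Real.sq_sqrt ?_
  rcases eq_or_ne y 0 with rfl | hy
  · simp
  · exact (h.pos x y hy).le

lemma sq_inChart_norm (h : Metric (n := n) M) (e : OpenPartialHomeomorph M (E n)) (p v : E n) :
    inChart e h.norm p v ^ 2 = v.ofLp ⬝ᵥ metricCoord h e p *ᵥ v.ofLp :=
  (sq_norm h _ _).trans (inner_ofCoord h e p v v)

lemma mulVec_lowerCoord (h : Metric (n := n) M) (W : VField (n := n) M) {p : E n} {u : E n}
    (hu : ofCoord e p u = W (e.symm p)) :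
    metricCoord h e p *ᵥ u.ofLp = fun i => lowerCoord h W e i p := by
  ext i
  rw [lowerCoord, ← hu, h.symm, inner_ofCoord_right]
  rfl

section LocalData

variable (h : Metric (n := n) M) (he : e ∈ IsManifold.maximalAtlas (𝓡 n) ∞ M)

include he

lemma localMetric_metricCoord : LocalMetric (chartTarget e) (metricCoord h e) where
  smooth i j p hp := contDiffAt_inner he h hp (contMDiffAt_ofCoord he hp _)
    (contMDiffAt_ofCoord he hp _)
  posDef p hp := by
    refine Matrix.PosDef.of_dotProduct_mulVec_pos ?_ fun v hv => ?_
    · ext i j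
      exact h.symm _ _ _
    · have h1 := inner_ofCoord h e p (WithLp.toLp 2 v) (WithLp.toLp 2 v)
      rw [star_trivial]
      change 0 < (WithLp.toLp 2 v).ofLp ⬝ᵥ metricCoord h e p *ᵥ (WithLp.toLp 2 v).ofLp
      rw [← h1]
      refine h.pos _ _ fun h0 => hv ?_
      have h2 : ofCoord e p 0 = 0 := map_zero (mfderiv (𝓡 n) (𝓡 n) e.symm p)
      exact congrArg WithLp.ofLp (ofCoord_injective he hp (h0.trans h2.symm))

lemma ofCoord_dual (W : VField (n := n) M) {p : E n} (hp : p ∈ e.target) :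
    ofCoord e p (dual (metricCoord h e) (lowerCoord h W e) p) = W (e.symm p) := by
  obtain ⟨u, hu⟩ := exists_ofCoord he hp (W (e.symm p))
  rw [← hu]
  congr 1
  rw [dual, ← mulVec_lowerCoord h W hu, mulVec_mulVec,
    nonsing_inv_mul _ ((localMetric_metricCoord h he).isUnit_det hp), one_mulVec]

lemma localData_lowerCoord {W : VField (n := n) M} (hW : IsUnitField h W) :
    LocalData (chartTarget e) (metricCoord h e) (lowerCoord h W e) where
  metric := localMetric_metricCoord h he
  smooth i p hp := contDiffAt_inner he h hp
    ((W.contMDiff (e.symm p)).comp p ((contMDiffOn_symm_of_mem_maximalAtlas he).contMDiffAt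
      (e.open_target.mem_nhds hp))) (contMDiffAt_ofCoord he hp _)
  unit p hp := by
    have h1 := inner_field_ofCoord h W e p (dual (metricCoord h e) (lowerCoord h W e) p)
    rw [ofCoord_dual h he W hp, ← sq_norm, hW, one_pow] at h1
    exact h1.symm

end LocalData

section Navigation

variable {a : Metric (n := n) M} {β : OneForm (n := n) M} {h : Metric (n := n) M}
  {W : VField (n := n) M} (hnav : IsNavigationData a β h W)

include hnav

/-- Expand ‖y/F - W‖² = 1 using ‖W‖ = 1, and multiply by F². -/
lemma inner_self_eq_of_navigation {x : M} {y : TangentSpace (𝓡 n) x} (hy : 0 < β x y) :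
    0 < kropina a β x y ∧ h.inner x y y = 2 * kropina a β x y * h.inner x (W x) y := by
  have hy0 : y ≠ 0 := by
    rintro rfl
    simp at hy
  have hF : 0 < kropina a β x y := by
    rw [kropina, sq_norm]
    exact div_pos (a.pos x y hy0) hy
  refine ⟨hF, ?_⟩
  have h1 := hnav.2 x y hy
  have h2 : h.inner x (W x) (W x) = 1 := by rw [← sq_norm, hnav.1, one_pow]
  set k := kropina a β x y
  have h3 : h.inner x (k⁻¹ • y - W x) (k⁻¹ • y - W x) = 1 := by rw [← sq_norm, h1, one_pow]
  simp only [map_sub, map_smul, _root_.sub_apply, _root_.smul_apply, h2,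
    smul_eq_mul, h.symm x y (W x)] at h3
  field_simp at h3
  linear_combination h3

lemma kropina_eq_of_navigation {x : M} {y : TangentSpace (𝓡 n) x} (hy : 0 < β x y) :
    0 < h.inner x (W x) y ∧ kropina a β x y = h.inner x y y / (2 * h.inner x (W x) y) := by
  obtain ⟨hF, h1⟩ := inner_self_eq_of_navigation hnav hy
  have hy0 : y ≠ 0 := by
    rintro rfl
    simp at hy
  have h2 := h.pos x y hy0
  have h3 : 0 < h.inner x (W x) y := by
    rw [h1] at h2
    exact pos_of_mul_pos_right h2 (by positivity)
  refine ⟨h3, ?_⟩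
  rw [h1]
  field_simp

/-- The domain of a Kropina metric in terms of the navigation data. -/
lemma domain_iff_of_navigation (hβ : ∀ x, β x ≠ 0) {x : M} {y : TangentSpace (𝓡 n) x} :
    0 < β x y ↔ 0 < h.inner x (W x) y := by
  refine ⟨fun hy => (kropina_eq_of_navigation hnav hy).1, fun hy => ?_⟩
  by_contra! hneg
  -- If β(y) < 0, then -y lies in the domain, so h(W,y) < 0. If β(y) = 0, a vector z with β(z) > 0
  -- can be moved along y until h(W,·) vanishes on it without leaving the domain. Both are
  -- impossible.
  rcases hneg.lt_or_eq with h1 | h1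
  · have h2 := (kropina_eq_of_navigation hnav (x := x) (y := -y)
      (by rw [map_neg]; exact neg_pos.mpr h1)).1
    rw [map_neg] at h2
    linarith
  · obtain ⟨z, hz⟩ : ∃ z, 0 < β x z := by
      obtain ⟨z, hz⟩ : ∃ z, β x z ≠ 0 := by
        by_contra! h0
        exact hβ x (ContinuousLinearMap.ext h0)
      rcases hz.lt_or_gt with h2 | h2
      · exact ⟨-z, by rw [map_neg]; exact neg_pos.mpr h2⟩
      · exact ⟨z, h2⟩
    have h2 := (kropina_eq_of_navigation hnav (x := x)
      (y := z - (h.inner x (W x) z / h.inner x (W x) y) • y) (by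
        rw [map_sub, map_smul, h1, smul_zero, sub_zero]; exact hz)).1
    rw [map_sub, map_smul, smul_eq_mul, div_mul_cancel₀ _ hy.ne'] at h2
    linarith

lemma mem_kropinaDomain_iff (hβ : ∀ x, β x ≠ 0) {p v : E n} :
    ofCoord e p v ∈ kropinaDomain β (e.symm p) ↔ 0 < ∑ i, lowerCoord h W e i p * v i := by
  rw [← inner_field_ofCoord]
  exact domain_iff_of_navigation hnav hβ

lemma isKropina_inChart (hβ : ∀ x, β x ≠ 0) :
    LocalData.IsKropina (chartTarget e) (metricCoord h e) (lowerCoord h W e)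
      (inChart e (kropina a β)) := fun p _ v hv => by
  have h1 := (kropina_eq_of_navigation hnav ((mem_kropinaDomain_iff hnav hβ).mpr hv)).2
  rw [inner_field_ofCoord, inner_ofCoord] at h1
  exact h1

end Navigation

end Kropina

end

/-! ### From charts to the manifold, and the theorem -/

noncomputable section

open Matrix TopologicalSpace

namespace Kropina

variable {n : ℕ} {M : Type*} [TopologicalSpace M] [ChartedSpace (E n) M] [IsManifold (𝓡 n) ∞ M]

/-- In every chart the Ricci tensor of `h`, as a quadratic form, is `δ h`. -/
def IsEinsteinTensor (h : Metric (n := n) M) (δ : M → ℝ) : Prop :=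
  ∀ e ∈ IsManifold.maximalAtlas (𝓡 n) ∞ M, ∀ p ∈ e.target, ∀ v : Fin n → ℝ,
    v ⬝ᵥ ricciMatrix (metricCoord h e) p *ᵥ v = δ (e.symm p) * (v ⬝ᵥ metricCoord h e p *ᵥ v)

/-- In a chart the Ricci curvature of √h is the quadratic form of the Ricci tensor; the excluded
zero vector imposes no condition. -/
lemma isEinsteinWith_norm_iff {h : Metric (n := n) M} {δ : M → ℝ} :
    IsEinsteinWith (slitDomain M) h.norm δ ↔ IsEinsteinTensor h δ := by
  have key : ∀ e ∈ IsManifold.maximalAtlas (𝓡 n) ∞ M, ∀ p ∈ e.target, ∀ v : E n,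
      ricciCurvature (inChart e h.norm) p v =
        v.ofLp ⬝ᵥ ricciMatrix (metricCoord h e) p *ᵥ v.ofLp := fun e he p hp v => by
    rw [(localMetric_metricCoord h he).ricciCurvature_eq
      (fun p _ v => sq_inChart_norm h e p v) hp v, ← sum_ricciTensor]
  refine ⟨fun H e he p hp v => ?_, fun H e he p hp v _ => ?_⟩
  · rcases eq_or_ne v 0 with rfl | hv
    · simp
    have h1 := H e he p hp (WithLp.toLp 2 v) fun h0 => hv (by
      have h2 : ofCoord e p 0 = 0 := map_zero (mfderiv (𝓡 n) (𝓡 n) e.symm p)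
      exact congrArg WithLp.ofLp (ofCoord_injective he hp (h0.trans h2.symm)))
    rw [key e he p hp, sq_inChart_norm] at h1
    exact h1
  · rw [key e he p hp, sq_inChart_norm]
    exact H e he p hp v.ofLp

section Navigation

variable {a : Metric (n := n) M} {β : OneForm (n := n) M} {h : Metric (n := n) M}
  {W : VField (n := n) M} (hnav : IsNavigationData a β h W) (hβ : ∀ x, β x ≠ 0)

include hnav hβ

lemma isKilling_of_isEinsteinWith (hn : 2 ≤ n) {σ : M → ℝ}
    (hE : IsEinsteinWith (kropinaDomain β) (kropina a β) σ) : IsKilling h W :=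
  fun e he p hp i j => (localData_lowerCoord h he hnav.1).killing_of_einstein
    (isKropina_inChart hnav hβ) hn hp
    (fun v hv => hE e he p hp v ((mem_kropinaDomain_iff hnav hβ).mpr hv)) i j

/-- The comparison is made point by point with the same scalar on both sides, which is what yields σ
= δ. -/
lemma isEinsteinWith_kropina_iff (hK : IsKilling h W) {σ : M → ℝ} :
    IsEinsteinWith (kropinaDomain β) (kropina a β) σ ↔ IsEinsteinTensor h σ :=
  ⟨fun hE e he p hp => (localData_lowerCoord h he hnav.1).quadratic_of_einstein (hK e he)
      (isKropina_inChart hnav hβ) hp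
      (fun _ hv => hE e he p hp _ ((mem_kropinaDomain_iff hnav hβ).mpr hv)),
    fun H e he p hp _ hv => (localData_lowerCoord h he hnav.1).ricciCurvature_of_quadratic
      (hK e he) (isKropina_inChart hnav hβ) hp (H e he p hp)
      ((mem_kropinaDomain_iff hnav hβ).mp hv)⟩

end Navigation

/-- The Einstein scalar of a metric with a unit Killing field is unique and nonnegative. -/
lemma IsEinsteinTensor.eq_and_nonneg {h : Metric (n := n) M} {W : VField (n := n) M}
    (hW : IsUnitField h W) (hK : IsKilling h W) {σ δ : M → ℝ} (hσ : IsEinsteinTensor h σ)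
    (hδ : IsEinsteinTensor h δ) (x : M) : σ x = δ x ∧ 0 ≤ δ x := by
  have he : chartAt (E n) x ∈ IsManifold.maximalAtlas (𝓡 n) ∞ M := IsManifold.chart_mem_maximalAtlas x
  have hp := mem_chart_target (E n) x
  set e := chartAt (E n) x
  have D := localData_lowerCoord h he hW
  have hx : e.symm (e x) = x := e.left_inv (mem_chart_source (E n) x)
  -- Evaluated on W, where h(W,W) = 1, the Einstein equation reads scalar = Ric(W,W); this gives
  -- both uniqueness and the sign.
  have h1 := hσ e he _ hp (dual (metricCoord h e) (lowerCoord h W e) (e x)).ofLp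
  have h2 := hδ e he _ hp (dual (metricCoord h e) (lowerCoord h W e) (e x)).ofLp
  have h3 := D.ricciTensor_dual_nonneg (hK e he) hp
  rw [sum_ricciTensor] at h3
  rw [D.dual_dotProduct hp, hx, mul_one] at h1 h2
  exact ⟨h1.symm.trans h2, h2 ▸ h3⟩

/-- Schur's lemma. -/
lemma IsEinsteinTensor.isLocallyConstant (hn : 3 ≤ n) {h : Metric (n := n) M} {δ : M → ℝ}
    (hδ : IsEinsteinTensor h δ) : IsLocallyConstant δ := by
  refine (IsLocallyConstant.iff_eventually_eq δ).mpr fun x => ?_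
  have he : chartAt (E n) x ∈ IsManifold.maximalAtlas (𝓡 n) ∞ M := IsManifold.chart_mem_maximalAtlas x
  have hp := mem_chart_target (E n) x
  have hs := mem_chart_source (E n) x
  set e := chartAt (E n) x
  have hL := localMetric_metricCoord h he
  have hd : ∀ p ∈ e.target, HasFDerivAt (fun p => δ (e.symm p)) (0 : E n →L[ℝ] ℝ) p :=
    fun p hp => hL.schur hn
      (fun p hp i j => hL.ricciTensor_eq hp (hδ e he p hp) i j) hp
  -- On a ball inside the chart target, which is convex, a function with zero differential is
  -- constant.
  obtain ⟨r, hr, hball⟩ := Metric.isOpen_iff.mp e.open_target _ hp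
  have hconst : ∀ p ∈ Metric.ball (e x) r, δ (e.symm p) = δ (e.symm (e x)) := fun p hpb =>
    Metric.isOpen_ball.is_const_of_fderiv_eq_zero (𝕜 := ℝ) (convex_ball _ _).isPreconnected
      (fun q hq => (hd q (hball hq)).differentiableAt.differentiableWithinAt)
      (fun q hq => (hd q (hball hq)).fderiv) hpb (Metric.mem_ball_self hr)
  filter_upwards [e.open_source.mem_nhds hs,
    (e.continuousAt hs).preimage_mem_nhds (Metric.ball_mem_nhds _ hr)] with y hy hy2
  have h1 := hconst _ hy2
  rwa [e.left_inv hy, e.left_inv hs] at h1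

end Kropina

end

open Kropina in
theorem theorem1p2 {n : ℕ} (hn : 2 ≤ n) {M : Type*} [TopologicalSpace M]
    [ChartedSpace (EuclideanSpace ℝ (Fin n)) M] [IsManifold (𝓡 n) ∞ M]
    (a : Kropina.Metric (n := n) M) (β : OneForm (n := n) M) (hβ : ∀ x, β x ≠ 0)
    (h : Kropina.Metric (n := n) M) (W : VField (n := n) M) (hnav : IsNavigationData a β h W) :
    (IsEinstein (kropinaDomain β) (kropina a β) ↔
      IsEinstein (slitDomain M) h.norm ∧ IsUnitField h W ∧ IsKilling h W) ∧
    (∀ σ δ : M → ℝ, IsEinsteinWith (kropinaDomain β) (kropina a β) σ →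
      IsEinsteinWith (slitDomain M) h.norm δ → ∀ x, σ x = δ x ∧ 0 ≤ δ x) ∧
    (3 ≤ n → PreconnectedSpace M → IsEinstein (kropinaDomain β) (kropina a β) →
      IsRicciConstant (kropinaDomain β) (kropina a β)) := by
  refine ⟨⟨fun ⟨σ, hσ⟩ => ?_, fun ⟨⟨δ, hδ⟩, _, hK⟩ => ?_⟩, fun σ δ hσ hδ => ?_, fun hn3 _ hE => ?_⟩
  · have hK := isKilling_of_isEinsteinWith hnav hβ hn hσ
    exact ⟨⟨σ, isEinsteinWith_norm_iff.mpr ((isEinsteinWith_kropina_iff hnav hβ hK).mp hσ)⟩,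
      hnav.1, hK⟩
  · exact ⟨δ, (isEinsteinWith_kropina_iff hnav hβ hK).mpr (isEinsteinWith_norm_iff.mp hδ)⟩
  · have hK := isKilling_of_isEinsteinWith hnav hβ hn hσ
    exact IsEinsteinTensor.eq_and_nonneg hnav.1 hK ((isEinsteinWith_kropina_iff hnav hβ hK).mp hσ)
      (isEinsteinWith_norm_iff.mp hδ)
  · obtain ⟨σ, hσ⟩ := hE
    have hK := isKilling_of_isEinsteinWith hnav hβ hn hσ
    have hlc := ((isEinsteinWith_kropina_iff hnav hβ hK).mp hσ).isLocallyConstant hn3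
    rcases isEmpty_or_nonempty M with hM | ⟨⟨x⟩⟩
    -- A preconnected M may be empty, and then any constant serves.
    · exact ⟨0, fun e _ p _ => (hM.false (e.symm p)).elim⟩
    · have h1 : σ = fun _ => σ x := funext fun y => hlc.apply_eq_of_preconnectedSpace y x
      exact ⟨σ x, h1 ▸ hσ⟩
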